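/- Let $k$ be a perfect field of characteristic $p>0$ with Frobenius $\sigma$; a $k$-variety is an integral separated scheme of finite type over $k$. Let $S$ be a smooth $k$-variety with absolute Frobenius $F_S$, let $q:S'=S\times_{k,\sigma}k\to S$ be the projection, $F_{S/k}:S\to S'$ the relative Frobenius, and fix a lifting $(\tilde S,\tilde F_S)$ of $(S,F_S)$ to $W_2(k)$, with $\tilde S$ smooth over $W_2(k)$ and $\tilde F_S$ linear over $W_2(\sigma)$. Let $\tilde F:\tilde S\to\tilde S'=\tilde S\times_{W_2(k),W_2(\sigma)}W_2(k)$ be the induced lifting of $F_{S/k}$, and let $\zeta:T_S\to F_{S/k}^*T_{S'}=F_S^*T_S$ be the dual of $d\tilde F/[p]$. For $S\to T$ smooth and a morphism of $T$-schemes $f:X\to S$, a $\lambda$-connection on $f$ is an $\mathcal O_X$-linear map $\nabla:f^*T_{S/T}\to T_{X/T}$ whose composite with $T_{X/T}\to f^*T_{S/T}$ is $\lambda\cdot\mathrm{id}$; it is integrable if $[\nabla D,\nabla E]=\lambda\nabla[D,E]$ for local sections $D,E$ of $T_{S/T}$. A connection is a $1$-connection, a Higgs field a $0$-connection. A transversal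 foliated (resp. Higgs) $S$-variety is a morphism $f:X\to S$ of $k$-varieties with an integrable connection (resp. Higgs field) relative to $k$. A Higgs field $\theta$ is nilpotent if $[p]^n\circ\theta=0$ for some $n$, where $[p]$ is the $p$-th power map of derivations and $[p]^n\circ\theta$ is regarded as a $p^n$-linear map on $T_S$. For a nilpotent Higgs $S'$-variety $(g:Y\to S',\theta')$ let $\pi:X=Y\times_{S',F_{S/k}}S\to Y$ and $f:X\to S$ be the projections. Let $\nabla_{can}$ be the connection on $f$ whose image annihilates $\mathcal O_Y$, and put $$C^{-1}(g,\theta')=\Big(f,\ \nabla_{can}-\sum_{n\ge0}[p]^n\circ(\pi^*\theta'\circ f^*\zeta)\circ(f^*\zeta)^n\Big),$$ where the $p^n$-linear maps $[p]^n\circ(\pi^*\theta'\circ f^*\zeta)$ are extended linearly to Frobenius pullbacks. A geometric strict $p$-torsion nonlinear Fontaine module over $S$ is a quadruple $(f,\nabla,Fil,\varphi)$ with the following data and properties. $(f:X\to S,\nabla)$ is a transversal foliated $S$-variety with $f$ flat. $Fil$ is a flat morphism $\tilde f:\mathscr X\to\mathbb A^1_S$ whose fibre over $t=1$ is $f$,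 with a $\mathbb G_m$-action on $\mathscr X$ covering the standard action on $\mathbb A^1_S$. $\nabla$ extends to a $\mathbb G_m$-equivariant $t$-connection $\tilde\nabla:\tilde f^*T_{\mathbb A^1_S/\mathbb A^1}\to T_{\mathscr X/\mathbb A^1}$, where the coordinate $t$ has weight one, i.e. $\tilde\nabla_{ay}=a\cdot a_*\tilde\nabla_y$ on vector fields coming from $S$, for $a\in\mathbb G_m$. With $f_0:X_0\to S$ the fibre of $\tilde f$ over $t=0$ $(=p)$ and $\theta=\tilde\nabla|_{X_0}$, one has $[p]\circ\theta=0$. Finally $\varphi:X\to X_0$ is a morphism with $f_0\circ\varphi=F_S\circ f$ that induces an isomorphism $\psi:X\to F_S^*X_0$ and satisfies the parallelism condition $d\varphi\circ\nabla=\varphi^*\theta\circ f^*\zeta$. **Proposition 6.5.** Let $(f,\nabla,Fil,\varphi)$ be a geometric strict $p$-torsion nonlinear Fontaine module over $S$. Then $(f_0,-\theta)$ is a nilpotent Higgs $S$-variety, $q^*(f_0,-\theta)$ is a nilpotent Higgs $S'$-variety, its transform $C^{-1}q^*(f_0,-\theta)$ exists, is uniquely determined by the above description and is a transversal foliated $S$-variety,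 and the morphism induced by $\varphi$ is an isomorphism of transversal foliated $S$-varieties $$(f,\nabla)\cong C^{-1}q^*(f_0,-\theta).$$ Explicitly, $\psi$ identifies $X$ with $F_S^*X_0$ over $S$, and $\nabla$ with $\nabla_{can}+\pi^*\theta\circ\zeta$, where $\pi:F_S^*X_0\to X_0$ is the projection and $\nabla_{can}$ is the canonical connection on $F_S^*X_0\to S$. -/

import Mathlib

open CategoryTheory CategoryTheory.Limits AlgebraicGeometry TopologicalSpace

universe u

namespace NFM

/-! ### Vector fields and derivations along a morphism -/

/-- A section over the open `V ⊆ X` of the relative tangent sheaf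
`T_{X/T} = Hom(Ω_{X/T}, O_X) = Der_{O_T}(O_X, O_X)`, where `g : X ⟶ T`: a derivation of the sheaf
of rings `O_V`, linear over the inverse image of `O_T`. -/
@[ext]
structure VectorField {X T : Scheme.{u}} (g : X ⟶ T) (V : X.Opens) where
  app : ∀ W : X.Opens, W ≤ V → Γ(X, W) → Γ(X, W)
  map_add : ∀ W hW x y, app W hW (x + y) = app W hW x + app W hW y
  leibniz : ∀ W hW x y, app W hW (x * y) = x * app W hW y + y * app W hW x
  map_base : ∀ (W : X.Opens) (hW : W ≤ V) (U : T.Opens) (hU : W ≤ g ⁻¹ᵁ U) (a : Γ(T, U)),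
    app W hW ((g.appLE U W hU).hom a) = 0
  map_res : ∀ (W W' : X.Opens) (h : W' ≤ W) (hW : W ≤ V) (x : Γ(X, W)),
    app W' (h.trans hW) ((X.presheaf.map (homOfLE h).op).hom x) =
      (X.presheaf.map (homOfLE h).op).hom (app W hW x)

namespace VectorField

variable {X T : Scheme.{u}} {g : X ⟶ T} {V : X.Opens}

instance : Zero (VectorField g V) where
  zero :=
    { app := fun _ _ _ => 0
      map_add := fun _ _ _ _ => by simp
      leibniz := fun _ _ _ _ => by simp
      map_base := fun _ _ _ _ _ => rfl
      map_res := fun _ _ _ _ _ => by simp }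

instance : Add (VectorField g V) where
  add D E :=
    { app := fun W hW x => D.app W hW x + E.app W hW x
      map_add := fun W hW x y => by rw [D.map_add, E.map_add]; ring
      leibniz := fun W hW x y => by rw [D.leibniz, E.leibniz]; ring
      map_base := fun W hW U hU a => by rw [D.map_base, E.map_base, add_zero]
      map_res := fun W W' h hW x => by rw [D.map_res, E.map_res, _root_.map_add] }

instance : Neg (VectorField g V) where
  neg D :=
    { app := fun W hW x => - D.app W hW x
      map_add := fun W hW x y => by rw [D.map_add]; ring
      leibniz := fun W hW x y => by rw [D.leibniz]; ring
      map_base := fun W hW U hU a => by rw [D.map_base, neg_zero]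
      map_res := fun W W' h hW x => by rw [D.map_res, _root_.map_neg] }

instance : SMul Γ(X, V) (VectorField g V) where
  smul c D :=
    { app := fun W hW x => (X.presheaf.map (homOfLE hW).op).hom c * D.app W hW x
      map_add := fun W hW x y => by rw [D.map_add]; ring
      leibniz := fun W hW x y => by rw [D.leibniz]; ring
      map_base := fun W hW U hU a => by rw [D.map_base, mul_zero]
      map_res := fun W W' h hW x => by
        rw [D.map_res (hW := hW), _root_.map_mul]
        congr 1
        rw [← CommRingCat.comp_apply, ← X.presheaf.map_comp]
        rfl }

/-- The restriction of a vector field to a smaller open. -/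
def restrict (D : VectorField g V) {V' : X.Opens} (h : V' ≤ V) : VectorField g V' where
  app W hW := D.app W (hW.trans h)
  map_add W hW := D.map_add W (hW.trans h)
  leibniz W hW := D.leibniz W (hW.trans h)
  map_base W hW := D.map_base W (hW.trans h)
  map_res W W' h' hW := D.map_res W W' h' (hW.trans h)

lemma app_zero (D : VectorField g V) (W hW) : D.app W hW 0 = 0 := by
  have := D.map_add W hW 0 0
  simpa using this

lemma app_sub (D : VectorField g V) (W hW x y) :
    D.app W hW (x - y) = D.app W hW x - D.app W hW y := by
  have := D.map_add W hW (x - y) y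
  rw [sub_add_cancel] at this
  rw [this]; ring

/-- The Lie bracket `[D, E] = D ∘ E - E ∘ D`. -/
def bracket (D E : VectorField g V) : VectorField g V where
  app W hW x := D.app W hW (E.app W hW x) - E.app W hW (D.app W hW x)
  map_add W hW x y := by simp only [D.map_add, E.map_add]; ring
  leibniz W hW x y := by simp only [D.map_add, E.map_add, D.leibniz, E.leibniz]; ring
  map_base W hW U hU a := by rw [D.map_base, E.map_base, D.app_zero, E.app_zero, sub_zero]
  map_res W W' h hW x := by
    rw [D.map_res W W' h hW x, E.map_res W W' h hW x, D.map_res W W' h hW, E.map_res W W' h hW,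
      _root_.map_sub]

end VectorField

/-- A section over the open `V ⊆ X` of the sheaf `Hom(h^* Ω_{Y/T}, O_X) = Der_{O_T}(O_Y, h_* O_X)`,
where `h : X ⟶ Y` and `y : Y ⟶ T`. If `y` is smooth this sheaf is `h^* T_{Y/T}`. -/
@[ext]
structure DerivationAlong {X Y T : Scheme.{u}} (h : X ⟶ Y) (y : Y ⟶ T) (V : X.Opens) where
  app : ∀ (W' : Y.Opens) (W : X.Opens), W ≤ V → W ≤ h ⁻¹ᵁ W' → Γ(Y, W') → Γ(X, W)
  map_add : ∀ W' W hW hW' a b, app W' W hW hW' (a + b) = app W' W hW hW' a + app W' W hW hW' b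
  leibniz : ∀ W' W hW hW' a b, app W' W hW hW' (a * b) =
    (h.appLE W' W hW').hom a * app W' W hW hW' b + (h.appLE W' W hW').hom b * app W' W hW hW' a
  map_base : ∀ W' W hW hW' (U : T.Opens) (hU : W' ≤ y ⁻¹ᵁ U) (a : Γ(T, U)),
    app W' W hW hW' ((y.appLE U W' hU).hom a) = 0
  map_res : ∀ (W₁' W₂' : Y.Opens) (W₁ W₂ : X.Opens) (i : W₂' ≤ W₁') (j : W₂ ≤ W₁)
    (h₁ : W₁ ≤ V) (h₁' : W₁ ≤ h ⁻¹ᵁ W₁') (h₂' : W₂ ≤ h ⁻¹ᵁ W₂') (a : Γ(Y, W₁')),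
    app W₂' W₂ (j.trans h₁) h₂' ((Y.presheaf.map (homOfLE i).op).hom a) =
      (X.presheaf.map (homOfLE j).op).hom (app W₁' W₁ h₁ h₁' a)

/-- The vector field `E` on `V ⊆ X` and the vector field `E'` on `V' ⊆ Y` are related by
`h : X ⟶ Y`: one has `E (h^* b) = h^* (E' b)`, i.e. `dh (E) = h^* E'` in `Der(O_Y, h_* O_X)`. -/
def Related {X Y T T' : Scheme.{u}} (h : X ⟶ Y) {x : X ⟶ T} {y : Y ⟶ T'} {V : X.Opens}
    {V' : Y.Opens} (E : VectorField x V) (E' : VectorField y V') : Prop :=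
  ∀ (W' : Y.Opens) (hW' : W' ≤ V') (W : X.Opens) (hW : W ≤ V) (hWW' : W ≤ h ⁻¹ᵁ W')
    (b : Γ(Y, W')),
    E.app W hW ((h.appLE W' W hWW').hom b) = (h.appLE W' W hWW').hom (E'.app W' hW' b)

/-! ### `λ`-connections -/

/-- A `λ`-connection on `f : X ⟶ S` over `s : S ⟶ T`: an `O_X`-linear map `f^* T_{S/T} → T_{X/T}`
whose composite with `T_{X/T} → f^* T_{S/T}` is multiplication by `λ`. It is given through the
adjoint `O_S`-linear map of sheaves `T_{S/T} → f_* T_{X/T}`. -/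
@[ext]
structure LConnection {X S T : Scheme.{u}} (f : X ⟶ S) (s : S ⟶ T) (lam : Γ(T, ⊤)) where
  toFun : ∀ U : S.Opens, VectorField s U → VectorField (f ≫ s) (f ⁻¹ᵁ U)
  map_add : ∀ U D E, toFun U (D + E) = toFun U D + toFun U E
  map_smul : ∀ (U : S.Opens) (c : Γ(S, U)) (D : VectorField s U),
    toFun U (c • D) = (f.app U).hom c • toFun U D
  map_res : ∀ (U U' : S.Opens) (h : U' ≤ U) (D : VectorField s U),
    toFun U' (D.restrict h) = (toFun U D).restrict (f.preimage_mono h)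
  proj : ∀ (U : S.Opens) (D : VectorField s U) (W : S.Opens) (hW : W ≤ U) (V : X.Opens)
    (hV : V ≤ f ⁻¹ᵁ U) (hVW : V ≤ f ⁻¹ᵁ W) (a : Γ(S, W)),
    (toFun U D).app V hV ((f.appLE W V hVW).hom a) =
      ((f ≫ s).appLE ⊤ V le_top).hom lam * (f.appLE W V hVW).hom (D.app W hW a)

/-- A Higgs field on `f : X ⟶ S`: a `0`-connection `f^* T_{S/T} → T_{X/S}`. -/
abbrev HiggsField {X S T : Scheme.{u}} (f : X ⟶ S) (s : S ⟶ T) := LConnection f s 0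

/-- A connection on `f : X ⟶ S`, i.e. a `1`-connection. -/
abbrev Connection {X S T : Scheme.{u}} (f : X ⟶ S) (s : S ⟶ T) := LConnection f s 1

/-- Integrability `[∇ D, ∇ E] = λ ∇ [D, E]`. For `λ = 1` this says that the curvature
`∧² f^* T_{S/T} → T_{X/T} / im ∇` vanishes, and for `λ = 0` it says `[θ D, θ E] = 0`. -/
def LConnection.Integrable {X S T : Scheme.{u}} {f : X ⟶ S} {s : S ⟶ T} {lam : Γ(T, ⊤)}
    (N : LConnection f s lam) : Prop :=
  ∀ (U : S.Opens) (D E : VectorField s U) (W : X.Opens) (hW : W ≤ f ⁻¹ᵁ U) (x : Γ(X, W)),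
    ((N.toFun U D).bracket (N.toFun U E)).app W hW x =
      ((f ≫ s).appLE ⊤ W le_top).hom lam * (N.toFun U (D.bracket E)).app W hW x

/-- The Higgs field `-θ`. -/
def LConnection.neg {X S T : Scheme.{u}} {f : X ⟶ S} {s : S ⟶ T} (N : HiggsField f s) :
    HiggsField f s where
  toFun U D := - N.toFun U D
  map_add U D E := by
    rw [N.map_add]
    ext W hW x
    exact neg_add _ _
  map_smul U c D := by
    rw [N.map_smul]
    ext W hW x
    exact (mul_neg _ _).symm
  map_res U U' h D := by rw [N.map_res]; rfl
  proj U D W hW V hV hVW a := by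
    have := N.proj U D W hW V hV hVW a
    rw [map_zero, zero_mul] at this ⊢
    exact neg_eq_zero.mpr this

/-- `[p]^n ∘ θ = 0`, where `[p]` is the `p`-th power map of derivations and `[p]^n ∘ θ` is
considered as a (`p^n`-linear) map `T_{S/T} → f_* T_{X/S}`. -/
def LConnection.PowZero {X S T : Scheme.{u}} {f : X ⟶ S} {s : S ⟶ T} (p n : ℕ)
    (θ : HiggsField f s) : Prop :=
  ∀ (U : S.Opens) (D : VectorField s U) (W : X.Opens) (hW : W ≤ f ⁻¹ᵁ U) (x : Γ(X, W)),
    ((θ.toFun U D).app W hW)^[p ^ n] x = 0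

/-- Given a commutative diagram with horizontal maps `gX : X' ⟶ X` and `gS : S' ⟶ S` lying over
some `T' ⟶ T`, the `λ'`-connection `N'` is the base change of the `λ`-connection `N`. As `S / T` is
smooth, `T_{S'/T'}` is generated locally by vector fields that are related to vector fields on `S`,
so `N'` is determined by this for `S' = S ×_T T'` and `X' = X ×_T T'`. -/
def IsBaseChange {X S T X' S' T' : Scheme.{u}} {f : X ⟶ S} {s : S ⟶ T} {lam : Γ(T, ⊤)}
    {f' : X' ⟶ S'} {s' : S' ⟶ T'} {lam' : Γ(T', ⊤)} (gX : X' ⟶ X) (gS : S' ⟶ S)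
    (N : LConnection f s lam) (N' : LConnection f' s' lam') : Prop :=
  ∀ (U : S.Opens) (U' : S'.Opens) (_ : U' ≤ gS ⁻¹ᵁ U) (D : VectorField s U)
    (D' : VectorField s' U'), Related gS D' D → Related gX (N'.toFun U' D') (N.toFun U D)

/-- `h : X ⟶ Y` is an isomorphism `(f, N) ≅ (g, N')` of `S`-schemes with `λ`-connections, i.e. an
isomorphism over `S` with `h^* N' = h_* ∘ N`. -/
structure IsConnectionIso {X Y S T : Scheme.{u}} {f : X ⟶ S} {g : Y ⟶ S} {s : S ⟶ T}
    {lam : Γ(T, ⊤)} (h : X ⟶ Y) (N : LConnection f s lam) (N' : LConnection g s lam) : Prop where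
  isIso : IsIso h
  comm : h ≫ g = f
  related : ∀ (U : S.Opens) (D : VectorField s U), Related h (N.toFun U D) (N'.toFun U D)

/-! ### Varieties -/

/-- A `k`-variety: an integral separated scheme of finite type over `k`. -/
structure IsVariety {k : Type u} [Field k] {X : Scheme.{u}} (x : X ⟶ Spec (.of k)) : Prop where
  isIntegral : IsIntegral X
  isSeparated : IsSeparated x
  locallyOfFiniteType : LocallyOfFiniteType x
  quasiCompact : QuasiCompact x

/-- `(f, ∇)` is a transversal foliated `S`-variety. -/
structure IsFoliatedVariety {k : Type u} [Field k] {X S : Scheme.{u}} {f : X ⟶ S}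
    {s : S ⟶ Spec (.of k)} (N : Connection f s) : Prop where
  isVariety : IsVariety (f ≫ s)
  integrable : N.Integrable

/-- `(f, θ)` is a Higgs `S`-variety with nilpotent Higgs field. -/
structure IsNilpotentHiggsVariety (p : ℕ) {k : Type u} [Field k] {X S : Scheme.{u}} {f : X ⟶ S}
    {s : S ⟶ Spec (.of k)} (θ : HiggsField f s) : Prop where
  isVariety : IsVariety (f ≫ s)
  integrable : θ.Integrable
  nilpotent : ∃ n, θ.PowZero p n

/-! ### Frobenius -/

/-- The `p`-th power endomorphism of a ring in which `p = 0` (possibly the zero ring). -/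
def powHom (p : ℕ) [Fact p.Prime] (R : Type*) [CommRing R] (h : (p : R) = 0) : R →+* R where
  toFun x := x ^ p
  map_one' := one_pow p
  map_mul' x y := mul_pow x y p
  map_zero' := zero_pow (Fact.out : p.Prime).ne_zero
  map_add' x y := by
    rcases subsingleton_or_nontrivial R with _ | _
    · exact Subsingleton.elim _ _
    · have := (CharP.charP_iff_prime_eq_zero (R := R) (Fact.out : p.Prime)).mpr h
      exact add_pow_char x y p

/-- The absolute Frobenius of a scheme in which `p = 0`: the identity on the underlying space and
`a ↦ a ^ p` on the structure sheaf. -/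
noncomputable def absFrobenius (p : ℕ) [Fact p.Prime] (X : Scheme.{u})
    (hX : ∀ U : X.Opens, (p : Γ(X, U)) = 0) : X ⟶ X where
  base := 𝟙 _
  c := { app := fun U => CommRingCat.ofHom (powHom p Γ(X, U.unop) (hX U.unop))
         naturality := fun U V i => by
          ext x
          exact (map_pow (X.presheaf.map i).hom x p).symm }
  prop x := by
    constructor
    intro a ha
    obtain ⟨U, hxU, a, rfl⟩ := X.presheaf.exists_germ_eq a
    have e := PresheafedSpace.stalkMap_germ_apply (X := X.toPresheafedSpace)
      (Y := X.toPresheafedSpace) ⟨𝟙 _, { 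
        app := fun U => CommRingCat.ofHom (powHom p Γ(X, U.unop) (hX U.unop))
        naturality := fun U V i => by
          ext x
          exact (map_pow (X.presheaf.map i).hom x p).symm }⟩ U x hxU a
    erw [e] at ha
    have e2 : (X.presheaf.germ U x hxU).hom (a ^ p) = (X.presheaf.germ U x hxU).hom a ^ p :=
      map_pow _ _ _
    have ha' : IsUnit ((X.presheaf.germ U x hxU).hom (a ^ p)) := ha
    rw [e2] at ha'
    exact (isUnit_pow_iff (Fact.out : p.Prime).ne_zero).mp ha'

lemma natCast_eq_zero (p : ℕ) {k : Type u} [Field k] [CharP k p] {X : Scheme.{u}}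
    (x : X ⟶ Spec (.of k)) (U : X.Opens) : (p : Γ(X, U)) = 0 := by
  have h := map_natCast ((Scheme.ΓSpecIso (.of k)).inv ≫ x.appLE ⊤ U le_top).hom p
  rw [← h]
  have : ((p : ℕ) : k) = 0 := CharP.cast_eq_zero k p
  erw [this]
  exact map_zero _

/-- The absolute Frobenius `F_S` of a `k`-scheme. -/
noncomputable def frob (p : ℕ) [Fact p.Prime] {k : Type u} [Field k] [CharP k p] {S : Scheme.{u}}
    (s : S ⟶ Spec (.of k)) : S ⟶ S :=
  absFrobenius p S (natCast_eq_zero p s)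

/-- `Spec σ`, where `σ : k → k` is the Frobenius. -/
noncomputable def specFrob (k : Type u) [Field k] (p : ℕ) [Fact p.Prime] [CharP k p] :
    Spec (.of k) ⟶ Spec (.of k) :=
  Spec.map (CommRingCat.ofHom (frobenius k p))

lemma frob_comp (p : ℕ) [Fact p.Prime] {k : Type u} [Field k] [CharP k p] {S : Scheme.{u}}
    (s : S ⟶ Spec (.of k)) : frob p s ≫ s = s ≫ specFrob k p := by
  apply ext_to_Spec
  ext a
  have h1 : (s.appTop).hom ((specFrob k p).appTop.hom ((Scheme.ΓSpecIso (.of k)).inv.hom a)) =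
      s.appTop.hom ((Scheme.ΓSpecIso (.of k)).inv.hom (a ^ p)) := by
    congr 1
    exact (DFunLike.congr_fun (congrArg CommRingCat.Hom.hom
      (Scheme.ΓSpecIso_inv_naturality (CommRingCat.ofHom (frobenius k p)))) a).symm
  have h2 : (frob p s).appTop.hom (s.appTop.hom ((Scheme.ΓSpecIso (.of k)).inv.hom a)) =
      s.appTop.hom ((Scheme.ΓSpecIso (.of k)).inv.hom a) ^ p := rfl
  have h3 : (frob p s).appTop.hom (s.appTop.hom ((Scheme.ΓSpecIso (.of k)).inv.hom a)) =
      (s.appTop).hom ((specFrob k p).appTop.hom ((Scheme.ΓSpecIso (.of k)).inv.hom a)) := by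
    rw [h1, h2, ← map_pow, ← map_pow]
  exact h3

/-- The Frobenius twist `S' = S ×_{k, σ} k`. -/
noncomputable abbrev twist (p : ℕ) [Fact p.Prime] {k : Type u} [Field k] [CharP k p]
    {S : Scheme.{u}} (s : S ⟶ Spec (.of k)) : Scheme.{u} :=
  pullback s (specFrob k p)

/-- The projection `q : S' ⟶ S`. -/
noncomputable abbrev twistProj (p : ℕ) [Fact p.Prime] {k : Type u} [Field k] [CharP k p]
    {S : Scheme.{u}} (s : S ⟶ Spec (.of k)) : twist p s ⟶ S :=
  pullback.fst s (specFrob k p)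

/-- The structure morphism `S' ⟶ Spec k`. -/
noncomputable abbrev twistStr (p : ℕ) [Fact p.Prime] {k : Type u} [Field k] [CharP k p]
    {S : Scheme.{u}} (s : S ⟶ Spec (.of k)) : twist p s ⟶ Spec (.of k) :=
  pullback.snd s (specFrob k p)

/-- The relative Frobenius `F_{S/k} : S ⟶ S'`. -/
noncomputable def relFrob (p : ℕ) [Fact p.Prime] {k : Type u} [Field k] [CharP k p]
    {S : Scheme.{u}} (s : S ⟶ Spec (.of k)) : S ⟶ twist p s :=
  pullback.lift (frob p s) s (frob_comp p s)

lemma relFrob_proj (p : ℕ) [Fact p.Prime] {k : Type u} [Field k] [CharP k p]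
    {S : Scheme.{u}} (s : S ⟶ Spec (.of k)) : relFrob p s ≫ twistProj p s = frob p s :=
  pullback.lift_fst _ _ _

/-! ### Liftings to `W₂(k)` -/

/-- `W₂(k) = W(k) / p²`. -/
abbrev W2 (k : Type u) [Field k] (p : ℕ) [Fact p.Prime] : Type u :=
  WittVector p k ⧸ Ideal.span {(p : WittVector p k) ^ 2}

/-- The reduction map `W₂(k) → k`. -/
noncomputable def W2.toField (k : Type u) [Field k] (p : ℕ) [Fact p.Prime] [CharP k p] :
    W2 k p →+* k :=
  Ideal.Quotient.lift _ WittVector.constantCoeff (by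
    intro a ha
    obtain ⟨c, rfl⟩ := Ideal.mem_span_singleton.mp ha
    rw [map_mul, map_pow, map_natCast, CharP.cast_eq_zero k p, zero_pow two_ne_zero, zero_mul])

/-- The Frobenius `W₂(σ)` of `W₂(k)`. -/
noncomputable def W2.frob (k : Type u) [Field k] (p : ℕ) [Fact p.Prime] [CharP k p] :
    W2 k p →+* W2 k p :=
  Ideal.quotientMap _ WittVector.frobenius (by
    rw [Ideal.span_le, Set.singleton_subset_iff]
    exact Ideal.mem_span_singleton.mpr (by simp))

lemma W2.toField_frob (k : Type u) [Field k] (p : ℕ) [Fact p.Prime] [CharP k p] :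
    (W2.toField k p).comp (W2.frob k p) = (frobenius k p).comp (W2.toField k p) := by
  apply Ideal.Quotient.ringHom_ext
  ext a
  exact WittVector.coeff_frobenius_charP p a 0

/-- The closed immersion `Spec k ⟶ Spec W₂(k)`. -/
noncomputable abbrev specRes (k : Type u) [Field k] (p : ℕ) [Fact p.Prime] [CharP k p] :
    Spec (.of k) ⟶ Spec (.of (W2 k p)) :=
  Spec.map (CommRingCat.ofHom (W2.toField k p))

/-- `Spec W₂(σ)`. -/
noncomputable abbrev specW2Frob (k : Type u) [Field k] (p : ℕ) [Fact p.Prime] [CharP k p] :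
    Spec (.of (W2 k p)) ⟶ Spec (.of (W2 k p)) :=
  Spec.map (CommRingCat.ofHom (W2.frob k p))

lemma specRes_specW2Frob (k : Type u) [Field k] (p : ℕ) [Fact p.Prime] [CharP k p] :
    specFrob k p ≫ specRes k p = specRes k p ≫ specW2Frob k p := by
  rw [specFrob, specRes, specW2Frob, ← Spec.map_comp, ← Spec.map_comp, ← CommRingCat.ofHom_comp,
    ← CommRingCat.ofHom_comp, W2.toField_frob]

/-- A `W₂(k)`-lifting `(S̃, F̃_S)` of the pair `(S, F_S)`: a smooth `W₂(k)`-scheme `S̃` with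
reduction `S`, and a `W₂(σ)`-linear endomorphism `F̃_S` of `S̃` with reduction `F_S`. -/
structure FrobeniusLifting (p : ℕ) [Fact p.Prime] {k : Type u} [Field k] [CharP k p]
    {S : Scheme.{u}} (s : S ⟶ Spec (.of k)) where
  lift : Scheme.{u}
  str : lift ⟶ Spec (.of (W2 k p))
  smooth : Smooth str
  incl : S ⟶ lift
  isPullback : IsPullback incl s str (specRes k p)
  F : lift ⟶ lift
  F_str : F ≫ str = str ≫ specW2Frob k p
  incl_F : incl ≫ F = frob p s ≫ incl

namespace FrobeniusLifting

variable {p : ℕ} [Fact p.Prime] {k : Type u} [Field k] [CharP k p] {S : Scheme.{u}}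
  {s : S ⟶ Spec (.of k)} (L : FrobeniusLifting p s)

/-- `S̃' = S̃ ×_{W₂(k), W₂(σ)} W₂(k)`. -/
noncomputable abbrev twist : Scheme.{u} := pullback L.str (specW2Frob k p)

/-- The closed immersion `S' ⟶ S̃'`. -/
noncomputable def inclTwist : NFM.twist p s ⟶ L.twist :=
  pullback.map s (specFrob k p) L.str (specW2Frob k p) L.incl (specRes k p) (specRes k p)
    L.isPullback.w.symm (specRes_specW2Frob k p)

/-- The `W₂(k)`-morphism `F̃ : S̃ ⟶ S̃'` lifting the relative Frobenius. -/
noncomputable def relF : L.lift ⟶ L.twist := pullback.lift L.F L.str L.F_str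

end FrobeniusLifting

/-- `δ = ζ(D)` where `ζ : T_S → F^* T_B` is the dual of `dF̃ / [p] : F^* Ω_B → Ω_S`, for a morphism
`F̃ : S̃ ⟶ B̃` that reduces to the Frobenius morphism `F : S ⟶ B` along `iS : S ⟶ S̃` and
`iB : B ⟶ B̃`. If `D̃` is a local lift of `D` and `b̃` is a local section of `O_B̃`, then
`⟨dF̃ (d b̃), D̃⟩ = D̃ (F̃^* b̃)` is of the form `p c̃`, and `ζ(D)` sends `b̃ mod p` to `c̃ mod p`. -/
def IsZeta (p : ℕ) {S B T S₂ B₂ T₂ T' : Scheme.{u}} (F : S ⟶ B) {s : S ⟶ T} {b : B ⟶ T'}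
    (iS : S ⟶ S₂) (iB : B ⟶ B₂) (F₂ : S₂ ⟶ B₂) (s₂ : S₂ ⟶ T₂) {U : S.Opens}
    (D : VectorField s U) (δ : DerivationAlong F b U) : Prop :=
  ∀ (V : B₂.Opens) (U₂ : S₂.Opens) (hUV : U₂ ≤ F₂ ⁻¹ᵁ V) (D₂ : VectorField s₂ U₂)
    (W : S.Opens) (hW : W ≤ U) (hWU : W ≤ iS ⁻¹ᵁ U₂) (hWF : W ≤ F ⁻¹ᵁ (iB ⁻¹ᵁ V)),
    Related iS (D.restrict hW) D₂ →
    ∀ (b₂ : Γ(B₂, V)) (c₂ : Γ(S₂, U₂)),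
      D₂.app U₂ le_rfl ((F₂.appLE V U₂ hUV).hom b₂) = p * c₂ →
      δ.app (iB ⁻¹ᵁ V) W hW hWF ((iB.app V).hom b₂) = (iS.appLE U₂ W hWU).hom c₂

/-! ### The inverse Cartier transform -/

/-- `δ = ∑ cᵢ ⊗ Dᵢ` in `F^* T_B` over the open `U'`, where the `Dᵢ` are vector fields on an open `V`
of `B` with `U' ⊆ F⁻¹ V`. -/
def IsDecomposition {S B T : Scheme.{u}} {F : S ⟶ B} {b : B ⟶ T} {U : S.Opens}
    (δ : DerivationAlong F b U) {V : B.Opens} {U' : S.Opens} (hU' : U' ≤ U) {n : ℕ}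
    (c : Fin n → Γ(S, U')) (D : Fin n → VectorField b V) : Prop :=
  U' ≤ F ⁻¹ᵁ V ∧
  ∀ (W' : B.Opens) (hW' : W' ≤ V) (W : S.Opens) (hW : W ≤ U') (hWW' : W ≤ F ⁻¹ᵁ W')
    (a : Γ(B, W')),
    δ.app W' W (hW.trans hU') hWW' a =
      ∑ i, (S.presheaf.map (homOfLE hW).op).hom (c i) *
        (F.appLE W' W hWW').hom ((D i).app W' hW' a)

/-- For a commutative square `f ≫ F = π ≫ g` with `π : X ⟶ Y`, `g : Y ⟶ B`, `f : X ⟶ S`,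
`F : S ⟶ B`, a Higgs field `θ` on `g`, a section `δ` of `F^* T_B` and a vector field `E` on `X`:
`dπ (E) = (π^* θ) (f^* δ)` in `π^* T_{Y/k}`. If the square is Cartesian and `E` belongs to
`T_{X/S} = π^* T_{Y/B}`, this means that `E = (π^* θ) (f^* δ)`. -/
def IsPullbackValue {X Y S B T T' : Scheme.{u}} (π : X ⟶ Y) (f : X ⟶ S) (F : S ⟶ B) {g : Y ⟶ B}
    {b : B ⟶ T} {x : X ⟶ T'} (θ : HiggsField g b) {U : S.Opens} (δ : DerivationAlong F b U)
    (E : VectorField x (f ⁻¹ᵁ U)) : Prop :=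
  ∀ (V : B.Opens) (U' : S.Opens) (hU' : U' ≤ U) (n : ℕ) (c : Fin n → Γ(S, U'))
    (D : Fin n → VectorField b V), IsDecomposition δ hU' c D →
    ∀ (W' : Y.Opens) (hW' : W' ≤ g ⁻¹ᵁ V) (W : X.Opens) (hW : W ≤ f ⁻¹ᵁ U')
      (hWW' : W ≤ π ⁻¹ᵁ W') (y : Γ(Y, W')),
      E.app W (hW.trans (f.preimage_mono hU')) ((π.appLE W' W hWW').hom y) =
        ∑ i, (f.appLE U' W hW).hom (c i) *
          (π.appLE W' W hWW').hom ((θ.toFun V (D i)).app W' hW' y)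

/-- The canonical connection on a base change `f : X ⟶ S` of `Y ⟶ B` along a Frobenius morphism
`S ⟶ B`: its image is the annihilator of `O_Y` in `T_{X/k}`, where `π : X ⟶ Y`. -/
def IsCanonical {X Y S T : Scheme.{u}} (π : X ⟶ Y) {f : X ⟶ S} {s : S ⟶ T}
    (N : Connection f s) : Prop :=
  ∀ (U : S.Opens) (D : VectorField s U) (W' : Y.Opens) (W : X.Opens) (hW : W ≤ f ⁻¹ᵁ U)
    (hWW' : W ≤ π ⁻¹ᵁ W') (y : Γ(Y, W')),
    (N.toFun U D).app W hW ((π.appLE W' W hWW').hom y) = 0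

/-- `Φ = (π^* θ) ∘ (f^* ζ)` as a map `f^* T_S → T_{X/S}`; the relation `zeta D δ` stands for
`δ = ζ(D)`. -/
def IsPullbackHiggs {X Y S B T T' : Scheme.{u}} (π : X ⟶ Y) {f : X ⟶ S} {F : S ⟶ B} {g : Y ⟶ B}
    {b : B ⟶ T} {s : S ⟶ T'}
    (zeta : ∀ {U : S.Opens}, VectorField s U → DerivationAlong F b U → Prop)
    (θ : HiggsField g b) (Φ : HiggsField f s) : Prop :=
  ∀ (U : S.Opens) (D : VectorField s U) (δ : DerivationAlong F b U), zeta D δ →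
    IsPullbackValue π f F θ δ (Φ.toFun U D)

/-- `Φ' = ([p] ∘ Φ) ∘ (f^* ζ)`. Here the `p`-linear map `[p] ∘ Φ : T_S → f_* T_{X/S}` is extended to
an `O_X`-linear map `f^* F_S^* T_S → T_{X/S}`, and `F_S^* T_S = F^* T_B` by means of
`q : B ⟶ S`: if `ζ(D) = ∑ cᵢ ⊗ Dᵢ'`, with `Dᵢ'` the pullback of `Dᵢ` along `q`, then
`Φ'(D) = ∑ cᵢ Φ(Dᵢ)^p`. -/
def IsFrobeniusIterate (p : ℕ) {X S B T T' : Scheme.{u}} {f : X ⟶ S} {F : S ⟶ B} (q : B ⟶ S)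
    {b : B ⟶ T} {s : S ⟶ T'}
    (zeta : ∀ {U : S.Opens}, VectorField s U → DerivationAlong F b U → Prop)
    (Φ Φ' : HiggsField f s) : Prop :=
  ∀ (U : S.Opens) (D : VectorField s U) (δ : DerivationAlong F b U), zeta D δ →
    ∀ (V : S.Opens) (U' : S.Opens) (hU' : U' ≤ U) (n : ℕ) (c : Fin n → Γ(S, U'))
      (E : Fin n → VectorField s V) (E' : Fin n → VectorField b (q ⁻¹ᵁ V)),
      (∀ i, Related q (E' i) (E i)) → IsDecomposition δ hU' c E' →
      ∀ (W : X.Opens) (hW : W ≤ f ⁻¹ᵁ U') (hWV : W ≤ f ⁻¹ᵁ V) (x : Γ(X, W)),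
        (Φ'.toFun U D).app W (hW.trans (f.preimage_mono hU')) x =
          ∑ i, (f.appLE U' W hW).hom (c i) * ((Φ.toFun V (E i)).app W hWV)^[p] x

/-- For a nilpotent Higgs field `θ` on `g : Y ⟶ S'` and `X = Y ×_{S'} S`, with projections
`π : X ⟶ Y` and `f : X ⟶ S`, the connection `N` on `f` is that of the inverse Cartier transform
`C⁻¹(g, θ)`, i.e.
`N = ∇_can - ∑_{m ≥ 0} [p]^m ∘ (π^* θ ∘ f^* ζ) ∘ (f^* ζ)^m`, where `∇_can` is the canonical connection
and where the sum is finite. -/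
def IsInverseCartier (p : ℕ) {X Y S B T T' : Scheme.{u}} (π : X ⟶ Y) {f : X ⟶ S} {F : S ⟶ B}
    (q : B ⟶ S) {g : Y ⟶ B} {b : B ⟶ T} {s : S ⟶ T'}
    (zeta : ∀ {U : S.Opens}, VectorField s U → DerivationAlong F b U → Prop)
    (θ : HiggsField g b) (N : Connection f s) : Prop :=
  ∃ (can : Connection f s) (Φ : ℕ → HiggsField f s) (n : ℕ),
    IsCanonical π can ∧
    IsPullbackHiggs π zeta θ (Φ 0) ∧
    (∀ m, IsFrobeniusIterate p q zeta (Φ m) (Φ (m + 1))) ∧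
    (∀ m, n ≤ m → ∀ (U : S.Opens) (D : VectorField s U), (Φ m).toFun U D = 0) ∧
    ∀ (U : S.Opens) (D : VectorField s U) (W : X.Opens) (hW : W ≤ f ⁻¹ᵁ U) (x : Γ(X, W)),
      (N.toFun U D).app W hW x = (can.toFun U D).app W hW x -
        ∑ m ∈ Finset.range n, ((Φ m).toFun U D).app W hW x

/-! ### The affine line over `S` and `𝔾ₘ`-actions -/

/-- The affine line `Spec k[t]`. -/
noncomputable abbrev line (k : Type u) [Field k] : Scheme.{u} := Spec (.of (Polynomial k))

/-- The structure morphism of the affine line. -/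
noncomputable abbrev lineStr (k : Type u) [Field k] : line k ⟶ Spec (.of k) :=
  Spec.map (CommRingCat.ofHom Polynomial.C)

/-- The coordinate `t` of the affine line. -/
noncomputable def coord (k : Type u) [Field k] : Γ(line k, ⊤) :=
  (Scheme.ΓSpecIso (.of (Polynomial k))).inv.hom Polynomial.X

section line

variable {k : Type u} [Field k] {S : Scheme.{u}} (s : S ⟶ Spec (.of k))

/-- The affine line `𝔸¹_S` over `S`. -/
noncomputable abbrev A1 : Scheme.{u} := pullback (lineStr k) s

/-- The projection `𝔸¹_S ⟶ 𝔸¹_k`. -/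
noncomputable abbrev toLine : A1 s ⟶ line k := pullback.fst (lineStr k) s

/-- The projection `𝔸¹_S ⟶ S`. -/
noncomputable abbrev toBase : A1 s ⟶ S := pullback.snd (lineStr k) s

/-- The section `t = a` of `𝔸¹_S ⟶ S`, for `a ∈ k`. -/
noncomputable def sec (a : k) : S ⟶ A1 s :=
  pullback.lift (s ≫ Spec.map (CommRingCat.ofHom (Polynomial.evalRingHom a))) (𝟙 S) (by
    rw [Category.assoc, ← Spec.map_comp, ← CommRingCat.ofHom_comp]
    have : (Polynomial.evalRingHom a).comp Polynomial.C = RingHom.id k := by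
      ext x; simp
    rw [this]
    simp)

end line

/-- An action of the multiplicative group on a scheme `Y`, in terms of the functor of points:
the group `𝔾ₘ(Z) = Γ(Z, O_Z)ˣ` acts on the set of morphisms `Z ⟶ Y`, functorially in `Z`. -/
structure GmAction (Y : Scheme.{u}) where
  smul : ∀ {Z : Scheme.{u}}, (Γ(Z, ⊤))ˣ → (Z ⟶ Y) → (Z ⟶ Y)
  one_smul : ∀ {Z : Scheme.{u}} (x : Z ⟶ Y), smul 1 x = x
  mul_smul : ∀ {Z : Scheme.{u}} (a b : (Γ(Z, ⊤))ˣ) (x : Z ⟶ Y), smul (a * b) x = smul a (smul b x)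
  naturality : ∀ {Z Z' : Scheme.{u}} (h : Z' ⟶ Z) (a : (Γ(Z, ⊤))ˣ) (x : Z ⟶ Y),
    h ≫ smul a x = smul (Units.map h.appTop.hom.toMonoidHom a) (h ≫ x)

namespace GmAction

variable {k : Type u} [Field k] {S Y : Scheme.{u}} {s : S ⟶ Spec (.of k)} (act : GmAction Y)

/-- The action covers the standard action `(a, t) ↦ a t` on `𝔸¹_S`, which is trivial on `S`. -/
def Covers (f : Y ⟶ A1 s) : Prop :=
  ∀ {Z : Scheme.{u}} (a : (Γ(Z, ⊤))ˣ) (x : Z ⟶ Y),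
    act.smul a x ≫ f ≫ toBase s = x ≫ f ≫ toBase s ∧
    (act.smul a x ≫ f ≫ toLine s).appTop.hom (coord k) =
      a * (x ≫ f ≫ toLine s).appTop.hom (coord k)

/-- `𝔾ₘ`-equivariance of a `t`-connection `N : f^* T_{𝔸¹_S/𝔸¹} → T_{Y/𝔸¹}`. As `N` lifts `t · id` and
`t` has weight one, equivariance means `N_{a y} = a · (a_* N_y)`, for a point `a` of `𝔾ₘ`, on vector
fields `D₁` on `𝔸¹_S` that come from vector fields `D` on `S` (these are invariant).
In terms of points: let `x : Z ⟶ Y` be a point of `Y` and `a` a point of `𝔾ₘ` with values in `Z`, and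
let `E` be a vector field on `Z` that is related to `N(D₁)` by `x` and kills `a`
(the universal case being `Z = 𝔾ₘ × Y` and `E = 1 ⊗ N(D₁)`). Then the vector field `a E` is related
to `N(D₁)` by `a x : Z ⟶ Y`. -/
def Equivariant {f : Y ⟶ A1 s} (N : LConnection f (toLine s) (coord k)) : Prop :=
  ∀ (U : S.Opens) (D : VectorField s U) (D₁ : VectorField (toLine s) (toBase s ⁻¹ᵁ U)),
    Related (toBase s) D₁ D →
    ∀ {Z : Scheme.{u}} (a : (Γ(Z, ⊤))ˣ) (x : Z ⟶ Y) (V : Z.Opens)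
      (E : VectorField (x ≫ f ≫ toBase s ≫ s) V),
      V ≤ x ⁻¹ᵁ f ⁻¹ᵁ toBase s ⁻¹ᵁ U →
      Related x E (N.toFun _ D₁) →
      (∀ (W : Z.Opens) (hW : W ≤ V), E.app W hW ((Z.presheaf.map (homOfLE le_top).op).hom a) = 0) →
      Related (act.smul a x) ((Z.presheaf.map (homOfLE (le_top : V ≤ ⊤)).op).hom (a : Γ(Z, ⊤)) • E)
        (N.toFun _ D₁)

end GmAction

/-! ### Nonlinear Fontaine modules -/

/-- A nonlinear Fontaine module `(f, ∇, Fil, φ)` over the `k`-variety `S`, with respect to the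
lifting `L` of `(S, F_S)`, where `X` is a `k`-variety. As `p = 0` in `k`, the fibre at `t = p` of the
filtration `total ⟶ 𝔸¹_S` is its fibre at `t = 0`. -/
structure FontaineModule {p : ℕ} [Fact p.Prime] {k : Type u} [Field k] [CharP k p]
    {S : Scheme.{u}} {s : S ⟶ Spec (.of k)} (L : FrobeniusLifting p s) where
  X : Scheme.{u}
  f : X ⟶ S
  isVariety : IsVariety (f ≫ s)
  flat : Flat f
  /-- the connection `∇` -/
  conn : Connection f s
  integrable : conn.Integrable
  /-- the total space of the filtration structure -/
  total : Scheme.{u}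
  ft : total ⟶ A1 s
  flat_ft : Flat ft
  /-- the identification of `X` with the fibre at `t = 1` -/
  incl : X ⟶ total
  isPullback : IsPullback incl f ft (sec s 1)
  action : GmAction total
  covers : action.Covers ft
  /-- the Frobenius structure, a morphism from `X` to the fibre at `t = p = 0` -/
  φ : X ⟶ pullback ft (sec s 0)
  φ_comm : φ ≫ pullback.snd ft (sec s 0) = f ≫ frob p s
  isIso_φ : IsIso (pullback.lift (f := pullback.snd ft (sec s 0)) (g := frob p s) φ f φ_comm)
  /-- the extension of `∇` to a `t`-connection -/
  connT : LConnection ft (toLine s) (coord k)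
  extends_conn : IsBaseChange incl (sec s 1) connT conn
  equivariant : action.Equivariant connT
  /-- the restriction `θ` of the `t`-connection to the fibre at `t = p = 0` -/
  θ : HiggsField (pullback.snd ft (sec s 0)) s
  isBaseChange_θ : IsBaseChange (pullback.fst ft (sec s 0)) (sec s 0) connT θ
  /-- the parallelism condition `dφ ∘ ∇ = φ^* θ ∘ f^* (dF̃_S / [p])` -/
  parallel : ∀ (U : S.Opens) (D : VectorField s U) (δ : DerivationAlong (frob p s) s U),
    IsZeta p (frob p s) L.incl L.incl L.F L.str D δ →
      IsPullbackValue φ f (frob p s) θ δ (conn.toFun U D)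

namespace FontaineModule

variable {p : ℕ} [Fact p.Prime] {k : Type u} [Field k] [CharP k p] {S : Scheme.{u}}
  {s : S ⟶ Spec (.of k)} {L : FrobeniusLifting p s} (M : FontaineModule L)

/-- `M` is geometric strict `p`-torsion: `[p] ∘ θ = 0`. -/
def StrictPTorsion : Prop := M.θ.PowZero p 1

/-- The scheme `X₀`, the fibre of the filtration structure at `t = 0`. -/
noncomputable abbrev X₀ : Scheme.{u} := pullback M.ft (sec s 0)

/-- The structure morphism `f₀ : X₀ ⟶ S`. -/
noncomputable abbrev f₀ : M.X₀ ⟶ S := pullback.snd M.ft (sec s 0)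

/-- The structure morphism `q^* X₀ ⟶ S'`. -/
noncomputable abbrev twistf₀ : pullback M.f₀ (twistProj p s) ⟶ twist p s :=
  pullback.snd M.f₀ (twistProj p s)

/-- The structure morphism `q^* X₀ ×_{S'} S ⟶ S`. -/
noncomputable abbrev cartierf₀ : pullback M.twistf₀ (relFrob p s) ⟶ S :=
  pullback.snd M.twistf₀ (relFrob p s)

/-- The morphism `X ⟶ q^* X₀ ×_{S'} S` over `S` induced by the Frobenius structure `φ`. -/
noncomputable def toCartier : M.X ⟶ pullback M.twistf₀ (relFrob p s) :=
  pullback.lift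
    (pullback.lift M.φ (M.f ≫ relFrob p s) (by
      rw [Category.assoc, relFrob_proj]; exact M.φ_comm))
    M.f (pullback.lift_snd _ _ _)

/-- The morphism `ψ : X ⟶ F_S^* X₀` over `S` induced by the Frobenius structure `φ`. -/
noncomputable def ψ : M.X ⟶ pullback M.f₀ (frob p s) :=
  pullback.lift M.φ M.f M.φ_comm

end FontaineModule

end NFM

/-! The square formed by `φ`, `f`, `f₀` and `F_S` is Cartesian. A derivation on a fibre product is
determined by its restrictions to the functions of the two factors, and restrictions that agree on
the functions of the base glue (`ADer.ext_of_isPullback`, `ADer.exists_of_isPullback`). On `O_S` the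
field `∇ D` acts as `D`, because `∇` is a connection; on `O_{X₀}` the parallelism condition says
that it acts as `π^*θ` at `ζ(D)`. The canonical connection acts as `D` on `O_S` and as zero on
`O_{X₀}`. Comparing the two gives `∇ = ∇_can + π^*θ ∘ ζ`.

The series for `C⁻¹` reduces to its first term. Locally `ζ(D)` is a combination `∑ cᵢ ⊗ Dᵢ`, and the
fields `θ'(Dᵢ)` commute by integrability and have vanishing `p`-th powers. Hence the `p`-th power of
`(π^*θ')(ζ D)` vanishes (`iterate_prime_eq_zero`), and so do all later terms
(`isInverseCartier_iff`). As `θ'` is the twist of `-θ`, the two minus signs cancel and the transform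
is the connection found above (`FontaineModule.isPullbackHiggs_sub`).

Two facts about `(f₀, θ)` are not part of the data. Integrability of `θ` comes from that of `∇`:
where `t` is invertible, equivariance identifies `t⁻¹ ∇̃` with `∇` on the fibre over `t = 1`, which
gives `[∇̃ D, ∇̃ E] = t ∇̃ [D, E]` there. Flatness over the affine line makes `t` a nonzerodivisor,
so the identity holds everywhere, and it is restricted to `t = 0` (`FontaineModule.connT_bracket`,
`FontaineModule.integrable_θ`). That `X₀` is a variety is descended from `X` along `φ`, a flat base
change of Frobenius and therefore integral, surjective and scheme-theoretically dominant
(`IsVariety.of_isIntegralHom`).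

The definitions speak of `ζ` as a relation, so uniqueness of the transform requires that `ζ(D)`
exist locally. It is `b ↦ b^(p-1) D b + D g`, where the Frobenius lifting sends a lift of `b` to its
`p`-th power plus `p` times a lift of `g` (`exists_dividedFrobenius`). Perfectness of `k` makes the
projection `q` an isomorphism, so that `q^*` is a transport of structure, and makes every derivation
linear over `k`. -/

namespace NFM

/-! ### Sections and restrictions -/

section Sections

variable {X Y Z : Scheme.{u}}

/-- Restriction of sections. -/
abbrev res (X : Scheme.{u}) {W W' : X.Opens} (h : W' ≤ W) : Γ(X, W) →+* Γ(X, W') :=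
  (X.presheaf.map (homOfLE h).op).hom

lemma le_inf_preimage {h : X ⟶ Y} {W : X.Opens} {A B : Y.Opens} (h₁ : W ≤ h ⁻¹ᵁ A)
    (h₂ : W ≤ h ⁻¹ᵁ B) : W ≤ h ⁻¹ᵁ (A ⊓ B) := fun _ z => ⟨h₁ z, h₂ z⟩

lemma le_preimage_of_comp {f : X ⟶ Y} {g : Y ⟶ Z} {k : X ⟶ Z} (hk : f ≫ g = k) {W : X.Opens}
    {A : Z.Opens} (h : W ≤ k ⁻¹ᵁ A) : W ≤ f ⁻¹ᵁ (g ⁻¹ᵁ A) := by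
  subst hk; exact h

lemma preimage_comp_le {f : X ⟶ Y} {g : Y ⟶ Z} {k : X ⟶ Z} (hk : f ≫ g = k) {W : X.Opens}
    {B : Y.Opens} {A : Z.Opens} (h₁ : W ≤ f ⁻¹ᵁ B) (h₂ : B ≤ g ⁻¹ᵁ A) : W ≤ k ⁻¹ᵁ A := by
  subst hk; exact h₁.trans (f.preimage_mono h₂)

lemma le_preimage_id {U V : X.Opens} (e : V ≤ U) : V ≤ (𝟙 X : X ⟶ X) ⁻¹ᵁ U := e

lemma res_res {W₁ W₂ W₃ : X.Opens} (h : W₂ ≤ W₁) (h' : W₃ ≤ W₂) (a : Γ(X, W₁)) :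
    res X h' (res X h a) = res X (h'.trans h) a := by
  rw [← CommRingCat.comp_apply, ← X.presheaf.map_comp]
  rfl

lemma res_self {W : X.Opens} (h : W ≤ W) (a : Γ(X, W)) : res X h a = a := by
  have : (homOfLE h).op = 𝟙 _ := rfl
  rw [res, this, X.presheaf.map_id]
  rfl

lemma res_appLE (h : X ⟶ Y) {U : Y.Opens} {V V' : X.Opens} (e : V ≤ h ⁻¹ᵁ U) (i : V' ≤ V)
    (b : Γ(Y, U)) : res X i ((h.appLE U V e).hom b) = (h.appLE U V' (i.trans e)).hom b := by
  rw [← CommRingCat.comp_apply, Scheme.Hom.appLE_map]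

lemma appLE_res (h : X ⟶ Y) {U U' : Y.Opens} {V : X.Opens} (i : U' ≤ U) (e : V ≤ h ⁻¹ᵁ U')
    (b : Γ(Y, U)) : (h.appLE U' V e).hom (res Y i b) =
      (h.appLE U V (e.trans (h.preimage_mono i))).hom b := by
  rw [← CommRingCat.comp_apply, Scheme.Hom.map_appLE]

lemma appLE_appLE (f : X ⟶ Y) (g : Y ⟶ Z) {U : Z.Opens} {V : Y.Opens} {W : X.Opens}
    (e₁ : V ≤ g ⁻¹ᵁ U) (e₂ : W ≤ f ⁻¹ᵁ V) (b : Γ(Z, U)) :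
    (f.appLE V W e₂).hom ((g.appLE U V e₁).hom b) =
      ((f ≫ g).appLE U W (e₂.trans (f.preimage_mono e₁))).hom b := by
  rw [← CommRingCat.comp_apply, Scheme.Hom.appLE_comp_appLE]

lemma appLE_app (f : X ⟶ Y) (g : Y ⟶ Z) {U : Z.Opens} {W : X.Opens}
    (e₂ : W ≤ f ⁻¹ᵁ (g ⁻¹ᵁ U)) (b : Γ(Z, U)) :
    (f.appLE (g ⁻¹ᵁ U) W e₂).hom ((g.app U).hom b) =
      ((f ≫ g).appLE U W (preimage_comp_le rfl e₂ le_rfl)).hom b := by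
  rw [Scheme.Hom.app_eq_appLE, appLE_appLE]

lemma appLE_comp_eq {f : X ⟶ Y} {g : Y ⟶ Z} {k : X ⟶ Z} (hk : f ≫ g = k) {U : Z.Opens}
    {V : Y.Opens} {W : X.Opens} (e₁ : V ≤ g ⁻¹ᵁ U) (e₂ : W ≤ f ⁻¹ᵁ V) (e₃ : W ≤ k ⁻¹ᵁ U)
    (b : Γ(Z, U)) :
    (f.appLE V W e₂).hom ((g.appLE U V e₁).hom b) = (k.appLE U W e₃).hom b := by
  subst hk; exact appLE_appLE f g e₁ e₂ b

lemma id_appLE {U V : X.Opens} (e : V ≤ (𝟙 X : X ⟶ X) ⁻¹ᵁ U) (e' : V ≤ U) (b : Γ(X, U)) :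
    ((𝟙 X : X ⟶ X).appLE U V e).hom b = res X e' b := by
  have := res_appLE (𝟙 X) (U := U) (V := U) le_rfl e b
  rw [← this]
  congr 1
  have e2 : (𝟙 X : X ⟶ X).appLE U U le_rfl = 𝟙 _ := by
    exact (Scheme.Hom.app_eq_appLE (𝟙 X)).symm.trans (Scheme.Hom.id_app U)
  exact congrArg (fun f => (CommRingCat.Hom.hom f) b) e2

lemma appLE_congr_hom {f g : X ⟶ Y} (h : f = g) {U : Y.Opens} {V : X.Opens} (e : V ≤ f ⁻¹ᵁ U)
    (b : Γ(Y, U)) : (f.appLE U V e).hom b = (g.appLE U V (h ▸ e)).hom b := by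
  subst h; rfl

/-- Sections that agree locally are equal. -/
theorem section_ext {W : X.Opens} {a b : Γ(X, W)}
    (H : ∀ x ∈ W, ∃ (W₁ : X.Opens) (i : W₁ ≤ W), x ∈ W₁ ∧ res X i a = res X i b) : a = b := by
  apply TopCat.Presheaf.section_ext X.sheaf
  intro x hx
  obtain ⟨W₁, i, hx1, e⟩ := H x hx
  have e1 := X.presheaf.germ_res_apply (homOfLE i) x hx1 a
  have e2 := X.presheaf.germ_res_apply (homOfLE i) x hx1 b
  exact (e1.symm.trans (congrArg _ e)).trans e2

/-- Gluing of sections characterized by a restriction-stable property with local uniqueness. -/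
theorem section_glue {W : X.Opens} (P : ∀ W₁ : X.Opens, W₁ ≤ W → Γ(X, W₁) → Prop)
    (hres : ∀ W₁ W₂ (h₁ : W₁ ≤ W) (h : W₂ ≤ W₁) a, P W₁ h₁ a → P W₂ (h.trans h₁) (res X h a))
    (huniq : ∀ W₁ h₁ a b, P W₁ h₁ a → P W₁ h₁ b → a = b)
    (hex : ∀ x ∈ W, ∃ (W₁ : X.Opens) (h₁ : W₁ ≤ W) (a : Γ(X, W₁)), x ∈ W₁ ∧ P W₁ h₁ a) :
    ∃ c : Γ(X, W), ∀ W₁ h₁ a, P W₁ h₁ a → res X h₁ c = a := by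
  choose U hU s hx hs using hex
  obtain ⟨c, hc, -⟩ := X.sheaf.existsUnique_gluing' (fun x : W => U x.1 x.2) W
    (fun x => homOfLE (hU x.1 x.2)) (fun x hxW => by
      exact Opens.mem_iSup.mpr ⟨⟨x, hxW⟩, hx x hxW⟩)
    (fun x => s x.1 x.2) (fun x y => huniq _ _ _ _
      (hres _ _ (hU x.1 x.2) inf_le_left _ (hs x.1 x.2))
      (hres _ _ (hU y.1 y.2) inf_le_right _ (hs y.1 y.2)))
  change Γ(X, W) at c
  refine ⟨c, fun W₁ h₁ a ha => section_ext fun x hxW => ?_⟩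
  refine ⟨W₁ ⊓ U x (h₁ hxW), inf_le_left, ⟨hxW, hx _ _⟩, ?_⟩
  have e := hc ⟨x, h₁ hxW⟩
  rw [res_res]
  have e' : res X (hU x (h₁ hxW)) c = s x (h₁ hxW) := e
  rw [← res_res (hU x (h₁ hxW)) inf_le_right, e']
  exact huniq _ _ _ _ (hres _ _ _ inf_le_right _ (hs _ _)) (hres _ _ _ inf_le_left _ ha)

end Sections

/-! ### Derivations along a morphism, without base -/

/-- A derivation `O_Y → h_* O_X` over the open `V ⊆ X`, for `h : X ⟶ Y`. -/
@[ext]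
structure ADer {X Y : Scheme.{u}} (h : X ⟶ Y) (V : X.Opens) where
  app : ∀ (W' : Y.Opens) (W : X.Opens), W ≤ V → W ≤ h ⁻¹ᵁ W' → Γ(Y, W') → Γ(X, W)
  app_add : ∀ W' W hW hW' a b, app W' W hW hW' (a + b) = app W' W hW hW' a + app W' W hW hW' b
  app_mul : ∀ W' W hW hW' a b, app W' W hW hW' (a * b) =
    (h.appLE W' W hW').hom a * app W' W hW hW' b + (h.appLE W' W hW').hom b * app W' W hW hW' a
  app_map : ∀ (W₁' W₂' : Y.Opens) (W₁ W₂ : X.Opens) (i : W₂' ≤ W₁') (j : W₂ ≤ W₁)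
    (h₁ : W₁ ≤ V) (h₁' : W₁ ≤ h ⁻¹ᵁ W₁') (h₂' : W₂ ≤ h ⁻¹ᵁ W₂') (a : Γ(Y, W₁')),
    app W₂' W₂ (j.trans h₁) h₂' (res Y i a) = res X j (app W₁' W₁ h₁ h₁' a)

namespace ADer

variable {X Y : Scheme.{u}} {h : X ⟶ Y} {V : X.Opens}

/-- The restriction to a smaller open. -/
def restrict (δ : ADer h V) {V' : X.Opens} (hV : V' ≤ V) : ADer h V' where
  app W' W hW := δ.app W' W (hW.trans hV)
  app_add W' W hW := δ.app_add W' W (hW.trans hV)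
  app_mul W' W hW := δ.app_mul W' W (hW.trans hV)
  app_map W₁' W₂' W₁ W₂ i j h₁ := δ.app_map W₁' W₂' W₁ W₂ i j (h₁.trans hV)

lemma app_res (δ : ADer h V) {W₁' W₂' : Y.Opens} {W : X.Opens} (i : W₂' ≤ W₁') (hW : W ≤ V)
    (h₂' : W ≤ h ⁻¹ᵁ W₂') (a : Γ(Y, W₁')) :
    δ.app W₂' W hW h₂' (res Y i a) = δ.app W₁' W hW (h₂'.trans (h.preimage_mono i)) a := by
  have := δ.app_map W₁' W₂' W W i le_rfl hW (h₂'.trans (h.preimage_mono i)) h₂' a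
  rw [res_self] at this
  exact this

lemma res_app (δ : ADer h V) {W' : Y.Opens} {W₁ W₂ : X.Opens} (j : W₂ ≤ W₁) (hW : W₁ ≤ V)
    (h₁' : W₁ ≤ h ⁻¹ᵁ W') (a : Γ(Y, W')) :
    res X j (δ.app W' W₁ hW h₁' a) = δ.app W' W₂ (j.trans hW) (j.trans h₁') a := by
  rw [← δ.app_map W' W' W₁ W₂ le_rfl j hW h₁' (j.trans h₁'), res_self]

/-- A derivation along `h` as a ring homomorphism to the dual numbers. -/
def toDual (δ : ADer h V) (W' : Y.Opens) (W : X.Opens) (hW : W ≤ V) (hW' : W ≤ h ⁻¹ᵁ W') :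
    Γ(Y, W') →+* TrivSqZeroExt Γ(X, W) Γ(X, W) where
  toFun a := .inl ((h.appLE W' W hW').hom a) + .inr (δ.app W' W hW hW' a)
  map_one' := by
    have := δ.app_mul W' W hW hW' 1 1
    rw [mul_one, map_one, one_mul, left_eq_add] at this
    rw [this, map_one, TrivSqZeroExt.inr_zero, add_zero, TrivSqZeroExt.inl_one]
  map_zero' := by
    have := δ.app_add W' W hW hW' 0 0
    rw [add_zero, left_eq_add] at this
    rw [this, map_zero, TrivSqZeroExt.inr_zero, add_zero, TrivSqZeroExt.inl_zero]
  map_add' a b := by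
    ext
    · simp
    · simp [δ.app_add]
  map_mul' a b := by
    ext
    · simp
    · simp only [TrivSqZeroExt.snd_mul, TrivSqZeroExt.snd_add, TrivSqZeroExt.fst_add,
        TrivSqZeroExt.fst_inl, TrivSqZeroExt.snd_inl, TrivSqZeroExt.fst_inr, TrivSqZeroExt.snd_inr,
        add_zero, zero_add, δ.app_mul, smul_eq_mul, MulOpposite.smul_eq_mul_unop,
        MulOpposite.unop_op]
      rw [mul_comm (δ.app W' W hW hW' a)]

lemma toDual_fst (δ : ADer h V) (W' W hW hW') (a) :
    (δ.toDual W' W hW hW' a).fst = (h.appLE W' W hW').hom a := by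
  simp [toDual]

lemma toDual_snd (δ : ADer h V) (W' W hW hW') (a) :
    (δ.toDual W' W hW hW' a).snd = δ.app W' W hW hW' a := by
  simp [toDual]

lemma ext_local {δ δ' : ADer h V}
    (H : ∀ x ∈ V, ∃ (V' : X.Opens) (i : V' ≤ V), x ∈ V' ∧ δ.restrict i = δ'.restrict i) :
    δ = δ' := by
  ext W' W hW hW' a
  refine section_ext fun x hx => ?_
  obtain ⟨V', i, hxV, e⟩ := H x (hW hx)
  refine ⟨W ⊓ V', inf_le_left, ⟨hx, hxV⟩, ?_⟩
  rw [δ.res_app, δ'.res_app]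
  have := congrArg (fun d : ADer h V' => d.app W' (W ⊓ V') inf_le_right
    (inf_le_left.trans hW') a) e
  exact this

/-- Local form of a section near a point of an affine open. -/
lemma exists_fraction {P : Y.Opens} (hP : IsAffineOpen P) {W' : Y.Opens} (b : Γ(Y, W'))
    {y : Y} (hy : y ∈ P) (hy' : y ∈ W') :
    ∃ r a : Γ(Y, P), y ∈ Y.basicOpen r ∧ Y.basicOpen r ≤ W' ∧
      ∀ (U : Y.Opens) (h₁ : U ≤ W') (h₂ : U ≤ P), U ≤ Y.basicOpen r →
        res Y h₂ r * res Y h₁ b = res Y h₂ a := by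
  obtain ⟨r, hr, hyr⟩ := hP.exists_basicOpen_le (V := W') ⟨y, hy'⟩ hy
  have := hP.isLocalization_basicOpen r
  obtain ⟨⟨a, s⟩, e⟩ := IsLocalization.surj (Submonoid.powers r) (res Y hr b)
  obtain ⟨s, n, rfl⟩ := s
  have e' : res Y hr b * res Y (Y.basicOpen_le r) (r ^ n) = res Y (Y.basicOpen_le r) a := e
  -- On the basic open `b` is `a / r ^ n`. One further factor `r` keeps the exponent positive, so
  -- that the basic open of the denominator is still that of `r` when `n = 0`.
  refine ⟨r ^ (n + 1), r * a, ?_, ?_, ?_⟩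
  · rw [Scheme.basicOpen_pow _ _ (Nat.succ_pos n)]; exact hyr
  · rw [Scheme.basicOpen_pow _ _ (Nat.succ_pos n)]; exact hr
  · intro U h₁ h₂ hU
    rw [Scheme.basicOpen_pow _ _ (Nat.succ_pos n)] at hU
    have := congrArg (res Y hU) e'
    rw [map_mul, res_res, res_res, res_res] at this
    rw [map_mul, ← this, pow_succ, map_mul]
    ring

lemma isUnit_of_le_basicOpen {P : Y.Opens} (r : Γ(Y, P)) {W : X.Opens} (hW : W ≤ h ⁻¹ᵁ P)
    (hr : W ≤ h ⁻¹ᵁ (Y.basicOpen r)) : IsUnit ((h.appLE P W hW).hom r) := by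
  have := Y.toRingedSpace.isUnit_res_basicOpen r
  have h2 : IsUnit (res Y (Y.basicOpen_le r) r) := this
  have := h2.map (h.appLE _ W hr).hom
  rwa [appLE_res] at this

/-- A derivation along `h` into an affine open is determined by its values on the coordinate
ring. -/
theorem ext_of_affine {P : Y.Opens} (hP : IsAffineOpen P) (hV : V ≤ h ⁻¹ᵁ P) {δ δ' : ADer h V}
    (H : ∀ a : Γ(Y, P), δ.app P V le_rfl hV a = δ'.app P V le_rfl hV a) : δ = δ' := by
  have H' : ∀ (W : X.Opens) (hW : W ≤ V) (a : Γ(Y, P)),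
      δ.app P W hW (hW.trans hV) a = δ'.app P W hW (hW.trans hV) a := fun W hW a => by
    rw [← δ.res_app hW le_rfl hV, ← δ'.res_app hW le_rfl hV, H]
  ext W' W hW hW' b
  refine section_ext fun x hx => ?_
  obtain ⟨r, a, hxr, hrW, e⟩ := exists_fraction hP b (y := h x) (hV (hW hx)) (hW' hx)
  have e := e _ hrW (Y.basicOpen_le r) le_rfl
  set U : X.Opens := W ⊓ h ⁻¹ᵁ (Y.basicOpen r) with hU
  have hUV : U ≤ V := inf_le_left.trans hW
  have hUr : U ≤ h ⁻¹ᵁ (Y.basicOpen r) := inf_le_right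
  refine ⟨U, inf_le_left, ⟨hx, hxr⟩, ?_⟩
  rw [δ.res_app, δ'.res_app]
  have hu := isUnit_of_le_basicOpen (h := h) r (hUV.trans hV) hUr
  -- The Leibniz rule for `r b = a` is the quotient rule: it expresses `r · d b` through `d a` and
  -- `d r`, and `r` is a unit on `U`.
  have key : ∀ d : ADer h V, (h.appLE P U (hUV.trans hV)).hom r *
      d.app W' U hUV (inf_le_left.trans hW') b
      = d.app P U hUV (hUV.trans hV) a - (h.appLE W' U (inf_le_left.trans hW')).hom b *
        d.app P U hUV (hUV.trans hV) r := by
    intro d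
    have := congrArg (d.app _ U hUV hUr) e
    rw [d.app_mul, d.app_res, d.app_res, d.app_res, appLE_res, appLE_res] at this
    rw [← this]
    ring
  refine hu.mul_left_cancel ?_
  rw [key, key, H', H']

/-- Construction of derivations by gluing. -/
theorem exists_of_rel
    (rel : ∀ (W' : Y.Opens) (W : X.Opens), W ≤ V → W ≤ h ⁻¹ᵁ W' → Γ(Y, W') → Γ(X, W) → Prop)
    (hres : ∀ (W₁' W₂' : Y.Opens) (W₁ W₂ : X.Opens) (i : W₂' ≤ W₁') (j : W₂ ≤ W₁)
      (h₁ : W₁ ≤ V) (h₁' : W₁ ≤ h ⁻¹ᵁ W₁') (h₂' : W₂ ≤ h ⁻¹ᵁ W₂') (b c),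
      rel W₁' W₁ h₁ h₁' b c → rel W₂' W₂ (j.trans h₁) h₂' (res Y i b) (res X j c))
    (huniq : ∀ W' W hW hW' b c c', rel W' W hW hW' b c → rel W' W hW hW' b c' → c = c')
    (hex : ∀ W' W (hW : W ≤ V) (hW' : W ≤ h ⁻¹ᵁ W') (b : Γ(Y, W')), ∀ x ∈ W,
      ∃ (W₁ : X.Opens) (i : W₁ ≤ W) (c : Γ(X, W₁)), x ∈ W₁ ∧
        rel W' W₁ (i.trans hW) (i.trans hW') b c)
    (hadd : ∀ W' W hW hW' b b' c c', rel W' W hW hW' b c → rel W' W hW hW' b' c' →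
      rel W' W hW hW' (b + b') (c + c'))
    (hmul : ∀ W' W hW hW' b b' c c', rel W' W hW hW' b c → rel W' W hW hW' b' c' →
      rel W' W hW hW' (b * b')
        ((h.appLE W' W hW').hom b * c' + (h.appLE W' W hW').hom b' * c)) :
    ∃ δ : ADer h V, ∀ W' W hW hW' b c, rel W' W hW hW' b c → δ.app W' W hW hW' b = c := by
  -- The relation plays the role of the graph of the derivation, inhabited only locally. Local
  -- existence and uniqueness turn it into a function, and its algebraic closure properties become
  -- the axioms of a derivation.
  have main : ∀ W' W (hW : W ≤ V) (hW' : W ≤ h ⁻¹ᵁ W') (b : Γ(Y, W')), ∃ c : Γ(X, W),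
      ∀ W₁ (i : W₁ ≤ W) a, rel W' W₁ (i.trans hW) (i.trans hW') b a → res X i c = a := by
    intro W' W hW hW' b
    refine section_glue (fun W₁ i a => rel W' W₁ (i.trans hW) (i.trans hW') b a) ?_ ?_ ?_
    · intro W₁ W₂ h₁ i a ha
      have := hres W' W' W₁ W₂ le_rfl i (h₁.trans hW) (h₁.trans hW') (i.trans (h₁.trans hW')) b a ha
      rwa [res_self] at this
    · exact fun W₁ h₁ a b' ha hb => huniq _ _ _ _ _ _ _ ha hb
    · exact hex W' W hW hW' b
  choose app happ using main
  have hloc : ∀ W' W (hW : W ≤ V) (hW' : W ≤ h ⁻¹ᵁ W') (b : Γ(Y, W')), ∀ x ∈ W,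
      ∃ (W₁ : X.Opens) (i : W₁ ≤ W), x ∈ W₁ ∧
        rel W' W₁ (i.trans hW) (i.trans hW') b (res X i (app W' W hW hW' b)) := by
    intro W' W hW hW' b x hx
    obtain ⟨W₁, i, c, hx1, hc⟩ := hex W' W hW hW' b x hx
    exact ⟨W₁, i, hx1, by rwa [happ _ _ _ _ _ _ i c hc]⟩
  have hres' : ∀ W' W₁ W₂ (i : W₂ ≤ W₁) (h₁ : W₁ ≤ V) (h₁' : W₁ ≤ h ⁻¹ᵁ W') b c,
      rel W' W₁ h₁ h₁' b c → rel W' W₂ (i.trans h₁) (i.trans h₁') b (res X i c) := by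
    intro W' W₁ W₂ i h₁ h₁' b c hc
    have := hres W' W' W₁ W₂ le_rfl i h₁ h₁' (i.trans h₁') b c hc
    rwa [res_self] at this
  refine ⟨⟨app, ?_, ?_, ?_⟩, ?_⟩
  · intro W' W hW hW' b b'
    refine section_ext fun x hx => ?_
    obtain ⟨W₁, i, hx1, r1⟩ := hloc W' W hW hW' b x hx
    obtain ⟨W₂, j, hx2, r2⟩ := hloc W' W hW hW' b' x hx
    refine ⟨W₁ ⊓ W₂, inf_le_left.trans i, ⟨hx1, hx2⟩, ?_⟩
    have r1 := hres' _ _ (W₁ ⊓ W₂) inf_le_left _ _ _ _ r1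
    have r2 := hres' _ _ (W₁ ⊓ W₂) inf_le_right _ _ _ _ r2
    rw [res_res] at r1 r2
    rw [happ _ _ _ _ _ _ _ _ (hadd _ _ _ _ _ _ _ _ r1 r2), map_add]
  · intro W' W hW hW' b b'
    refine section_ext fun x hx => ?_
    obtain ⟨W₁, i, hx1, r1⟩ := hloc W' W hW hW' b x hx
    obtain ⟨W₂, j, hx2, r2⟩ := hloc W' W hW hW' b' x hx
    refine ⟨W₁ ⊓ W₂, inf_le_left.trans i, ⟨hx1, hx2⟩, ?_⟩
    have r1 := hres' _ _ (W₁ ⊓ W₂) inf_le_left _ _ _ _ r1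
    have r2 := hres' _ _ (W₁ ⊓ W₂) inf_le_right _ _ _ _ r2
    rw [res_res] at r1 r2
    rw [happ _ _ _ _ _ _ _ _ (hmul _ _ _ _ _ _ _ _ r1 r2), map_add, map_mul, map_mul,
      res_appLE, res_appLE]
  · intro W₁' W₂' W₁ W₂ i j h₁ h₁' h₂' b
    refine section_ext fun x hx => ?_
    obtain ⟨W₃, k, hx3, r⟩ := hloc W₁' W₁ h₁ h₁' b x (j hx)
    refine ⟨W₂ ⊓ W₃, inf_le_left, ⟨hx, hx3⟩, ?_⟩
    have r := hres _ W₂' _ (W₂ ⊓ W₃) i inf_le_right _ _ (inf_le_left.trans h₂') _ _ r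
    rw [happ _ _ _ _ _ _ inf_le_left _ r, res_res, res_res]
  · intro W' W hW hW' b c hc
    have := happ W' W hW hW' b W le_rfl c hc
    rwa [res_self] at this

/-- Gluing of derivations along `h`. -/
theorem exists_glue (P : ∀ V' : X.Opens, ADer h V' → Prop)
    (hP : ∀ V₁ V₂ (δ₁ : ADer h V₁) (δ₂ : ADer h V₂), P V₁ δ₁ → P V₂ δ₂ →
      δ₁.restrict (inf_le_left : V₁ ⊓ V₂ ≤ V₁) = δ₂.restrict inf_le_right)
    (hex : ∀ x ∈ V, ∃ (V₁ : X.Opens) (δ : ADer h V₁), x ∈ V₁ ∧ P V₁ δ) :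
    ∃ δ : ADer h V, ∀ V₁ δ₁, P V₁ δ₁ →
      ∀ W' W (hW : W ≤ V) (hW₁ : W ≤ V₁) (hW') b,
        δ.app W' W hW hW' b = δ₁.app W' W hW₁ hW' b := by
  have hagree : ∀ V₁ V₂ (δ₁ : ADer h V₁) (δ₂ : ADer h V₂), P V₁ δ₁ → P V₂ δ₂ →
      ∀ W' W (h₁ : W ≤ V₁) (h₂ : W ≤ V₂) (hW') b,
        δ₁.app W' W h₁ hW' b = δ₂.app W' W h₂ hW' b := by
    intro V₁ V₂ δ₁ δ₂ p₁ p₂ W' W h₁ h₂ hW' b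
    exact congrArg (fun d : ADer h (V₁ ⊓ V₂) => d.app W' W (le_inf h₁ h₂) hW' b)
      (hP V₁ V₂ δ₁ δ₂ p₁ p₂)
  have key := exists_of_rel (h := h) (V := V)
    (fun W' W hW hW' b c => ∃ (V₁ : X.Opens) (δ₁ : ADer h V₁) (hW₁ : W ≤ V₁), P V₁ δ₁ ∧
      δ₁.app W' W hW₁ hW' b = c) ?_ ?_ ?_ ?_ ?_
  · obtain ⟨δ, hδ⟩ := key
    exact ⟨δ, fun V₁ δ₁ p W' W hW hW₁ hW' b => hδ _ _ _ _ _ _ ⟨V₁, δ₁, hW₁, p, rfl⟩⟩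
  · rintro W₁' W₂' W₁ W₂ i j h₁ h₁' h₂' b c ⟨V₁, δ₁, hW₁, p, rfl⟩
    exact ⟨V₁, δ₁, j.trans hW₁, p, δ₁.app_map _ _ _ _ _ _ _ _ _ _⟩
  · rintro W' W hW hW' b c c' ⟨V₁, δ₁, hW₁, p, rfl⟩ ⟨V₂, δ₂, hW₂, p', rfl⟩
    exact hagree _ _ _ _ p p' _ _ _ _ _ _
  · intro W' W hW hW' b x hx
    obtain ⟨V₁, δ₁, hx1, p⟩ := hex x (hW hx)
    exact ⟨W ⊓ V₁, inf_le_left, δ₁.app W' _ inf_le_right (inf_le_left.trans hW') b, ⟨hx, hx1⟩,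
      V₁, δ₁, inf_le_right, p, rfl⟩
  · rintro W' W hW hW' b b' c c' ⟨V₁, δ₁, hW₁, p, rfl⟩ ⟨V₂, δ₂, hW₂, p', rfl⟩
    refine ⟨V₁, δ₁, hW₁, p, ?_⟩
    rw [δ₁.app_add, hagree _ _ _ _ p p' _ _ _ hW₂ _ b']
  · rintro W' W hW hW' b b' c c' ⟨V₁, δ₁, hW₁, p, rfl⟩ ⟨V₂, δ₂, hW₂, p', rfl⟩
    refine ⟨V₁, δ₁, hW₁, p, ?_⟩
    rw [δ₁.app_mul, hagree _ _ _ _ p p' _ _ _ hW₂ _ b']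

/-- A derivation of the coordinate ring of an affine open extends to a derivation along `h`. -/
theorem exists_of_affine {P : Y.Opens} (hP : IsAffineOpen P) (hV : V ≤ h ⁻¹ᵁ P)
    (d : Γ(Y, P) → Γ(X, V)) (dadd : ∀ a b, d (a + b) = d a + d b)
    (dmul : ∀ a b, d (a * b) =
      (h.appLE P V hV).hom a * d b + (h.appLE P V hV).hom b * d a) :
    ∃ δ : ADer h V, ∀ a, δ.app P V le_rfl hV a = d a := by
  have d0 : d 0 = 0 := by simpa using dadd 0 0
  have dsub : ∀ a b, d (a - b) = d a - d b := fun a b => by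
    have := dadd (a - b) b
    rw [sub_add_cancel] at this
    rw [this]; ring
  -- The graph: `b` is locally a fraction `a / r`, and its value `c` solves the quotient rule `r c +
  -- b (d r) = d a`.
  have key := exists_of_rel (h := h) (V := V)
    (fun W' W hW hW' b c => ∃ r a : Γ(Y, P), W ≤ h ⁻¹ᵁ (Y.basicOpen r) ∧
      (∀ (U : Y.Opens) (h₁ : U ≤ W') (h₂ : U ≤ P), U ≤ Y.basicOpen r →
        res Y h₂ r * res Y h₁ b = res Y h₂ a) ∧
      (h.appLE P W (hW.trans hV)).hom r * c + (h.appLE W' W hW').hom b * res X hW (d r) =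
        res X hW (d a)) ?_ ?_ ?_ ?_ ?_
  · obtain ⟨δ, hδ⟩ := key
    refine ⟨δ, fun a => hδ _ _ _ _ _ _ ⟨1, a, ?_, ?_, ?_⟩⟩
    · rw [Scheme.basicOpen_of_isUnit _ isUnit_one]; exact hV
    · intro U h₁ h₂ _
      rw [map_one, one_mul]
    · have d1 : d 1 = 0 := by simpa using dmul 1 1
      rw [map_one, one_mul, d1, map_zero, mul_zero, add_zero, res_self]
  · rintro W₁' W₂' W₁ W₂ i j h₁ h₁' h₂' b c ⟨r, a, hr, e, ec⟩
    refine ⟨r, a, j.trans hr, fun U k₁ k₂ k => ?_, ?_⟩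
    · rw [res_res]; exact e U _ k₂ k
    · have := congrArg (res X j) ec
      rw [map_add, map_mul, map_mul, res_appLE, res_appLE, res_res, res_res] at this
      rw [appLE_res]
      exact this
  · rintro W' W hW hW' b c c' ⟨r, a, hr, e, ec⟩ ⟨r', a', hr', e', ec'⟩
    refine section_ext fun x hx => ?_
    obtain ⟨s, hs, hxs⟩ := hP.exists_basicOpen_le (V := W' ⊓ Y.basicOpen r ⊓ Y.basicOpen r')
      ⟨h x, ⟨⟨hW' hx, hr hx⟩, hr' hx⟩⟩ (hV (hW hx))
    have hsP := Y.basicOpen_le s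
    have e := e _ (hs.trans (inf_le_left.trans inf_le_left)) hsP
      (hs.trans (inf_le_left.trans inf_le_right))
    have e' := e' _ (hs.trans (inf_le_left.trans inf_le_left)) hsP (hs.trans inf_le_right)
    have := hP.isLocalization_basicOpen s
    -- Two fractions for the same `b` are cross-multiplied on a basic open of `s`. In the coordinate
    -- ring of `P`, where `d` is defined, the resulting identity holds only after multiplication by
    -- a power of `s`.
    have ez : res Y hsP (a * r' - a' * r) = 0 := by
      rw [map_sub, map_mul, map_mul, ← e, ← e']; ring
    obtain ⟨⟨_, n, rfl⟩, hn⟩ := (IsLocalization.map_eq_zero_iff (Submonoid.powers s)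
      Γ(Y, Y.basicOpen s) (a * r' - a' * r)).mp ez
    set U : X.Opens := W ⊓ h ⁻¹ᵁ (Y.basicOpen s) with hU
    have hUW : U ≤ W := inf_le_left
    have hUP := hUW.trans (hW.trans hV)
    refine ⟨U, hUW, ⟨hx, hxs⟩, ?_⟩
    have us := (isUnit_of_le_basicOpen (h := h) s hUP inf_le_right).pow n
    have ur := isUnit_of_le_basicOpen (h := h) r hUP (hUW.trans hr)
    have ur' := isUnit_of_le_basicOpen (h := h) r' hUP (hUW.trans hr')
    -- Applying `d` to `s ^ n (a r' - a' r) = 0` gives two terms. The one with `d (s ^ n)` has a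
    -- factor that vanishes on `U`; in the other `s` is a unit, so `d` of the cross-difference
    -- vanishes.
    have hd := congrArg (fun z => res X (hUW.trans hW) (d z)) hn
    simp only [dmul, dsub, d0, map_zero, map_add, map_sub, map_mul, res_appLE] at hd
    have ez' := congrArg (h.appLE _ U inf_le_right).hom ez
    rw [appLE_res, map_zero, map_sub, map_mul, map_mul] at ez'
    rw [ez', zero_mul, add_zero, map_pow] at hd
    have hd := (us.mul_right_eq_zero).mp hd
    have ec := congrArg (res X hUW) ec
    have ec' := congrArg (res X hUW) ec'
    rw [map_add, map_mul, map_mul, res_appLE, res_appLE, res_res, res_res] at ec ec'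
    have e := congrArg (h.appLE _ U inf_le_right).hom e
    have e' := congrArg (h.appLE _ U inf_le_right).hom e'
    rw [map_mul, appLE_res, appLE_res, appLE_res] at e e'
    refine (ur.mul ur').mul_left_cancel ?_
    rw [← ec, ← ec', ← e, ← e'] at hd
    linear_combination hd
  · intro W' W hW hW' b x hx
    obtain ⟨r, a, hxr, hrW, e⟩ := exists_fraction hP b (y := h x) (hV (hW hx)) (hW' hx)
    set U : X.Opens := W ⊓ h ⁻¹ᵁ (Y.basicOpen r) with hU
    have hUW : U ≤ W := inf_le_left
    have hUP := hUW.trans (hW.trans hV)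
    obtain ⟨u, hu⟩ := isUnit_of_le_basicOpen (h := h) r hUP inf_le_right
    refine ⟨U, hUW, ↑u⁻¹ * (res X (hUW.trans hW) (d a) -
      (h.appLE W' U (hUW.trans hW')).hom b * res X (hUW.trans hW) (d r)), ⟨hx, hxr⟩, r, a,
      inf_le_right, e, ?_⟩
    rw [← hu, ← mul_assoc, u.mul_inv, one_mul, sub_add_cancel]
  · rintro W' W hW hW' b b' c c' ⟨r, a, hr, e, ec⟩ ⟨r', a', hr', e', ec'⟩
    refine ⟨r * r', r' * a + r * a', ?_, ?_, ?_⟩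
    · rw [Scheme.basicOpen_mul]; exact le_inf hr hr'
    · intro U h₁ h₂ hU
      rw [Scheme.basicOpen_mul] at hU
      rw [map_mul, map_add, map_add, map_mul, map_mul, ← e U h₁ h₂ (hU.trans inf_le_left),
        ← e' U h₁ h₂ (hU.trans inf_le_right)]
      ring
    · have hi : W ≤ h ⁻¹ᵁ (W' ⊓ Y.basicOpen r) := le_inf_preimage hW' hr
      have hi' : W ≤ h ⁻¹ᵁ (W' ⊓ Y.basicOpen r') := le_inf_preimage hW' hr'
      have e := congrArg (h.appLE (W' ⊓ Y.basicOpen r) W hi).hom (e (W' ⊓ Y.basicOpen r) inf_le_left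
        (inf_le_right.trans (Y.basicOpen_le _)) inf_le_right)
      have e' := congrArg (h.appLE (W' ⊓ Y.basicOpen r') W hi').hom
        (e' (W' ⊓ Y.basicOpen r') inf_le_left
        (inf_le_right.trans (Y.basicOpen_le _)) inf_le_right)
      rw [map_mul, appLE_res, appLE_res, appLE_res] at e e'
      simp only [dmul, dadd, map_add, map_mul, res_appLE]
      rw [← e, ← e', ← ec, ← ec']
      ring
  · rintro W' W hW hW' b b' c c' ⟨r, a, hr, e, ec⟩ ⟨r', a', hr', e', ec'⟩
    refine ⟨r * r', a * a', ?_, ?_, ?_⟩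
    · rw [Scheme.basicOpen_mul]; exact le_inf hr hr'
    · intro U h₁ h₂ hU
      rw [Scheme.basicOpen_mul] at hU
      rw [map_mul, map_mul, map_mul, ← e U h₁ h₂ (hU.trans inf_le_left),
        ← e' U h₁ h₂ (hU.trans inf_le_right)]
      ring
    · have hi : W ≤ h ⁻¹ᵁ (W' ⊓ Y.basicOpen r) := le_inf_preimage hW' hr
      have hi' : W ≤ h ⁻¹ᵁ (W' ⊓ Y.basicOpen r') := le_inf_preimage hW' hr'
      have e := congrArg (h.appLE (W' ⊓ Y.basicOpen r) W hi).hom (e (W' ⊓ Y.basicOpen r) inf_le_left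
        (inf_le_right.trans (Y.basicOpen_le _)) inf_le_right)
      have e' := congrArg (h.appLE (W' ⊓ Y.basicOpen r') W hi').hom
        (e' (W' ⊓ Y.basicOpen r') inf_le_left
        (inf_le_right.trans (Y.basicOpen_le _)) inf_le_right)
      rw [map_mul, appLE_res, appLE_res, appLE_res] at e e'
      simp only [dmul, map_add, map_mul, res_appLE]
      rw [← e, ← e', ← ec, ← ec']
      ring

end ADer

/-! ### Derivations and fibre products -/

section Comp

variable {X Y Z T : Scheme.{u}} {h : Z ⟶ X} {V : Z.Opens}

/-- The composition of a derivation `O_X → h_* O_Z` with `p^* : O_Y → p_* O_X`. -/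
def ADer.comp (δ : ADer h V) (p : X ⟶ Y) (k : Z ⟶ Y) (hk : h ≫ p = k) : ADer k V where
  app W' W hW hW' b := δ.app (p ⁻¹ᵁ W') W hW (le_preimage_of_comp hk hW')
    ((p.app W').hom b)
  app_add W' W hW hW' a b := by rw [_root_.map_add, δ.app_add]
  app_mul W' W hW hW' a b := by
    rw [_root_.map_mul, δ.app_mul, appLE_app, appLE_app]
    subst hk
    rfl
  app_map W₁' W₂' W₁ W₂ i j h₁ h₁' h₂' a := by
    rw [← δ.app_map (p ⁻¹ᵁ W₁') (p ⁻¹ᵁ W₂') W₁ W₂ (p.preimage_mono i) j h₁]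
    · congr 1
      rw [Scheme.Hom.app_eq_appLE, Scheme.Hom.app_eq_appLE, res_appLE, appLE_res]
    · subst hk; exact h₂'

lemma ADer.comp_app (δ : ADer h V) {p : X ⟶ Y} {k : Z ⟶ Y} (hk : h ≫ p = k) {W' : Y.Opens}
    {W : Z.Opens} (hW : W ≤ V) (hW' : W ≤ k ⁻¹ᵁ W') {W₁ : X.Opens} (e : W₁ ≤ p ⁻¹ᵁ W')
    (hW₁ : W ≤ h ⁻¹ᵁ W₁) (b : Γ(Y, W')) :
    (δ.comp p k hk).app W' W hW hW' b = δ.app W₁ W hW hW₁ ((p.appLE W' W₁ e).hom b) := by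
  have := δ.app_res e hW hW₁ ((p.app W').hom b)
  rw [Scheme.Hom.app_eq_appLE, res_appLE] at this
  rw [this, ← Scheme.Hom.app_eq_appLE]
  rfl

end Comp

section Pullback

variable {X Y S B Z : Scheme.{u}} {p : X ⟶ Y} {q : X ⟶ S} {f : Y ⟶ B} {g : S ⟶ B}

/-- Around every point the fibre product is a product of affines, whose coordinate ring is a tensor
product. Ring homomorphisms out of it, in particular those to dual numbers, are therefore given by
pairs. -/
lemma exists_affine_pushout (H : IsPullback p q f g) (x : X) :
    ∃ (B₀ : B.Opens) (Y₀ : Y.Opens) (S₀ : S.Opens) (P : X.Opens) (_ : IsAffineOpen B₀)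
      (_ : IsAffineOpen Y₀) (_ : IsAffineOpen S₀) (_ : IsAffineOpen P) (_ : x ∈ P)
      (hY : Y₀ ≤ f ⁻¹ᵁ B₀) (hS : S₀ ≤ g ⁻¹ᵁ B₀) (hp : P ≤ p ⁻¹ᵁ Y₀) (hq : P ≤ q ⁻¹ᵁ S₀),
      IsPushout (f.appLE B₀ Y₀ hY) (g.appLE B₀ S₀ hS) (p.appLE Y₀ P hp) (q.appLE S₀ P hq) := by
  obtain ⟨B₀, hB, hxB, -⟩ := exists_isAffineOpen_mem_and_subset (X := B) (x := (p ≫ f) x)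
    (U := ⊤) trivial
  obtain ⟨Y₀, hY, hxY, hYB⟩ := exists_isAffineOpen_mem_and_subset (X := Y) (x := p x)
    (U := f ⁻¹ᵁ B₀) hxB
  have hxS' : q x ∈ g ⁻¹ᵁ B₀ := by
    have : (q ≫ g) x ∈ B₀ := by rw [← H.w]; exact hxB
    exact this
  obtain ⟨S₀, hS, hxS, hSB⟩ := exists_isAffineOpen_mem_and_subset (X := S) (x := q x)
    (U := g ⁻¹ᵁ B₀) hxS'
  have hiso := isIso_pushoutSection_of_isAffineOpen H (US := B₀) (UT := S₀) (UX := Y₀)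
    (UY := p ⁻¹ᵁ Y₀ ⊓ q ⁻¹ᵁ S₀) hSB hYB rfl hB hS hY
  have haff : IsAffineOpen (p ⁻¹ᵁ Y₀ ⊓ q ⁻¹ᵁ S₀) := by
    have : IsAffine _ := hB
    have : IsAffine _ := hY
    have : IsAffine _ := hS
    exact .of_isIso (Scheme.Hom.isPullback_resLE H hSB hYB rfl).isoPullback.hom
  exact ⟨B₀, Y₀, S₀, _, hB, hY, hS, haff, ⟨hxY, hxS⟩, hYB, hSB, inf_le_left, inf_le_right,
    (isIso_pushoutSection_iff H hSB hYB rfl).mp hiso⟩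

/-- A derivation along `h : Z ⟶ X`, with `X = Y ×_B S`, is determined by its restrictions to `O_Y`
and `O_S`. -/
theorem ADer.ext_of_isPullback (H : IsPullback p q f g) {h : Z ⟶ X} {V : Z.Opens}
    {δ δ' : ADer h V} {k : Z ⟶ Y} {l : Z ⟶ S} (hk : h ≫ p = k) (hl : h ≫ q = l)
    (hp : δ.comp p k hk = δ'.comp p k hk) (hq : δ.comp q l hl = δ'.comp q l hl) :
    δ = δ' := by
  refine ADer.ext_local fun z hz => ?_
  obtain ⟨B₀, Y₀, S₀, P, hB, hY, hS, hP, hzP, hYB, hSB, hp', hq', po⟩ :=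
    exists_affine_pushout H (h z)
  refine ⟨V ⊓ h ⁻¹ᵁ P, inf_le_left, ⟨hz, hzP⟩, ?_⟩
  refine ADer.ext_of_affine hP inf_le_right fun a => ?_
  have i₁ : V ⊓ h ⁻¹ᵁ P ≤ k ⁻¹ᵁ Y₀ := by subst hk; exact inf_le_right.trans (h.preimage_mono hp')
  have i₂ : V ⊓ h ⁻¹ᵁ P ≤ l ⁻¹ᵁ S₀ := by subst hl; exact inf_le_right.trans (h.preimage_mono hq')
  -- As homomorphisms to the dual numbers the two derivations fall under the universal property of
  -- the pushout.
  have key : CommRingCat.ofHom (δ.toDual P (V ⊓ h ⁻¹ᵁ P) inf_le_left inf_le_right) =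
      CommRingCat.ofHom (δ'.toDual P (V ⊓ h ⁻¹ᵁ P) inf_le_left inf_le_right) := by
    refine po.hom_ext ?_ ?_
    · refine CommRingCat.hom_ext (RingHom.ext fun b => ?_)
      change δ.toDual P _ _ _ ((p.appLE Y₀ P hp').hom b) =
        δ'.toDual P _ _ _ ((p.appLE Y₀ P hp').hom b)
      apply TrivSqZeroExt.ext
      · rw [ADer.toDual_fst, ADer.toDual_fst]
      · rw [ADer.toDual_snd, ADer.toDual_snd, ← δ.comp_app hk _ i₁, ← δ'.comp_app hk _ i₁, hp]
    · refine CommRingCat.hom_ext (RingHom.ext fun b => ?_)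
      change δ.toDual P _ _ _ ((q.appLE S₀ P hq').hom b) =
        δ'.toDual P _ _ _ ((q.appLE S₀ P hq').hom b)
      apply TrivSqZeroExt.ext
      · rw [ADer.toDual_fst, ADer.toDual_fst]
      · rw [ADer.toDual_snd, ADer.toDual_snd, ← δ.comp_app hl _ i₂, ← δ'.comp_app hl _ i₂, hq]
  have := congrArg (fun r => TrivSqZeroExt.snd (r a)) (congrArg CommRingCat.Hom.hom key)
  simp only [CommRingCat.hom_ofHom, ADer.toDual_snd] at this
  exact this

lemma ADer.restrict_comp {h : Z ⟶ X} {V V' : Z.Opens} (δ : ADer h V) (p : X ⟶ Y) (k : Z ⟶ Y)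
    (hk : h ≫ p = k) (i : V' ≤ V) : (δ.restrict i).comp p k hk = (δ.comp p k hk).restrict i := rfl

/-- Derivations along the projections of `X = Y ×_B S` that agree on `O_B` come from a derivation
of `O_X`. -/
theorem ADer.exists_of_isPullback (H : IsPullback p q f g) {h : Z ⟶ X} {k : Z ⟶ Y} {l : Z ⟶ S}
    {m : Z ⟶ B} (hk : h ≫ p = k) (hl : h ≫ q = l) (hm : k ≫ f = m) (hm' : l ≫ g = m)
    {V : Z.Opens} (δ₁ : ADer k V) (δ₂ : ADer l V) (hB : δ₁.comp f m hm = δ₂.comp g m hm') :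
    ∃ δ : ADer h V, δ.comp p k hk = δ₁ ∧ δ.comp q l hl = δ₂ := by
  let Pr : ∀ V' : Z.Opens, ADer h V' → Prop := fun V' δ => ∃ i : V' ≤ V,
    δ.comp p k hk = δ₁.restrict i ∧ δ.comp q l hl = δ₂.restrict i
  have hloc : ∀ x ∈ V, ∃ (V₁ : Z.Opens) (δ : ADer h V₁), x ∈ V₁ ∧ Pr V₁ δ := by
    intro x hx
    obtain ⟨B₀, Y₀, S₀, P, hB₀, hY₀, hS₀, hP, hxP, hYB, hSB, hp, hq, po⟩ :=
      exists_affine_pushout H (h x)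
    set U : Z.Opens := V ⊓ h ⁻¹ᵁ P with hU
    have hUV : U ≤ V := inf_le_left
    have hUP : U ≤ h ⁻¹ᵁ P := inf_le_right
    have hUY : U ≤ k ⁻¹ᵁ Y₀ := by subst hk; exact hUP.trans (h.preimage_mono hp)
    have hUS : U ≤ l ⁻¹ᵁ S₀ := by subst hl; exact hUP.trans (h.preimage_mono hq)
    have hUB : U ≤ m ⁻¹ᵁ B₀ := by subst hm; exact hUY.trans (k.preimage_mono hYB)
    let r₁ := δ₁.toDual Y₀ U hUV hUY
    let r₂ := δ₂.toDual S₀ U hUV hUS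
    -- The two derivations become one homomorphism to the dual numbers; agreement of `δ₁` and `δ₂`
    -- on `O_B` is the required compatibility.
    let r := po.desc (CommRingCat.ofHom r₁) (CommRingCat.ofHom r₂) (by
      refine CommRingCat.hom_ext (RingHom.ext fun b => ?_)
      change r₁ ((f.appLE B₀ Y₀ hYB).hom b) = r₂ ((g.appLE B₀ S₀ hSB).hom b)
      apply TrivSqZeroExt.ext
      · rw [ADer.toDual_fst, ADer.toDual_fst, appLE_appLE, appLE_appLE]
        exact appLE_congr_hom (hm.trans hm'.symm) _ b
      · rw [ADer.toDual_snd, ADer.toDual_snd, ← δ₁.comp_app hm _ hUB, ← δ₂.comp_app hm' _ hUB, hB])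
    have hr₁ : ∀ b, r.hom ((p.appLE Y₀ P hp).hom b) = r₁ b := fun b =>
      congrArg (fun φ => CommRingCat.Hom.hom φ b) (po.inl_desc _ _ _)
    have hr₂ : ∀ b, r.hom ((q.appLE S₀ P hq).hom b) = r₂ b := fun b =>
      congrArg (fun φ => CommRingCat.Hom.hom φ b) (po.inr_desc _ _ _)
    -- Only once the first component is known to be `h^*` is the second component a derivation along
    -- `h`.
    have hfst : ∀ a, (r.hom a).fst = (h.appLE P U hUP).hom a := by
      intro a
      have : r ≫ CommRingCat.ofHom (TrivSqZeroExt.fstHom Γ(Z, U) Γ(Z, U) Γ(Z, U)).toRingHom =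
          h.appLE P U hUP := by
        refine po.hom_ext ?_ ?_
        · refine CommRingCat.hom_ext (RingHom.ext fun b => ?_)
          change (r.hom ((p.appLE Y₀ P hp).hom b)).fst =
            (h.appLE P U hUP).hom ((p.appLE Y₀ P hp).hom b)
          rw [hr₁, ADer.toDual_fst, appLE_appLE]
          exact appLE_congr_hom hk.symm _ b
        · refine CommRingCat.hom_ext (RingHom.ext fun b => ?_)
          change (r.hom ((q.appLE S₀ P hq).hom b)).fst =
            (h.appLE P U hUP).hom ((q.appLE S₀ P hq).hom b)
          rw [hr₂, ADer.toDual_fst, appLE_appLE]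
          exact appLE_congr_hom hl.symm _ b
      exact congrArg (fun φ => CommRingCat.Hom.hom φ a) this
    obtain ⟨δ, hδ⟩ := ADer.exists_of_affine (h := h) (V := U) hP hUP
      (fun a => (r.hom a).snd) (fun a b => by rw [_root_.map_add, TrivSqZeroExt.snd_add])
      (fun a b => by
        rw [_root_.map_mul, TrivSqZeroExt.snd_mul, hfst, hfst, smul_eq_mul,
          MulOpposite.smul_eq_mul_unop, MulOpposite.unop_op, mul_comm (TrivSqZeroExt.snd _)])
    refine ⟨U, δ, ⟨hx, hxP⟩, hUV, ?_, ?_⟩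
    · refine ADer.ext_of_affine hY₀ hUY fun a => ?_
      rw [δ.comp_app hk _ _ hp hUP, hδ, hr₁, ADer.toDual_snd]
      rfl
    · refine ADer.ext_of_affine hS₀ hUS fun a => ?_
      rw [δ.comp_app hl _ _ hq hUP, hδ, hr₂, ADer.toDual_snd]
      rfl
  have key := ADer.exists_glue (h := h) (V := V) Pr ?_ hloc
  · obtain ⟨δ, hδ⟩ := key
    have hres : ∀ V₁ (d : ADer h V₁) (hd : Pr V₁ d), δ.restrict hd.1 = d := by
      intro V₁ d hd
      ext W' W hW hW' b
      exact hδ V₁ d hd W' W (hW.trans hd.1) hW hW' b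
    refine ⟨δ, ADer.ext_local fun x hx => ?_, ADer.ext_local fun x hx => ?_⟩
    · obtain ⟨V₁, d, hx1, hd⟩ := hloc x hx
      refine ⟨V₁, hd.1, hx1, ?_⟩
      rw [← ADer.restrict_comp, hres _ _ hd, hd.2.1]
    · obtain ⟨V₁, d, hx1, hd⟩ := hloc x hx
      refine ⟨V₁, hd.1, hx1, ?_⟩
      rw [← ADer.restrict_comp, hres _ _ hd, hd.2.2]
  · rintro V₁ V₂ d₁ d₂ ⟨i₁, a₁, b₁⟩ ⟨i₂, a₂, b₂⟩
    refine ADer.ext_of_isPullback H hk hl ?_ ?_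
    · rw [ADer.restrict_comp, ADer.restrict_comp, a₁, a₂]; rfl
    · rw [ADer.restrict_comp, ADer.restrict_comp, b₁, b₂]; rfl

end Pullback

/-! ### Vector fields -/

namespace VectorField

variable {X Y Z T T' : Scheme.{u}} {x : X ⟶ T} {V : X.Opens}

lemma add_app (D E : VectorField x V) (W hW a) :
    (D + E).app W hW a = D.app W hW a + E.app W hW a := rfl

lemma neg_app (D : VectorField x V) (W hW a) : (-D).app W hW a = - D.app W hW a := rfl

lemma zero_app (W hW a) : (0 : VectorField x V).app W hW a = 0 := rfl

lemma smul_app (c : Γ(X, V)) (D : VectorField x V) (W) (hW : W ≤ V) (a) :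
    (c • D).app W hW a = res X hW c * D.app W hW a := rfl

lemma bracket_app (D E : VectorField x V) (W hW a) :
    (D.bracket E).app W hW a = D.app W hW (E.app W hW a) - E.app W hW (D.app W hW a) := rfl

lemma restrict_app (D : VectorField x V) {V' : X.Opens} (h : V' ≤ V) (W) (hW : W ≤ V') (a) :
    (D.restrict h).app W hW a = D.app W (hW.trans h) a := rfl

lemma app_map (D : VectorField x V) {W W' : X.Opens} (h : W' ≤ W) (hW : W ≤ V) (a : Γ(X, W)) :
    D.app W' (h.trans hW) (res X h a) = res X h (D.app W hW a) := D.map_res W W' h hW a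

lemma app_one (D : VectorField x V) (W hW) : D.app W hW 1 = 0 := by
  have := D.leibniz W hW 1 1
  simpa using this

lemma app_neg (D : VectorField x V) (W hW a) : D.app W hW (-a) = - D.app W hW a := by
  have := D.app_sub W hW 0 a
  rwa [zero_sub, D.app_zero, zero_sub] at this

/-- A vector field is additive. -/
def toAddHom (D : VectorField x V) (W : X.Opens) (hW : W ≤ V) : Γ(X, W) →+ Γ(X, W) where
  toFun := D.app W hW
  map_zero' := D.app_zero W hW
  map_add' := D.map_add W hW

/-- The derivation `E ∘ h^*` along `h`. -/
def along (E : VectorField x V) (h : X ⟶ Y) : ADer h V where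
  app W' W hW hW' b := E.app W hW ((h.appLE W' W hW').hom b)
  app_add W' W hW hW' a b := by rw [_root_.map_add, E.map_add]
  app_mul W' W hW hW' a b := by rw [_root_.map_mul, E.leibniz]
  app_map W₁' W₂' W₁ W₂ i j h₁ h₁' h₂' a := by
    rw [← E.app_map, appLE_res, res_appLE]

lemma along_app (E : VectorField x V) (h : X ⟶ Y) (W' W hW hW' b) :
    (E.along h).app W' W hW hW' b = E.app W hW ((h.appLE W' W hW').hom b) := rfl

lemma along_comp (E : VectorField x V) (h : X ⟶ Y) (p : Y ⟶ Z) (k : X ⟶ Z) (hk : h ≫ p = k) :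
    (E.along h).comp p k hk = E.along k := by
  subst hk
  ext W' W hW hW' b
  change E.app W hW ((h.appLE (p ⁻¹ᵁ W') W (le_preimage_of_comp rfl hW')).hom
    ((p.app W').hom b)) = _
  rw [appLE_app]
  rfl

lemma along_id_app (E : VectorField x V) (W hW) (hW' : W ≤ (𝟙 X : X ⟶ X) ⁻¹ᵁ W) (a : Γ(X, W)) :
    (E.along (𝟙 X)).app W W hW hW' a = E.app W hW a := by
  rw [along_app, id_appLE _ le_rfl, res_self]

lemma app_eq_of_along {x' : X ⟶ T'} {E : VectorField x V} {E' : VectorField x' V}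
    (H : E.along (𝟙 X) = E'.along (𝟙 X)) (W hW a) : E.app W hW a = E'.app W hW a := by
  rw [← along_id_app E W hW (le_preimage_id le_rfl),
    ← along_id_app E' W hW (le_preimage_id le_rfl), H]

lemma ext_local {E E' : VectorField x V}
    (H : ∀ y ∈ V, ∃ (V' : X.Opens) (i : V' ≤ V), y ∈ V' ∧ E.restrict i = E'.restrict i) :
    E = E' := by
  ext W hW a
  refine app_eq_of_along (ADer.ext_local fun y hy => ?_) W hW a
  obtain ⟨V', i, hy', e⟩ := H y hy
  exact ⟨V', i, hy', congrArg (fun D : VectorField x V' => D.along (𝟙 X)) e⟩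

/-- The derivation `h^* ∘ E` along `h`. -/
def pull {y : Y ⟶ T} {V' : Y.Opens} (E : VectorField y V') (h : X ⟶ Y) (hV : V ≤ h ⁻¹ᵁ V') :
    ADer h V where
  app W' W hW hW' b :=
    (h.appLE (W' ⊓ V') W (le_inf_preimage hW' (hW.trans hV))).hom
      (E.app (W' ⊓ V') inf_le_right (res Y inf_le_left b))
  app_add W' W hW hW' a b := by rw [_root_.map_add, E.map_add, _root_.map_add]
  app_mul W' W hW hW' a b := by
    rw [_root_.map_mul, E.leibniz, _root_.map_add, _root_.map_mul, _root_.map_mul, appLE_res,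
      appLE_res]
  app_map W₁' W₂' W₁ W₂ i j h₁ h₁' h₂' a := by
    rw [res_appLE, res_res, ← res_res inf_le_left (inf_le_inf_right V' i), E.app_map, appLE_res]

/-- The definition uses the largest possible open `W' ⊓ V'`; any smaller one through which `W` maps
gives the same value. -/
lemma pull_app {y : Y ⟶ T} {V' : Y.Opens} (E : VectorField y V') (h : X ⟶ Y) (hV : V ≤ h ⁻¹ᵁ V')
    (W' W hW hW' b) (W₁ : Y.Opens) (h₁ : W₁ ≤ W') (h₁' : W₁ ≤ V') (h₂ : W ≤ h ⁻¹ᵁ W₁) :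
    (E.pull h hV).app W' W hW hW' b = (h.appLE W₁ W h₂).hom (E.app W₁ h₁' (res Y h₁ b)) := by
  change (h.appLE (W' ⊓ V') W _).hom (E.app (W' ⊓ V') inf_le_right (res Y inf_le_left b)) = _
  have hle : W₁ ≤ W' ⊓ V' := le_inf h₁ h₁'
  have e : res Y h₁ b = res Y hle (res Y inf_le_left b) := (res_res _ _ _).symm
  rw [e, E.app_map hle inf_le_right, appLE_res]

/-- The derivation `h^* ∘ E ∘ p^*` along `h ≫ p`. -/
lemma pull_comp_app {y : Y ⟶ T} {V' : Y.Opens} (E : VectorField y V') (h : X ⟶ Y)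
    (hV : V ≤ h ⁻¹ᵁ V') (p : Y ⟶ Z) (k : X ⟶ Z) (hk : h ≫ p = k) (W' : Z.Opens) (W : X.Opens)
    (hW : W ≤ V) (hW' : W ≤ k ⁻¹ᵁ W') (b : Γ(Z, W')) (W₁ : Y.Opens) (h₁ : W₁ ≤ p ⁻¹ᵁ W')
    (h₁' : W₁ ≤ V') (h₂ : W ≤ h ⁻¹ᵁ W₁) :
    ((E.pull h hV).comp p k hk).app W' W hW hW' b =
      (h.appLE W₁ W h₂).hom (E.app W₁ h₁' ((p.appLE W' W₁ h₁).hom b)) := by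
  rw [(E.pull h hV).comp_app hk hW hW' h₁ h₂, E.pull_app h hV _ _ _ _ _ W₁ le_rfl h₁' h₂, res_self]

end VectorField

/-- The vector field attached to a derivation along the identity. -/
def ADer.toVectorField {X T : Scheme.{u}} {V : X.Opens} (δ : ADer (𝟙 X) V) (x : X ⟶ T)
    (hx : ∀ (U : T.Opens) (a : Γ(T, U)) (W : X.Opens) (hW : W ≤ V) (hU : W ≤ x ⁻¹ᵁ U),
      (δ.comp x x (Category.id_comp x)).app U W hW hU a = 0) : VectorField x V where
  app W hW a := δ.app W W hW (le_preimage_id le_rfl) a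
  map_add W hW a b := δ.app_add _ _ _ _ a b
  leibniz W hW a b := by
    rw [δ.app_mul, id_appLE _ le_rfl, id_appLE _ le_rfl, res_self, res_self]
  map_base W hW U hU a := by
    rw [← hx U a W hW hU, δ.comp_app (Category.id_comp x) hW hU hU (le_preimage_id le_rfl)]
  map_res W W' h hW a :=
    δ.app_map W W' W W' h h hW (le_preimage_id le_rfl) (le_preimage_id le_rfl) a

lemma ADer.toVectorField_along {X Y T : Scheme.{u}} {V : X.Opens} (δ : ADer (𝟙 X) V) (x : X ⟶ T)
    (hx) (p : X ⟶ Y) :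
    (δ.toVectorField x hx).along p = δ.comp p p (Category.id_comp p) := by
  ext W' W hW hW' b
  rw [δ.comp_app (Category.id_comp p) hW hW' hW' (le_preimage_id le_rfl)]
  rfl

/-! ### Related vector fields. -/

section Related

variable {X Y S B Z T T' : Scheme.{u}}

/-- This turns relatedness into one equation between derivations along `h`, to which the
extensionality theorems for affine opens and fibre products apply. -/
lemma related_iff {h : X ⟶ Y} {x : X ⟶ T} {y : Y ⟶ T'} {V : X.Opens} {V' : Y.Opens}
    {E : VectorField x V} {E' : VectorField y V'} (hV : V ≤ h ⁻¹ᵁ V') :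
    Related h E E' ↔ E.along h = E'.pull h hV := by
  constructor
  · intro H
    ext W' W hW hW' b
    have := H (W' ⊓ V') inf_le_right W hW (le_inf_preimage hW' (hW.trans hV)) (res Y inf_le_left b)
    rw [appLE_res] at this
    exact this
  · intro H W' hW' W hW hWW' b
    have := congrArg (fun d : ADer h V => d.app W' W hW hWW' b) H
    rw [E'.pull_app h hV _ _ _ _ _ W' le_rfl hW' hWW', res_self] at this
    exact this

lemma Related.bracket {h : X ⟶ Y} {x : X ⟶ T} {y : Y ⟶ T'} {V : X.Opens} {V' : Y.Opens}
    {E₁ E₂ : VectorField x V} {E₁' E₂' : VectorField y V'} (H₁ : Related h E₁ E₁')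
    (H₂ : Related h E₂ E₂') : Related h (E₁.bracket E₂) (E₁'.bracket E₂') := by
  intro W' hW' W hW hWW' b
  rw [VectorField.bracket_app, VectorField.bracket_app, H₁ W' hW', H₂ W' hW', H₁ W' hW',
    H₂ W' hW', map_sub]

lemma Related.iterate {h : X ⟶ Y} {x : X ⟶ T} {y : Y ⟶ T'} {V : X.Opens} {V' : Y.Opens}
    {E : VectorField x V} {E' : VectorField y V'} (H : Related h E E') (n : ℕ) (W' : Y.Opens)
    (hW' : W' ≤ V') (W : X.Opens) (hW : W ≤ V) (hWW' : W ≤ h ⁻¹ᵁ W') (b : Γ(Y, W')) :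
    (E.app W hW)^[n] ((h.appLE W' W hWW').hom b) =
      (h.appLE W' W hWW').hom ((E'.app W' hW')^[n] b) := by
  induction n generalizing b with
  | zero => rfl
  | succ n ih =>
    rw [Function.iterate_succ_apply, Function.iterate_succ_apply, H W' hW', ih]

lemma Related.restrict {h : X ⟶ Y} {x : X ⟶ T} {y : Y ⟶ T'} {V V₁ : X.Opens} {V' V₁' : Y.Opens}
    {E : VectorField x V} {E' : VectorField y V'} (H : Related h E E') (i : V₁ ≤ V)
    (i' : V₁' ≤ V') : Related h (E.restrict i) (E'.restrict i') :=
  fun W' hW' W hW hWW' b => H W' (hW'.trans i') W (hW.trans i) hWW' b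

lemma Related.neg {h : X ⟶ Y} {x : X ⟶ T} {y : Y ⟶ T'} {V : X.Opens} {V' : Y.Opens}
    {E : VectorField x V} {E' : VectorField y V'} (H : Related h E E') :
    Related h (-E) (-E') := fun W' hW' W hW hWW' b => by
  rw [VectorField.neg_app, VectorField.neg_app, H W' hW', map_neg]

/-- To be related by a morphism to a fibre product can be tested on the two factors. -/
theorem related_of_isPullback {p : X ⟶ Y} {q : X ⟶ S} {f : Y ⟶ B} {g : S ⟶ B}
    (H : IsPullback p q f g) {h : Z ⟶ X} {k : Z ⟶ Y} {l : Z ⟶ S} (hk : h ≫ p = k)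
    (hl : h ≫ q = l) {z : Z ⟶ T} {x : X ⟶ T'} {V : Z.Opens} {V' : X.Opens} (hV : V ≤ h ⁻¹ᵁ V')
    {E : VectorField z V} {E' : VectorField x V'}
    (hp : ∀ (W' : Y.Opens) (W₁ : X.Opens) (e : W₁ ≤ p ⁻¹ᵁ W') (hV₁ : W₁ ≤ V') (W : Z.Opens)
      (hW : W ≤ V) (hW' : W ≤ k ⁻¹ᵁ W') (hW₁ : W ≤ h ⁻¹ᵁ W₁) (b : Γ(Y, W')),
      E.app W hW ((k.appLE W' W hW').hom b) =
        (h.appLE W₁ W hW₁).hom (E'.app W₁ hV₁ ((p.appLE W' W₁ e).hom b)))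
    (hq : ∀ (W' : S.Opens) (W₁ : X.Opens) (e : W₁ ≤ q ⁻¹ᵁ W') (hV₁ : W₁ ≤ V') (W : Z.Opens)
      (hW : W ≤ V) (hW' : W ≤ l ⁻¹ᵁ W') (hW₁ : W ≤ h ⁻¹ᵁ W₁) (b : Γ(S, W')),
      E.app W hW ((l.appLE W' W hW').hom b) =
        (h.appLE W₁ W hW₁).hom (E'.app W₁ hV₁ ((q.appLE W' W₁ e).hom b))) :
    Related h E E' := by
  rw [related_iff hV]
  refine ADer.ext_of_isPullback H hk hl ?_ ?_
  · rw [VectorField.along_comp]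
    ext W' W hW hW' b
    have e : W ≤ h ⁻¹ᵁ (p ⁻¹ᵁ W' ⊓ V') := by
      subst hk; exact le_inf_preimage (le_preimage_of_comp rfl hW') (hW.trans hV)
    rw [E'.pull_comp_app h hV p k hk W' W hW hW' b (p ⁻¹ᵁ W' ⊓ V') inf_le_left inf_le_right e,
      VectorField.along_app]
    exact hp _ _ _ _ _ _ _ _ _
  · rw [VectorField.along_comp]
    ext W' W hW hW' b
    have e : W ≤ h ⁻¹ᵁ (q ⁻¹ᵁ W' ⊓ V') := by
      subst hl; exact le_inf_preimage (le_preimage_of_comp rfl hW') (hW.trans hV)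
    rw [E'.pull_comp_app h hV q l hl W' W hW hW' b (q ⁻¹ᵁ W' ⊓ V') inf_le_left inf_le_right e,
      VectorField.along_app]
    exact hq _ _ _ _ _ _ _ _ _

/-- The two fields may be linear over different bases, so the conclusion concerns values only. -/
theorem VectorField.app_eq_of_isPullback {p : X ⟶ Y} {q : X ⟶ S} {f : Y ⟶ B} {g : S ⟶ B}
    (H : IsPullback p q f g) {x : X ⟶ T} {x' : X ⟶ T'} {V : X.Opens}
    {E : VectorField x V} {E' : VectorField x' V} (hp : E.along p = E'.along p)
    (hq : E.along q = E'.along q) (W hW a) : E.app W hW a = E'.app W hW a := by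
  refine VectorField.app_eq_of_along
    (ADer.ext_of_isPullback H (Category.id_comp p) (Category.id_comp q) ?_ ?_) W hW a
  · rw [along_comp, along_comp, hp]
  · rw [along_comp, along_comp, hq]

/-- Change of base of a vector field. -/
def VectorField.rebase {x : X ⟶ T} {V : X.Opens} (E : VectorField x V) (w : T ⟶ T') (x' : X ⟶ T')
    (hx : x ≫ w = x') : VectorField x' V where
  app := E.app
  map_add := E.map_add
  leibniz := E.leibniz
  map_base W hW U hU a := by
    subst hx
    have e : (w ⁻¹ᵁ U) ≤ w ⁻¹ᵁ U := le_rfl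
    rw [← appLE_appLE x w e hU]
    exact E.map_base W hW _ _ _
  map_res := E.map_res

end Related

/-! ### Transport along open immersions and isomorphisms -/

section Open

variable {X Z T T' : Scheme.{u}}

/-- Sections of an open subscheme as sections of the ambient scheme. -/
noncomputable abbrev push (j : Z ⟶ X) [IsOpenImmersion j] (W : Z.Opens) :
    Γ(Z, W) →+* Γ(X, j ''ᵁ W) := (j.appIso W).inv.hom

lemma le_preimage_image (j : Z ⟶ X) [IsOpenImmersion j] (W : Z.Opens) : W ≤ j ⁻¹ᵁ (j ''ᵁ W) :=
  (j.preimage_image_eq W).ge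

lemma appLE_push (j : Z ⟶ X) [IsOpenImmersion j] (W : Z.Opens) (e : W ≤ j ⁻¹ᵁ (j ''ᵁ W))
    (a : Γ(Z, W)) : (j.appLE (j ''ᵁ W) W e).hom (push j W a) = a := by
  rw [← CommRingCat.comp_apply]
  have : (j.appIso W).inv ≫ j.appLE (j ''ᵁ W) W e = 𝟙 _ := by
    rw [← Scheme.Hom.appIso_hom', Iso.inv_hom_id]
  rw [this]
  rfl

lemma push_appLE (j : Z ⟶ X) [IsOpenImmersion j] {W : Z.Opens} {W' : X.Opens} (e : W ≤ j ⁻¹ᵁ W')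
    (e' : j ''ᵁ W ≤ W') (b : Γ(X, W')) : push j W ((j.appLE W' W e).hom b) = res X e' b := by
  have h₁ : (j.appLE W' W e).hom b =
      (j.appLE (j ''ᵁ W) W (le_preimage_image j W)).hom (res X e' b) := by
    rw [appLE_res]
  rw [h₁, ← CommRingCat.comp_apply, ← Scheme.Hom.appIso_hom', Iso.hom_inv_id]
  rfl

lemma res_push (j : Z ⟶ X) [IsOpenImmersion j] {W W' : Z.Opens} (i : W' ≤ W) (a : Γ(Z, W)) :
    push j W' (res Z i a) = res X (j.image_mono i) (push j W a) := by
  conv_lhs => rw [← appLE_push j W (le_preimage_image j W) a]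
  rw [res_appLE, push_appLE]

lemma image_le (j : Z ⟶ X) [IsOpenImmersion j] {W : Z.Opens} {V : X.Opens} (h : W ≤ j ⁻¹ᵁ V) :
    j ''ᵁ W ≤ V := (Set.image_subset_iff).mpr h

end Open

section PullOpen

variable {X Z T T' : Scheme.{u}}

/-- Since `e` is an isomorphism, a function from `T'` is also a function from `T`, and the ambient
field kills it. -/
lemma push_base_eq_zero {x : X ⟶ T} {V : X.Opens} (E : VectorField x V) {j : Z ⟶ X}
    [IsOpenImmersion j] {z : Z ⟶ T'} {e : T' ⟶ T} [IsIso e] (hz : z ≫ e = j ≫ x) (W : Z.Opens)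
    (hW : j ''ᵁ W ≤ V) (U : T'.Opens) (hU : W ≤ z ⁻¹ᵁ U) (a : Γ(T', U)) :
    E.app (j ''ᵁ W) hW (push j W ((z.appLE U W hU).hom a)) = 0 := by
  have hj : j ''ᵁ W ≤ x ⁻¹ᵁ (e ''ᵁ U) := by
    rintro _ ⟨w, hw, rfl⟩
    change (j ≫ x) w ∈ e ''ᵁ U
    rw [← hz]
    exact ⟨z w, hU hw, rfl⟩
  have h₁ : (z.appLE U W hU).hom a =
      (j.appLE (j ''ᵁ W) W (le_preimage_image j W)).hom ((x.appLE (e ''ᵁ U) (j ''ᵁ W) hj).hom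
        (push e U a)) := by
    conv_lhs => rw [← appLE_push e U (le_preimage_image e U) a]
    rw [appLE_appLE, appLE_appLE]
    exact appLE_congr_hom hz _ _
  rw [h₁, push_appLE j _ le_rfl, res_self, E.map_base]

/-- The restriction of a vector field along an open immersion. -/
noncomputable def VectorField.pullOpen {x : X ⟶ T} {V : X.Opens} (E : VectorField x V) (j : Z ⟶ X)
    [IsOpenImmersion j] {V' : Z.Opens} (hV : V' ≤ j ⁻¹ᵁ V) {z : Z ⟶ T'} {e : T' ⟶ T} [IsIso e]
    (hz : z ≫ e = j ≫ x) : VectorField z V' where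
  app W hW a := (j.appLE (j ''ᵁ W) W (le_preimage_image j W)).hom
    (E.app (j ''ᵁ W) (image_le j (hW.trans hV)) (push j W a))
  map_add W hW a b := by rw [_root_.map_add, E.map_add, _root_.map_add]
  leibniz W hW a b := by
    rw [_root_.map_mul, E.leibniz, _root_.map_add, _root_.map_mul, _root_.map_mul, appLE_push,
      appLE_push]
  map_base W hW U hU a := by rw [push_base_eq_zero E hz, map_zero]
  map_res W W' h hW a := by
    have := res_push j h a
    change (j.appLE (j ''ᵁ W') W' _).hom (E.app (j ''ᵁ W') _ (push j W' (res Z h a))) =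
      res Z h _
    rw [this, E.app_map (j.image_mono h) (image_le j (hW.trans hV)), appLE_res, res_appLE]

variable {x : X ⟶ T} {V : X.Opens}

lemma VectorField.pullOpen_app (E : VectorField x V) (j : Z ⟶ X)
    [IsOpenImmersion j] {V' : Z.Opens} (hV : V' ≤ j ⁻¹ᵁ V) {z : Z ⟶ T'} {e : T' ⟶ T} [IsIso e]
    (hz : z ≫ e = j ≫ x) (W) (hW : W ≤ V') (a) :
    (E.pullOpen j hV hz).app W hW a = (j.appLE (j ''ᵁ W) W (le_preimage_image j W)).hom
      (E.app (j ''ᵁ W) (image_le j (hW.trans hV)) (push j W a)) := rfl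

lemma VectorField.related_pullOpen (E : VectorField x V) (j : Z ⟶ X)
    [IsOpenImmersion j] {V' : Z.Opens} (hV : V' ≤ j ⁻¹ᵁ V) {z : Z ⟶ T'} {e : T' ⟶ T} [IsIso e]
    (hz : z ≫ e = j ≫ x) : Related j (E.pullOpen j hV hz) E := by
  intro W' hW' W hW hWW' b
  rw [pullOpen_app, push_appLE j _ (image_le j hWW'), E.app_map (image_le j hWW') hW', appLE_res]

/-- A vector field on an open subscheme is determined by being related to an ambient one. -/
lemma Related.app_eq {T₁ T₂ : Scheme.{u}} {E : VectorField x V} {j : Z ⟶ X} [IsOpenImmersion j]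
    {V₁ V₂ : Z.Opens}
    {z₁ : Z ⟶ T₁} {z₂ : Z ⟶ T₂} {E₁ : VectorField z₁ V₁} {E₂ : VectorField z₂ V₂}
    (hV : V₁ ≤ j ⁻¹ᵁ V) (H₁ : Related j E₁ E) (H₂ : Related j E₂ E) (W : Z.Opens) (hW : W ≤ V₁)
    (hW₂ : W ≤ V₂) (a : Γ(Z, W)) : E₁.app W hW a = E₂.app W hW₂ a := by
  rw [← appLE_push j W (le_preimage_image j W) a,
    H₁ _ (image_le j (hW.trans hV)), H₂ _ (image_le j (hW.trans hV))]

lemma Related.eq {E : VectorField x V} {j : Z ⟶ X} [IsOpenImmersion j] {V' : Z.Opens}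
    {z : Z ⟶ T'} {E₁ E₂ : VectorField z V'} (hV : V' ≤ j ⁻¹ᵁ V) (H₁ : Related j E₁ E)
    (H₂ : Related j E₂ E) : E₁ = E₂ := by
  ext W hW a
  exact H₁.app_eq hV H₂ W hW hW a

end PullOpen

lemma appLE_injective_of_isIso {X Y : Scheme.{u}} (h : X ⟶ Y) [IsIso h] (W' : Y.Opens)
    {W : X.Opens} (e : W ≤ h ⁻¹ᵁ W') (e' : h ⁻¹ᵁ W' ≤ W) :
    Function.Injective (h.appLE W' W e).hom := by
  obtain rfl : W = h ⁻¹ᵁ W' := le_antisymm e e'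
  rw [← Scheme.Hom.app_eq_appLE]
  exact (ConcreteCategory.bijective_of_isIso (h.app W')).1

/-- The inverse of an isomorphism preserves relatedness. -/
lemma Related.inv {X Y T T' : Scheme.{u}} {h : X ⟶ Y} [IsIso h] {x : X ⟶ T} {y : Y ⟶ T'}
    {V : X.Opens} {V' : Y.Opens} {E : VectorField x V} {E' : VectorField y V'}
    (H : Related h E E') : Related (inv h) E' E := by
  intro W hW W' hW' hWW' a
  have h₁ : h ⁻¹ᵁ W' ≤ W := by
    have := h.preimage_mono hWW'
    refine this.trans (le_of_eq ?_)
    rw [← Scheme.Hom.comp_preimage, IsIso.hom_inv_id]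
    rfl
  refine appLE_injective_of_isIso h W' le_rfl le_rfl ?_
  rw [← H W' hW' _ (h₁.trans hW) le_rfl, appLE_comp_eq (IsIso.hom_inv_id h) hWW' le_rfl
    (le_preimage_id h₁), appLE_comp_eq (IsIso.hom_inv_id h) hWW' le_rfl (le_preimage_id h₁),
    id_appLE _ h₁, id_appLE _ h₁, E.app_map h₁ hW]

/-! ### Transport of `λ`-connections -/

section Transport

variable {X S T X' S' T' : Scheme.{u}} {f : X ⟶ S} {s : S ⟶ T} {f' : X' ⟶ S'} {s' : S' ⟶ T'}

lemma inv_str {gS : S' ⟶ S} [IsIso gS] {e : T' ⟶ T} [IsIso e] (hs : s' ≫ e = gS ≫ s) :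
    s ≫ inv e = inv gS ≫ s' := by
  rw [IsIso.comp_inv_eq, Category.assoc, hs, IsIso.inv_hom_id_assoc]

lemma le_preimage_inv {Z W : Scheme.{u}} (g : Z ⟶ W) [IsIso g] (U : Z.Opens) :
    U ≤ g ⁻¹ᵁ ((inv g) ⁻¹ᵁ U) := by
  rw [← Scheme.Hom.comp_preimage, IsIso.hom_inv_id]
  exact le_rfl

lemma preimage_le_inv {gX : X' ⟶ X} {gS : S' ⟶ S} [IsIso gS] (hf : f' ≫ gS = gX ≫ f)
    (U : S'.Opens) : f' ⁻¹ᵁ U ≤ gX ⁻¹ᵁ (f ⁻¹ᵁ ((inv gS) ⁻¹ᵁ U)) := by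
  refine le_preimage_of_comp hf.symm ?_
  rw [Scheme.Hom.comp_preimage]
  exact f'.preimage_mono (le_preimage_inv gS U)

variable {lam : Γ(T, ⊤)} {lam' : Γ(T', ⊤)}

lemma comp_str {gX : X' ⟶ X} {gS : S' ⟶ S} {e : T' ⟶ T} (hf : f' ≫ gS = gX ≫ f)
    (hs : s' ≫ e = gS ≫ s) : (f' ≫ s') ≫ e = gX ≫ f ≫ s := by
  rw [Category.assoc, hs, reassoc_of% hf]

lemma appLE_lam {X Z T T' : Scheme.{u}} {h : Z ⟶ X} {x : X ⟶ T} {z : Z ⟶ T'} {e : T' ⟶ T}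
    (hc : z ≫ e = h ≫ x) {lam : Γ(T, ⊤)} {lam' : Γ(T', ⊤)} (hlam : (e.appTop).hom lam = lam')
    {V : X.Opens} {W : Z.Opens} (i : W ≤ h ⁻¹ᵁ V) :
    (h.appLE V W i).hom ((x.appLE ⊤ V le_top).hom lam) = (z.appLE ⊤ W le_top).hom lam' := by
  have e₁ : V ≤ x ⁻¹ᵁ ⊤ := fun _ _ => trivial
  have e₂ : (⊤ : T'.Opens) ≤ e ⁻¹ᵁ ⊤ := fun _ _ => trivial
  have e₃ : W ≤ z ⁻¹ᵁ ⊤ := fun _ _ => trivial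
  have h₁ := appLE_appLE h x e₁ i lam
  have h₂ := appLE_appLE z e e₂ e₃ lam
  have h₃ : (e.appLE ⊤ ⊤ e₂).hom lam = lam' := by
    rw [← hlam]
    exact congrArg (fun φ => CommRingCat.Hom.hom φ lam) e.app_eq_appLE.symm
  rw [h₃] at h₂
  exact h₁.trans ((appLE_congr_hom hc.symm _ _).trans h₂.symm)

/-- The transport of a `λ`-connection along isomorphisms. -/
noncomputable def LConnection.transport (N : LConnection f s lam) {gX : X' ⟶ X} {gS : S' ⟶ S}
    {e : T' ⟶ T} [IsIso gX] [IsIso gS] [IsIso e] (hf : f' ≫ gS = gX ≫ f)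
    (hs : s' ≫ e = gS ≫ s) (hlam : (e.appTop).hom lam = lam') : LConnection f' s' lam' where
  toFun U D := (N.toFun _ (D.pullOpen (inv gS) le_rfl (inv_str hs))).pullOpen gX
    (preimage_le_inv hf U) (comp_str hf hs)
  map_add U D E := by
    have : (D + E).pullOpen (inv gS) le_rfl (inv_str hs) =
        D.pullOpen (inv gS) le_rfl (inv_str hs) + E.pullOpen (inv gS) le_rfl (inv_str hs) := by
      ext W hW a
      simp only [VectorField.add_app, VectorField.pullOpen_app, _root_.map_add]
    rw [this, N.map_add]
    ext W hW a
    simp only [VectorField.add_app, VectorField.pullOpen_app, _root_.map_add]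
  map_smul U c D := by
    have : (c • D).pullOpen (inv gS) le_rfl (inv_str hs) =
        ((inv gS).app U).hom c • D.pullOpen (inv gS) le_rfl (inv_str hs) := by
      ext W hW a
      rw [VectorField.smul_app, VectorField.pullOpen_app, VectorField.pullOpen_app,
        VectorField.smul_app, _root_.map_mul]
      congr 1
      rw [appLE_res, Scheme.Hom.app_eq_appLE, res_appLE]
    rw [this, N.map_smul]
    ext W hW a
    rw [VectorField.smul_app, VectorField.pullOpen_app, VectorField.pullOpen_app,
      VectorField.smul_app, _root_.map_mul]
    congr 1
    rw [appLE_res, Scheme.Hom.app_eq_appLE, Scheme.Hom.app_eq_appLE, Scheme.Hom.app_eq_appLE,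
      res_appLE, appLE_appLE, appLE_appLE]
    refine appLE_congr_hom ?_ _ _
    rw [← hf, Category.assoc, IsIso.hom_inv_id, Category.comp_id]
  map_res U U' h D := by
    have : (D.restrict h).pullOpen (inv gS) le_rfl (inv_str hs) =
        (D.pullOpen (inv gS) le_rfl (inv_str hs)).restrict ((inv gS).preimage_mono h) := rfl
    rw [this, N.map_res]
    rfl
  proj U D W hW V hV hVW a := by
    have hf' : gX ≫ f ≫ inv gS = f' := by
      rw [← Category.assoc, ← hf, Category.assoc, IsIso.hom_inv_id, Category.comp_id]
    have i₁ : gX ''ᵁ V ≤ f ⁻¹ᵁ ((inv gS) ⁻¹ᵁ W) :=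
      image_le gX (le_preimage_of_comp (g := f) rfl (by
        rw [← Category.comp_id f', ← IsIso.hom_inv_id gS, reassoc_of% hf] at hVW
        exact hVW))
    have i₀ := le_preimage_image gX V
    have h₁ : (f'.appLE W V hVW).hom a = (gX.appLE (gX ''ᵁ V) V i₀).hom
        ((f.appLE _ _ i₁).hom (((inv gS).appLE W _ le_rfl).hom a)) := by
      rw [appLE_appLE, appLE_appLE]
      exact appLE_congr_hom hf'.symm _ _
    have h₂ : (f'.appLE W V hVW).hom (D.app W hW a) = (gX.appLE (gX ''ᵁ V) V i₀).hom
        ((f.appLE _ _ i₁).hom (((inv gS).appLE W _ le_rfl).hom (D.app W hW a))) := by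
      rw [appLE_appLE, appLE_appLE]
      exact appLE_congr_hom hf'.symm _ _
    rw [h₂, VectorField.pullOpen_app, h₁, push_appLE gX _ le_rfl, res_self,
      N.proj _ _ _ ((inv gS).preimage_mono hW), _root_.map_mul,
      (D.related_pullOpen (inv gS) le_rfl (inv_str hs)) W hW]
    congr 1
    exact appLE_lam (comp_str hf hs) hlam _

lemma LConnection.transport_isBaseChange (N : LConnection f s lam) {gX : X' ⟶ X} {gS : S' ⟶ S}
    {e : T' ⟶ T} [IsIso gX] [IsIso gS] [IsIso e] (hf : f' ≫ gS = gX ≫ f)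
    (hs : s' ≫ e = gS ≫ s) (hlam : (e.appTop).hom lam = lam') :
    IsBaseChange gX gS N (N.transport hf hs hlam) := by
  intro U U' hU D D' H
  have hU' : (inv gS) ⁻¹ᵁ U' ≤ U := by
    refine ((inv gS).preimage_mono hU).trans (le_of_eq ?_)
    rw [← Scheme.Hom.comp_preimage, IsIso.inv_hom_id]
    rfl
  -- Along an isomorphism a field is determined by its related partner, so the transported `D'` must
  -- be a restriction of `D`.
  have h₁ : D'.pullOpen (inv gS) le_rfl (inv_str hs) = D.restrict hU' := by
    refine Related.eq (j := inv gS) le_rfl (D'.related_pullOpen (inv gS) le_rfl (inv_str hs)) ?_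
    exact (H.restrict le_rfl hU').inv
  change Related gX ((N.toFun _ (D'.pullOpen (inv gS) le_rfl (inv_str hs))).pullOpen gX
    (preimage_le_inv hf U') (comp_str hf hs)) _
  rw [h₁, N.map_res]
  intro W' hW' W hW hWW' b
  have i : W ≤ gX ⁻¹ᵁ (W' ⊓ f ⁻¹ᵁ (inv gS) ⁻¹ᵁ U') :=
    le_inf_preimage hWW' (hW.trans (preimage_le_inv hf U'))
  have := (VectorField.related_pullOpen ((N.toFun U D).restrict (f.preimage_mono hU')) gX
    (preimage_le_inv hf U') (comp_str hf hs)) (W' ⊓ f ⁻¹ᵁ (inv gS) ⁻¹ᵁ U') inf_le_right W hW i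
    (res X inf_le_left b)
  rw [appLE_res] at this
  rw [this, VectorField.restrict_app, (N.toFun U D).app_map inf_le_left hW', appLE_res]

variable {gX : X' ⟶ X} {gS : S' ⟶ S} [IsIso gX] [IsIso gS] {N : LConnection f s lam}

/-- The base change along isomorphisms is unique. -/
lemma IsBaseChange.unique {e : T' ⟶ T} [IsIso e] (hf : f' ≫ gS = gX ≫ f)
    (hs : s' ≫ e = gS ≫ s) {N₁ N₂ : LConnection f' s' lam'} (H₁ : IsBaseChange gX gS N N₁)
    (H₂ : IsBaseChange gX gS N N₂) : N₁ = N₂ := by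
  ext1
  funext U D
  have h := (D.related_pullOpen (inv gS) le_rfl (inv_str hs)).inv
  rw [IsIso.inv_inv] at h
  exact Related.eq (preimage_le_inv hf U) (H₁ _ U (le_preimage_inv gS U) _ _ h)
    (H₂ _ U (le_preimage_inv gS U) _ _ h)

/-- Every section on `X'` is pulled back from `X`, and every field on `S'` is related to its
transport to `S`. Relatedness respects brackets, so the identity carries over. -/
lemma IsBaseChange.integrable {e : T' ⟶ T} [IsIso e] (hf : f' ≫ gS = gX ≫ f)
    (hs : s' ≫ e = gS ≫ s) (hlam : (e.appTop).hom lam = lam') {N' : LConnection f' s' lam'}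
    (H : IsBaseChange gX gS N N') (hN : N.Integrable) : N'.Integrable := by
  intro U D E W hW a
  have hrel : ∀ D : VectorField s' U,
      Related gS D (D.pullOpen (inv gS) le_rfl (inv_str hs)) := fun D => by
    have h := (D.related_pullOpen (inv gS) le_rfl (inv_str hs)).inv
    rwa [IsIso.inv_inv] at h
  have hU := le_preimage_inv gS U
  have hD := H _ U hU _ _ (hrel D)
  have hE := H _ U hU _ _ (hrel E)
  have hDE := H _ U hU _ _ ((hrel D).bracket (hrel E))
  have i₀ := le_preimage_image gX W
  have hW' : gX ''ᵁ W ≤ f ⁻¹ᵁ ((inv gS) ⁻¹ᵁ U) := image_le gX (hW.trans (preimage_le_inv hf U))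
  rw [← appLE_push gX W i₀ a, (hD.bracket hE) _ hW' _ hW, hN, hDE _ hW' _ hW, map_mul]
  congr 1
  exact appLE_lam (comp_str hf hs) hlam _

lemma IsBaseChange.powZero {e : T' ⟶ T} [IsIso e] (hf : f' ≫ gS = gX ≫ f)
    (hs : s' ≫ e = gS ≫ s) {N : HiggsField f s} {N' : HiggsField f' s'}
    (H : IsBaseChange gX gS N N') {p n : ℕ} (hN : N.PowZero p n) : N'.PowZero p n := by
  intro U D W hW a
  have h := (D.related_pullOpen (inv gS) le_rfl (inv_str hs)).inv
  rw [IsIso.inv_inv] at h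
  have hD := H _ U (le_preimage_inv gS U) _ _ h
  have hW' : gX ''ᵁ W ≤ f ⁻¹ᵁ ((inv gS) ⁻¹ᵁ U) := image_le gX (hW.trans (preimage_le_inv hf U))
  rw [← appLE_push gX W (le_preimage_image gX W) a, hD.iterate _ _ hW' _ hW, hN, map_zero]

end Transport

/-- The difference of two `λ`-connections. -/
def LConnection.sub {X S T : Scheme.{u}} {f : X ⟶ S} {s : S ⟶ T} {lam : Γ(T, ⊤)}
    (N N' : LConnection f s lam) : HiggsField f s where
  toFun U D := N.toFun U D + - N'.toFun U D
  map_add U D E := by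
    rw [N.map_add, N'.map_add]
    ext W hW x
    simp only [VectorField.add_app, VectorField.neg_app]
    ring
  map_smul U c D := by
    rw [N.map_smul, N'.map_smul]
    ext W hW x
    simp only [VectorField.add_app, VectorField.neg_app, VectorField.smul_app]
    ring
  map_res U U' h D := by rw [N.map_res, N'.map_res]; rfl
  proj U D W hW V hV hVW a := by
    rw [VectorField.add_app, VectorField.neg_app, N.proj U D W hW V hV hVW,
      N'.proj U D W hW V hV hVW, map_zero, zero_mul, add_neg_cancel]

lemma LConnection.sub_app {X S T : Scheme.{u}} {f : X ⟶ S} {s : S ⟶ T} {lam : Γ(T, ⊤)}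
    (N N' : LConnection f s lam) (U) (D : VectorField s U) (W hW a) :
    ((N.sub N').toFun U D).app W hW a =
      (N.toFun U D).app W hW a - (N'.toFun U D).app W hW a := by
  rw [sub_eq_add_neg]; rfl

/-- The zero Higgs field. -/
def HiggsField.zero {X S T : Scheme.{u}} (f : X ⟶ S) (s : S ⟶ T) : HiggsField f s where
  toFun U D := 0
  map_add U D E := by ext W hW x; simp [VectorField.add_app, VectorField.zero_app]
  map_smul U c D := by ext W hW x; simp [VectorField.smul_app, VectorField.zero_app]
  map_res U U' h D := rfl
  proj U D W hW V hV hVW a := by rw [VectorField.zero_app, map_zero, zero_mul]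

/-! ### Witt vectors of length two -/

section Witt

lemma W2.p_sq {k : Type u} [Field k] {p : ℕ} [Fact p.Prime] : (p : W2 k p) * p = 0 := by
  rw [← map_natCast (Ideal.Quotient.mk _), ← map_mul, Ideal.Quotient.eq_zero_iff_mem, ← pow_two]
  exact Ideal.mem_span_singleton_self _

variable {k : Type u} [Field k] {p : ℕ} [Fact p.Prime] [CharP k p]

lemma W2.toField_surjective : Function.Surjective (W2.toField k p) := fun a => by
  obtain ⟨w, rfl⟩ := WittVector.constantCoeff_surjective p a
  exact ⟨Ideal.Quotient.mk _ w, rfl⟩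

variable [PerfectField k]

/-- For perfect `k` the kernel of the constant coefficient on Witt vectors is generated by `p`.
Together with the statement that `p`-torsion reduces to zero, this is what makes division by `p`
possible on the lifting. -/
lemma W2.exists_of_toField_eq_zero {w : W2 k p} (h : W2.toField k p w = 0) :
    ∃ w', w = p * w' := by
  have : PerfectRing k p := PerfectField.toPerfectRing p
  obtain ⟨w, rfl⟩ := Ideal.Quotient.mk_surjective w
  have : w ∈ RingHom.ker (WittVector.constantCoeff (p := p) (R := k)) := h
  rw [WittVector.ker_constantCoeff] at this
  obtain ⟨v, rfl⟩ := Ideal.mem_span_singleton.mp this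
  exact ⟨Ideal.Quotient.mk _ v, by rw [map_mul, map_natCast]⟩

/-- If `p w` is divisible by `p ^ 2`, one factor `p` cancels in the domain of Witt vectors. -/
lemma W2.toField_eq_zero_of_mul {w : W2 k p} (h : p * w = 0) : W2.toField k p w = 0 := by
  have : PerfectRing k p := PerfectField.toPerfectRing p
  obtain ⟨w, rfl⟩ := Ideal.Quotient.mk_surjective w
  rw [← map_natCast (Ideal.Quotient.mk _), ← map_mul, Ideal.Quotient.eq_zero_iff_mem] at h
  obtain ⟨v, hv⟩ := Ideal.mem_span_singleton.mp h
  rw [pow_two, mul_assoc] at hv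
  have hp : (p : WittVector p k) ≠ 0 := WittVector.p_nonzero p k
  have := mul_left_cancel₀ hp hv
  change WittVector.constantCoeff w = 0
  rw [this, map_mul, map_natCast, CharP.cast_eq_zero k p, zero_mul]

lemma W2.frob_bijective : Function.Bijective (W2.frob k p) := by
  have : PerfectRing k p := PerfectField.toPerfectRing p
  constructor
  · rw [injective_iff_map_eq_zero]
    intro w hw
    obtain ⟨w, rfl⟩ := Ideal.Quotient.mk_surjective w
    change Ideal.Quotient.mk _ (WittVector.frobenius w) = 0 at hw
    rw [Ideal.Quotient.eq_zero_iff_mem] at hw ⊢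
    obtain ⟨v, hv⟩ := Ideal.mem_span_singleton.mp hw
    obtain ⟨v, rfl⟩ := (WittVector.frobenius_bijective p k).2 v
    have : WittVector.frobenius w = WittVector.frobenius ((p : WittVector p k) ^ 2 * v) := by
      rw [hv, map_mul, map_pow, map_natCast]
    rw [(WittVector.frobenius_bijective p k).1 this]
    exact Ideal.mem_span_singleton.mpr (dvd_mul_right _ _)
  · intro w
    obtain ⟨w, rfl⟩ := Ideal.Quotient.mk_surjective w
    obtain ⟨v, rfl⟩ := (WittVector.frobenius_bijective p k).2 w
    exact ⟨Ideal.Quotient.mk _ v, rfl⟩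

variable (k p)

lemma isIso_specW2Frob : IsIso (specW2Frob k p) := by
  have : IsIso (CommRingCat.ofHom (W2.frob k p)) :=
    (ConcreteCategory.isIso_iff_bijective _).mpr W2.frob_bijective
  unfold specW2Frob
  infer_instance

lemma isIso_specFrob : IsIso (specFrob k p) := by
  have : PerfectRing k p := PerfectField.toPerfectRing p
  have : IsIso (CommRingCat.ofHom (frobenius k p)) :=
    (ConcreteCategory.isIso_iff_bijective _).mpr (bijective_frobenius k p)
  unfold specFrob
  infer_instance

/-- Functions on opens of the spectrum of a perfect field are `p`-th powers. -/
lemma exists_pow_eq_section (U : (Spec (.of k)).Opens) (a : Γ(Spec (.of k), U)) :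
    ∃ b, b ^ p = a := by
  have : PerfectRing k p := PerfectField.toPerfectRing p
  by_cases hU : U = ⊥
  · subst hU
    exact ⟨a, Subsingleton.elim _ _⟩
  · obtain ⟨x, hx⟩ : ∃ x, x ∈ U := by
      by_contra! h
      exact hU (le_antisymm (fun x hx => (h x hx).elim) bot_le)
    have : U = ⊤ := by
      refine le_antisymm le_top fun y _ => ?_
      have : y = x := Subsingleton.elim (α := PrimeSpectrum k) _ _
      exact this ▸ hx
    subst this
    obtain ⟨c, rfl⟩ := ((ConcreteCategory.bijective_of_isIso
      (Scheme.ΓSpecIso (.of k)).inv)).2 a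
    obtain ⟨d, rfl⟩ := (bijective_frobenius k p).2 c
    exact ⟨(Scheme.ΓSpecIso (.of k)).inv d, (map_pow (Scheme.ΓSpecIso (.of k)).inv.hom d p).symm⟩

end Witt

/-! ### The divided Frobenius -/

section Algebra

/-- The `p`-th power of a sum, with the derivative of the mixed terms. -/
lemma exists_add_pow_eq (p : ℕ) (hp : p.Prime) : ∃ T : ∀ (R : Type u) [CommRing R], R → R → R,
    (∀ (R R' : Type u) [CommRing R] [CommRing R'] (φ : R →+* R') (x y : R),
      φ (T R x y) = T R' (φ x) (φ y)) ∧
    (∀ (R : Type u) [CommRing R] (x y : R), (x + y) ^ p = x ^ p + y ^ p + p * T R x y) ∧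
    ∀ (R : Type u) [CommRing R] (D : Derivation ℤ R R) (x y : R),
      D (T R x y) = (x + y) ^ (p - 1) * (D x + D y) - x ^ (p - 1) * D x - y ^ (p - 1) * D y := by
  obtain ⟨n, rfl⟩ : ∃ n, p = n + 1 := ⟨p - 1, by have := hp.pos; omega⟩
  -- The number `c j` is the binomial coefficient of `p = n + 1` over `j + 1`, divided by `p`;
  -- outside the range of mixed terms its value does not matter.
  have hc : ∀ j, ∃ c : ℕ, j < n → (n + 1).choose (j + 1) = (n + 1) * c := fun j => by
    by_cases hj : j < n
    · obtain ⟨c, hc⟩ := hp.dvd_choose_self (k := j + 1) (by omega) (by omega)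
      exact ⟨c, fun _ => hc⟩
    · exact ⟨0, fun h => absurd h hj⟩
  choose c hc using hc
  -- The derivative of `T` cannot be obtained by dividing by `p` in `R`, so it is matched
  -- coefficient by coefficient. These two identities identify the coefficients of `D x` and `D y`
  -- with binomial coefficients of `n`.
  have h₁ : ∀ j < n, (j + 1) * c j = n.choose j := fun j hj => by
    have := Nat.add_one_mul_choose_eq n j
    rw [hc j hj, mul_assoc] at this
    rw [mul_comm]
    exact (Nat.eq_of_mul_eq_mul_left (Nat.succ_pos n) this).symm
  have h₂ : ∀ j < n, (n - j) * c j = n.choose (j + 1) := fun j hj => by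
    have := Nat.choose_succ_right_eq n j
    rw [← h₁ j hj] at this
    refine Nat.eq_of_mul_eq_mul_right (Nat.succ_pos j) ?_
    rw [Nat.succ_eq_add_one, this]
    ring
  refine ⟨fun R _ x y => ∑ j ∈ Finset.range n, (c j : R) * (x ^ (j + 1) * y ^ (n - j)),
    fun R R' _ _ φ x y => by simp, fun R _ x y => ?_, fun R _ D x y => ?_⟩
  · rw [add_pow, Finset.sum_range_succ, Finset.sum_range_succ', Finset.mul_sum]
    simp only [Nat.choose_self, Nat.choose_zero_right, Nat.sub_self, pow_zero, Nat.sub_zero]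
    have : ∀ j ∈ Finset.range n, x ^ (j + 1) * y ^ (n + 1 - (j + 1)) *
        ((n + 1).choose (j + 1) : R) = ((n + 1 : ℕ) : R) * (c j * (x ^ (j + 1) * y ^ (n - j))) := by
      intro j hj
      rw [hc j (Finset.mem_range.mp hj), Nat.add_sub_add_right]
      push_cast
      ring
    rw [Finset.sum_congr rfl this]
    push_cast
    ring
  · have e₁ : (x + y) ^ n = ∑ j ∈ Finset.range n, ((n.choose j : ℕ) : R) * (x ^ j * y ^ (n - j)) +
        x ^ n := by
      rw [add_pow, Finset.sum_range_succ]
      simp only [Nat.choose_self, Nat.sub_self, pow_zero]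
      congr 1
      · exact Finset.sum_congr rfl fun j _ => by ring
      · simp
    have e₂ : (x + y) ^ n = ∑ j ∈ Finset.range n,
        ((n.choose (j + 1) : ℕ) : R) * (x ^ (j + 1) * y ^ (n - j - 1)) + y ^ n := by
      rw [add_pow, Finset.sum_range_succ']
      simp only [Nat.choose_zero_right, Nat.sub_zero, pow_zero]
      congr 1
      · exact Finset.sum_congr rfl fun j _ => by rw [Nat.sub_sub]; ring
      · simp
    have e₃ : D (∑ j ∈ Finset.range n, (c j : R) * (x ^ (j + 1) * y ^ (n - j))) =
        (∑ j ∈ Finset.range n, ((n.choose j : ℕ) : R) * (x ^ j * y ^ (n - j))) * D x +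
        (∑ j ∈ Finset.range n, ((n.choose (j + 1) : ℕ) : R) * (x ^ (j + 1) * y ^ (n - j - 1))) *
          D y := by
      rw [map_sum, Finset.sum_mul, Finset.sum_mul, ← Finset.sum_add_distrib]
      refine Finset.sum_congr rfl fun j hj => ?_
      have hj := Finset.mem_range.mp hj
      rw [D.leibniz, D.leibniz, D.leibniz_pow, D.leibniz_pow, D.map_natCast, ← h₁ j hj, ← h₂ j hj]
      simp only [smul_eq_mul, nsmul_eq_mul, Nat.add_sub_cancel, mul_zero, add_zero]
      push_cast
      ring
    rw [e₃, Nat.add_sub_cancel, mul_add]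
    nth_rewrite 1 [e₁]
    rw [e₂]
    ring

/-- The derivation `b ↦ b ^ (p - 1) D b + D g`, where `φ b̃ = b̃ ^ p + p g`. -/
theorem exists_dividedFrobenius {p : ℕ} (hp : p.Prime) {A₂ A : Type u} [CommRing A₂] [CommRing A]
    (π : A₂ →+* A) (hπ : Function.Surjective π) (hker : ∀ a, π a = 0 → ∃ e, a = p * e)
    (htor : ∀ a : A₂, p * a = 0 → π a = 0) (hpA : (p : A) = 0) (φ : A₂ →+* A₂)
    (hφ : ∀ a, ∃ g, φ a = a ^ p + p * g)
    (D : Derivation ℤ A A) : ∃ δ : A → A,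
      (∀ a b, δ (a + b) = δ a + δ b) ∧ (∀ a b, δ (a * b) = a ^ p * δ b + b ^ p * δ a) ∧
      ∀ b g, φ b = b ^ p + p * g → δ (π b) = π b ^ (p - 1) * D (π b) + D (π g) := by
  obtain ⟨n, rfl⟩ : ∃ n, p = n + 1 := ⟨p - 1, by have := hp.pos; omega⟩
  set p := n + 1
  have hDp : ∀ x : A, D (x ^ p) = 0 := fun x => by
    rw [D.leibniz_pow, nsmul_eq_mul, hpA, zero_mul]
  -- Changing the lift `b` by `p e` changes `g` modulo `p` by `e ^ p`, and a derivation in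
  -- characteristic `p` kills `p`-th powers.
  have huniq : ∀ b b' g g', π b = π b' → φ b = b ^ p + p * g → φ b' = b' ^ p + p * g' →
      D (π g) = D (π g') := by
    intro b b' g g' hb hg hg'
    obtain ⟨e, he⟩ := hker (b - b') (by rw [map_sub, hb, sub_self])
    obtain ⟨h, hh⟩ := hφ e
    -- Congruence modulo `p` improves to congruence of `p`-th powers modulo `p ^ 2`; the extra
    -- factor `p` removes this term after division by `p` and reduction.
    obtain ⟨t, ht⟩ := dvd_sub_pow_of_dvd_sub (R := A₂) (p := p) (a := b) (b := b') ⟨e, he⟩ 1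
    have h₁ : φ b - φ b' = p * φ e := by rw [← map_sub, he, map_mul, map_natCast]
    rw [hg, hg', hh] at h₁
    simp only [pow_one] at ht
    have h₂ : p * (g - g' - e ^ p - p * h + p * t) = 0 := by linear_combination h₁ - ht
    have h₃ := htor _ h₂
    simp only [map_sub, map_add, map_mul, map_natCast, map_pow, hpA, zero_mul, sub_zero,
      add_zero] at h₃
    rw [sub_sub, sub_eq_zero] at h₃
    rw [h₃, map_add, hDp, add_zero]
  choose l hl using hπ
  choose γ hγ using hφ
  have key : ∀ b g, φ b = b ^ p + p * g →
      π b ^ n * D (π b) + D (π (γ (l (π b)))) = π b ^ n * D (π b) + D (π g) := fun b g hg => by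
    rw [huniq _ _ _ _ (hl (π b)) (hγ _) hg]
  refine ⟨fun a => a ^ n * D a + D (π (γ (l a))), fun a b => ?_, fun a b => ?_, key⟩
  -- The mixed terms of the `p`-th power enter the `g` of a sum as `-T`. The derivative of `T` is
  -- exactly the failure of `a ↦ a ^ (p - 1) * D a` to be additive.
  · obtain ⟨T, hT₁, hT₂, hT₃⟩ := exists_add_pow_eq p hp
    have h := key (l a + l b) (γ (l a) + γ (l b) - T A₂ (l a) (l b)) (by
      rw [map_add, hγ, hγ, hT₂]; ring)
    have h' := hT₃ A D a b
    rw [map_add, hl, hl] at h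
    beta_reduce
    rw [h, map_sub, map_add, hT₁, hl, hl, map_sub, h', map_add, map_add]
    simp only [p, Nat.add_sub_cancel]
    ring
  · have h := key (l a * l b) (γ (l a) * l b ^ p + γ (l b) * l a ^ p + p * (γ (l a) * γ (l b))) (by
      rw [map_mul, hγ, hγ]; ring)
    rw [map_mul, hl, hl] at h
    beta_reduce
    rw [h]
    simp only [map_add, map_mul, map_pow, map_natCast, hl, hpA, zero_mul, add_zero, D.leibniz, hDp,
      smul_eq_mul, mul_zero, zero_add]
    ring

end Algebra

/-! ### Reduction modulo `p`: kernels and torsion. -/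

section Reduction

variable {k : Type u} [Field k] {p : ℕ} [Fact p.Prime] [CharP k p]

lemma specRes_app (e : (⊤ : (Spec (.of k)).Opens) ≤ specRes k p ⁻¹ᵁ ⊤) (w : W2 k p) :
    ((specRes k p).appLE ⊤ ⊤ e).hom ((Scheme.ΓSpecIso (.of (W2 k p))).inv w) =
      (Scheme.ΓSpecIso (.of k)).inv (W2.toField k p w) := by
  have h := Scheme.ΓSpecIso_inv_naturality (CommRingCat.ofHom (W2.toField k p))
  have h₂ := congrArg (fun φ => CommRingCat.Hom.hom φ w) h
  refine Eq.trans ?_ h₂.symm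
  exact congrArg (fun φ => CommRingCat.Hom.hom φ ((Scheme.ΓSpecIso (.of (W2 k p))).inv w))
    (Scheme.Hom.app_eq_appLE (f := specRes k p)).symm

lemma specRes_surjective (e : (⊤ : (Spec (.of k)).Opens) ≤ specRes k p ⁻¹ᵁ ⊤) :
    Function.Surjective ((specRes k p).appLE ⊤ ⊤ e).hom := fun a => by
  obtain ⟨a, rfl⟩ := (ConcreteCategory.bijective_of_isIso (Scheme.ΓSpecIso (.of k)).inv).2 a
  obtain ⟨w, rfl⟩ := W2.toField_surjective (k := k) (p := p) a
  exact ⟨_, specRes_app e w⟩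

variable [PerfectField k]

lemma exists_of_specRes_eq_zero (e : (⊤ : (Spec (.of k)).Opens) ≤ specRes k p ⁻¹ᵁ ⊤)
    {w : Γ(Spec (.of (W2 k p)), ⊤)} (h : ((specRes k p).appLE ⊤ ⊤ e).hom w = 0) :
    ∃ w', w = p * w' := by
  obtain ⟨w, rfl⟩ := (ConcreteCategory.bijective_of_isIso (Scheme.ΓSpecIso (.of (W2 k p))).inv).2 w
  have h' := (specRes_app e w).symm.trans h
  have h'' : W2.toField k p w = 0 :=
    (ConcreteCategory.bijective_of_isIso (Scheme.ΓSpecIso (.of k)).inv).1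
      (h'.trans (map_zero (Scheme.ΓSpecIso (.of k)).inv.hom).symm)
  obtain ⟨w', rfl⟩ := W2.exists_of_toField_eq_zero h''
  refine ⟨(Scheme.ΓSpecIso (.of (W2 k p))).inv.hom w', ?_⟩
  change (Scheme.ΓSpecIso (.of (W2 k p))).inv.hom (p * w') = _
  rw [map_mul, map_natCast]

lemma specRes_eq_zero_of_mul (e : (⊤ : (Spec (.of k)).Opens) ≤ specRes k p ⁻¹ᵁ ⊤)
    {w : Γ(Spec (.of (W2 k p)), ⊤)} (h : p * w = 0) :
    ((specRes k p).appLE ⊤ ⊤ e).hom w = 0 := by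
  obtain ⟨w, rfl⟩ := (ConcreteCategory.bijective_of_isIso (Scheme.ΓSpecIso (.of (W2 k p))).inv).2 w
  have h' : (Scheme.ΓSpecIso (.of (W2 k p))).inv.hom (p * w) =
      (Scheme.ΓSpecIso (.of (W2 k p))).inv.hom 0 := by
    rw [map_mul, map_natCast, map_zero]; exact h
  have := (ConcreteCategory.bijective_of_isIso (Scheme.ΓSpecIso (.of (W2 k p))).inv).1 h'
  refine (specRes_app e w).trans ?_
  rw [W2.toField_eq_zero_of_mul this]
  exact map_zero (Scheme.ΓSpecIso (.of k)).inv.hom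

-- The kernel of the reduction is generated by `p`, whose square is zero, so every prime of `W₂(k)`
-- contains it.
variable (k p) in
lemma surjective_specRes : Surjective (specRes k p) := by
  constructor
  have h := range_comap_of_surjective k (W2.toField k p) W2.toField_surjective
  have h2 : (Set.range (PrimeSpectrum.comap (W2.toField k p))) = Set.univ := by
    rw [h]
    refine Set.eq_univ_of_forall fun x => ?_
    rw [PrimeSpectrum.mem_zeroLocus]
    intro w hw
    obtain ⟨w', rfl⟩ := W2.exists_of_toField_eq_zero hw
    refine x.2.mem_of_pow_mem 2 ?_
    have : ((p : W2 k p) * w') ^ 2 = 0 := by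
      linear_combination w' * w' * W2.p_sq (k := k) (p := p)
    rw [this]
    exact x.asIdeal.zero_mem
  exact Set.range_eq_univ.mp h2

end Reduction

lemma frob_appLE {p : ℕ} [Fact p.Prime] {k : Type u} [Field k] [CharP k p] {S : Scheme.{u}}
    (s : S ⟶ Spec (.of k)) {W' W : S.Opens} (e : W ≤ frob p s ⁻¹ᵁ W') (e' : W ≤ W')
    (b : Γ(S, W')) : ((frob p s).appLE W' W e).hom b = res S e' b ^ p := by
  have h : ((frob p s).app W').hom b = b ^ p := rfl
  rw [Scheme.Hom.appLE, CommRingCat.hom_comp, RingHom.comp_apply, h]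
  exact map_pow (res S e') b p

lemma frob_preimage {p : ℕ} [Fact p.Prime] {k : Type u} [Field k] [CharP k p] {S : Scheme.{u}}
    (s : S ⟶ Spec (.of k)) (W : S.Opens) : frob p s ⁻¹ᵁ W = W := rfl

/-- The coordinate ring of the fibre over `T` is a pushout, and functions on `T₂` vanishing on `T`
are multiples of `p`. The quotient map of `Γ(S₂, U)` modulo `p` therefore factors through the fibre,
so whatever restricts to zero there is divisible by `p`. -/
lemma exists_eq_mul_of_isPullback {S S₂ T T₂ : Scheme.{u}} {i : S ⟶ S₂} {s : S ⟶ T} {s₂ : S₂ ⟶ T₂}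
    {j : T ⟶ T₂} (H : IsPullback i s s₂ j) (hT : IsAffineOpen (⊤ : T.Opens))
    (hT₂ : IsAffineOpen (⊤ : T₂.Opens)) (p : ℕ) (e₂ : (⊤ : T.Opens) ≤ j ⁻¹ᵁ ⊤)
    (hsurj : Function.Surjective (j.appLE ⊤ ⊤ e₂).hom)
    (hker : ∀ w : Γ(T₂, ⊤), (j.appLE ⊤ ⊤ e₂).hom w = 0 → ∃ w', w = p * w')
    {U : S₂.Opens} (hU : IsAffineOpen U) {a : Γ(S₂, U)}
    (ha : (i.app U).hom a = 0) : ∃ b, a = p * b := by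
  have e₁ : U ≤ s₂ ⁻¹ᵁ ⊤ := fun _ _ => trivial
  have po := (isIso_pushoutSection_iff H e₂ e₁ rfl).mp
    (isIso_pushoutSection_of_isAffineOpen H e₂ e₁ rfl hT₂ hT hU)
  let I : Ideal Γ(S₂, U) := Ideal.span {(p : Γ(S₂, U))}
  let r := RingHom.liftOfSurjective (j.appLE ⊤ ⊤ e₂).hom hsurj
    ⟨(Ideal.Quotient.mk I).comp (s₂.appLE ⊤ U e₁).hom, fun w hw => by
      obtain ⟨w', rfl⟩ := hker w hw
      rw [RingHom.mem_ker, RingHom.comp_apply, map_mul, map_natCast, Ideal.Quotient.eq_zero_iff_mem]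
      exact Ideal.mul_mem_right _ _ (Ideal.mem_span_singleton_self _)⟩
  have hr : r.comp (j.appLE ⊤ ⊤ e₂).hom = (Ideal.Quotient.mk I).comp (s₂.appLE ⊤ U e₁).hom :=
    RingHom.liftOfRightInverse_comp _ _ _ _
  let d := po.desc (CommRingCat.ofHom (Ideal.Quotient.mk I)) (CommRingCat.ofHom r)
    (CommRingCat.hom_ext hr.symm)
  have hd := congrArg (fun φ => CommRingCat.Hom.hom φ a) (po.inl_desc
    (CommRingCat.ofHom (Ideal.Quotient.mk I)) (CommRingCat.ofHom r) (CommRingCat.hom_ext hr.symm))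
  have h0 : (i.appLE U (i ⁻¹ᵁ U ⊓ s ⁻¹ᵁ ⊤) inf_le_left).hom a = 0 := by
    have := res_appLE i (U := U) le_rfl
      (inf_le_left : i ⁻¹ᵁ U ⊓ s ⁻¹ᵁ ⊤ ≤ i ⁻¹ᵁ U) a
    rw [← this, ← Scheme.Hom.app_eq_appLE, ha, map_zero]
  have h1 : Ideal.Quotient.mk I a = 0 := by
    refine hd.symm.trans ?_
    change d.hom ((i.appLE U (i ⁻¹ᵁ U ⊓ s ⁻¹ᵁ ⊤) _).hom a) = 0
    rw [h0, map_zero]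
  rw [Ideal.Quotient.eq_zero_iff_mem] at h1
  exact Ideal.mem_span_singleton.mp h1

/-- This is the equational criterion of flatness for a single relation: the annihilator of `r` in
`M` is spanned by the annihilator of `r` in `R`. -/
lemma exists_eq_sum_of_flat {R M : Type u} [CommRing R] [AddCommGroup M] [Module R M]
    [Module.Flat R M] (r : R)
    {a : M} (ha : r • a = 0) :
    ∃ (m : ℕ) (c : Fin m → R) (y : Fin m → M), a = ∑ l, c l • y l ∧
      ∀ l, r * c l = 0 := by
  have hsum : ∑ i : Fin 1, (fun _ : Fin 1 => r) i • (fun _ : Fin 1 => a) i = 0 := by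
    rw [Fin.sum_univ_one]
    exact ha
  obtain ⟨m, c, y, h1, h2⟩ := Module.Flat.isTrivialRelation_of_sum_smul_eq_zero hsum
  refine ⟨m, c 0, y, h1 0, fun l => ?_⟩
  have := h2 l
  rwa [Fin.sum_univ_one] at this

/-- It is applied to `r = p` over `W₂(k)`, and to `r = t` over `k[t]` with `g` the identity, where
it says that `t` is a nonzerodivisor. -/
lemma map_eq_zero_of_flat {R M A : Type u} [CommRing R] [CommRing M] [CommRing A] (f : R →+* M)
    (hf : f.Flat) (g : M →+* A) (r : R) (hr : ∀ c : R, r * c = 0 → g (f c) = 0) {a : M}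
    (ha : f r * a = 0) : g a = 0 := by
  algebraize [f]
  obtain ⟨m, c, y, h1, h2⟩ := exists_eq_sum_of_flat r (a := a) (by rw [Algebra.smul_def]; exact ha)
  rw [h1, map_sum]
  refine Finset.sum_eq_zero fun l _ => ?_
  rw [Algebra.smul_def, map_mul]
  exact mul_eq_zero_of_left (hr _ (h2 l)) _

lemma app_eq_zero_of_isPullback {S S₂ T T₂ : Scheme.{u}} {i : S ⟶ S₂} {s : S ⟶ T} {s₂ : S₂ ⟶ T₂}
    {j : T ⟶ T₂} (H : i ≫ s₂ = s ≫ j) [Flat s₂] (hT₂ : IsAffineOpen (⊤ : T₂.Opens)) (p : ℕ)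
    (e₂ : (⊤ : T.Opens) ≤ j ⁻¹ᵁ ⊤)
    (hj : ∀ w : Γ(T₂, ⊤), p * w = 0 → (j.appLE ⊤ ⊤ e₂).hom w = 0)
    {U : S₂.Opens} (hU : IsAffineOpen U) {a : Γ(S₂, U)} (ha : p * a = 0) :
    (i.app U).hom a = 0 := by
  have e₁ : U ≤ s₂ ⁻¹ᵁ ⊤ := fun _ _ => trivial
  refine map_eq_zero_of_flat (s₂.appLE ⊤ U e₁).hom (Scheme.Hom.flat_appLE s₂ hT₂ hU e₁)
    (i.app U).hom p (fun c hc => ?_) (by rw [map_natCast]; exact ha)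
  have e₃ : i ⁻¹ᵁ U ≤ s ⁻¹ᵁ ⊤ := fun _ _ => trivial
  rw [Scheme.Hom.app_eq_appLE, appLE_appLE, appLE_congr_hom H,
    ← appLE_appLE s j e₂ e₃, hj _ hc, map_zero]

/-! ### Topology and local structure of the Frobenius lifting. -/

namespace FrobeniusLifting

variable {k : Type u} [Field k] {p : ℕ} [Fact p.Prime] [CharP k p]
  {S : Scheme.{u}} {s : S ⟶ Spec (.of k)} (L : FrobeniusLifting p s)

lemma isClosedImmersion_incl : IsClosedImmersion L.incl :=
  MorphismProperty.of_isPullback L.isPullback.flip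
    (IsClosedImmersion.spec_of_surjective _ W2.toField_surjective)

lemma exists_preimage_incl (W : S.Opens) : ∃ U : L.lift.Opens, L.incl ⁻¹ᵁ U = W := by
  have := L.isClosedImmersion_incl
  obtain ⟨t, ht, h⟩ := (Scheme.Hom.isClosedEmbedding L.incl).isInducing.isOpen_iff.mp W.2
  exact ⟨⟨t, ht⟩, by ext1; exact h⟩

lemma isAffineOpen_preimage {U : L.lift.Opens} (hU : IsAffineOpen U) :
    IsAffineOpen (L.incl ⁻¹ᵁ U) := by
  have := L.isClosedImmersion_incl
  exact hU.preimage L.incl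

lemma surjective_app {U : L.lift.Opens} (hU : IsAffineOpen U) :
    Function.Surjective (L.incl.app U).hom := by
  have := L.isClosedImmersion_incl
  exact L.incl.app_surjective U hU

/-- Small affine opens of the lifting. -/
lemma exists_affine {x : S} (W : S.Opens) (hx : x ∈ W) : ∃ U : L.lift.Opens, IsAffineOpen U ∧
    L.incl ⁻¹ᵁ U ≤ W ∧ x ∈ L.incl ⁻¹ᵁ U := by
  obtain ⟨V, rfl⟩ := L.exists_preimage_incl W
  obtain ⟨U, hU, hxU, hUV⟩ := exists_isAffineOpen_mem_and_subset (X := L.lift) (x := L.incl x)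
    (U := V) hx
  exact ⟨U, hU, fun y hy => hUV hy, hxU⟩

variable [PerfectField k]

lemma surjective_incl : Surjective L.incl :=
  MorphismProperty.of_isPullback L.isPullback.flip (surjective_specRes k p)

/-- Every point of the lifting lies on `S`, and there the lifting of Frobenius is Frobenius, which
fixes all points. -/
lemma preimage_F (U : L.lift.Opens) : L.F ⁻¹ᵁ U = U := by
  ext y
  obtain ⟨x, rfl⟩ := L.surjective_incl.surj y
  have h : (L.incl ≫ L.F) x = L.incl x := by rw [L.incl_F]; rfl
  change (L.incl ≫ L.F) x ∈ U ↔ L.incl x ∈ U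
  rw [h]

lemma le_F {U V : L.lift.Opens} (h : U ≤ V) : U ≤ L.F ⁻¹ᵁ V := by rwa [L.preimage_F]

lemma le_of_preimage_incl_le {U V : L.lift.Opens} (h : L.incl ⁻¹ᵁ U ≤ L.incl ⁻¹ᵁ V) : U ≤ V := by
  intro y hy
  obtain ⟨x, rfl⟩ := L.surjective_incl.surj y
  exact h hy

lemma exists_eq_mul {U : L.lift.Opens} (hU : IsAffineOpen U) {a : Γ(L.lift, U)}
    (ha : (L.incl.app U).hom a = 0) : ∃ b, a = p * b :=
  exists_eq_mul_of_isPullback L.isPullback (isAffineOpen_top _) (isAffineOpen_top _) p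
    (fun _ _ => trivial) (specRes_surjective _) (fun _ => exists_of_specRes_eq_zero _) hU ha

lemma app_eq_zero_of_mul {U : L.lift.Opens} (hU : IsAffineOpen U) {a : Γ(L.lift, U)}
    (ha : p * a = 0) : (L.incl.app U).hom a = 0 := by
  have := L.smooth
  exact app_eq_zero_of_isPullback L.isPullback.w (isAffineOpen_top _) p
    (fun _ _ => trivial) (fun _ => specRes_eq_zero_of_mul _) hU ha

/-- The difference from the `p`-th power vanishes on `S`, because `F` reduces to Frobenius, and is
therefore a multiple of `p`. -/
lemma exists_F_eq {U : L.lift.Opens} (hU : IsAffineOpen U) (a : Γ(L.lift, U)) :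
    ∃ g, (L.F.appLE U U (L.le_F le_rfl)).hom a = a ^ p + p * g := by
  have h : (L.incl.app U).hom ((L.F.appLE U U (L.le_F le_rfl)).hom a - a ^ p) = 0 := by
    have e : L.incl ⁻¹ᵁ U ≤ frob p s ⁻¹ᵁ (L.incl ⁻¹ᵁ U) := le_rfl
    rw [map_sub, sub_eq_zero, map_pow, Scheme.Hom.app_eq_appLE, appLE_appLE,
      appLE_congr_hom L.incl_F, ← appLE_appLE (frob p s) L.incl le_rfl e, frob_appLE s _ le_rfl,
      res_self]
  obtain ⟨g, hg⟩ := L.exists_eq_mul hU h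
  exact ⟨g, by rw [← hg]; ring⟩

end FrobeniusLifting

/-- A vector field as a derivation of the ring of sections. -/
def VectorField.toDerivation {X T : Scheme.{u}} {x : X ⟶ T} {V : X.Opens} (D : VectorField x V)
    (W : X.Opens) (hW : W ≤ V) : Derivation ℤ Γ(X, W) Γ(X, W) :=
  Derivation.mk' (D.toAddHom W hW).toIntLinearMap (D.leibniz W hW)

lemma VectorField.toDerivation_apply {X T : Scheme.{u}} {x : X ⟶ T} {V : X.Opens}
    (D : VectorField x V) (W : X.Opens) (hW : W ≤ V) (a : Γ(X, W)) :
    D.toDerivation W hW a = D.app W hW a := rfl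

section Base

variable {k : Type u} [Field k] [PerfectField k]

lemma ADer.app_pow {X Y : Scheme.{u}} {h : X ⟶ Y} {V : X.Opens} (δ : ADer h V) (W' W hW hW' a)
    (n : ℕ) : δ.app W' W hW hW' (a ^ n) =
      n * ((h.appLE W' W hW').hom a ^ (n - 1) * δ.app W' W hW hW' a) := by
  rw [← δ.toDual_snd, map_pow, TrivSqZeroExt.snd_pow, δ.toDual_fst, δ.toDual_snd, nsmul_eq_mul,
    smul_eq_mul, Nat.pred_eq_sub_one]

/-- Derivations kill functions from the spectrum of a perfect field. -/
lemma ADer.app_eq_zero_of_perfect (p : ℕ) [Fact p.Prime] [CharP k p]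
    {Z : Scheme.{u}} {h : Z ⟶ Spec (.of k)} {V : Z.Opens}
    (δ : ADer h V) (W' W hW hW' a) : δ.app W' W hW hW' a = 0 := by
  obtain ⟨b, rfl⟩ := exists_pow_eq_section k p W' a
  rw [δ.app_pow, natCast_eq_zero p h W, zero_mul]

/-- A derivation along a morphism of schemes over a perfect field. -/
def ADer.toDerivationAlong (p : ℕ) [Fact p.Prime] [CharP k p] {X Y : Scheme.{u}} {h : X ⟶ Y}
    {V : X.Opens} (δ : ADer h V) (y : Y ⟶ Spec (.of k)) : DerivationAlong h y V where
  app := δ.app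
  map_add := δ.app_add
  leibniz := δ.app_mul
  map_base W' W hW hW' U hU a := by
    rw [← δ.comp_app (k := h ≫ y) rfl hW (preimage_comp_le rfl hW' hU) hU hW',
      ADer.app_eq_zero_of_perfect p]
  map_res := δ.app_map

end Base

/-- A derivation along a morphism, without base. -/
def DerivationAlong.toADer {X Y T : Scheme.{u}} {h : X ⟶ Y} {y : Y ⟶ T} {V : X.Opens}
    (δ : DerivationAlong h y V) : ADer h V where
  app := δ.app
  app_add := δ.map_add
  app_mul := δ.leibniz
  app_map := δ.map_res

/-- The image of a derivation along `F` in the derivations along `F ≫ q`. -/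
def DerivationAlong.comp {S B B' T T' : Scheme.{u}} {F : S ⟶ B} {b : B ⟶ T} {U : S.Opens}
    (δ : DerivationAlong F b U) {q : B ⟶ B'} {F' : S ⟶ B'} (hF : F ≫ q = F') {b' : B' ⟶ T'}
    {e : T ⟶ T'} (he : b ≫ e = q ≫ b') : DerivationAlong F' b' U where
  app := (δ.toADer.comp q F' hF).app
  map_add := (δ.toADer.comp q F' hF).app_add
  leibniz := (δ.toADer.comp q F' hF).app_mul
  map_res := (δ.toADer.comp q F' hF).app_map
  map_base W' W hW hW' V hV a := by
    have i₁ : W ≤ F ⁻¹ᵁ (q ⁻¹ᵁ W') := le_preimage_of_comp hF hW'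
    have i₂ : q ⁻¹ᵁ W' ≤ b ⁻¹ᵁ (e ⁻¹ᵁ V) := le_preimage_of_comp he (preimage_comp_le rfl le_rfl hV)
    have h : (q.appLE W' (q ⁻¹ᵁ W') le_rfl).hom ((b'.appLE V W' hV).hom a) =
        (b.appLE (e ⁻¹ᵁ V) (q ⁻¹ᵁ W') i₂).hom ((e.appLE V (e ⁻¹ᵁ V) le_rfl).hom a) := by
      rw [appLE_appLE, appLE_appLE]
      exact appLE_congr_hom he.symm _ _
    rw [δ.toADer.comp_app hF hW hW' le_rfl i₁, h]
    exact δ.map_base _ _ _ _ _ _ _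

lemma DerivationAlong.comp_app {S B B' T T' : Scheme.{u}} {F : S ⟶ B} {b : B ⟶ T} {U : S.Opens}
    (δ : DerivationAlong F b U) {q : B ⟶ B'} {F' : S ⟶ B'} (hF : F ≫ q = F') {b' : B' ⟶ T'}
    {e : T ⟶ T'} (he : b ≫ e = q ≫ b') {W' : B'.Opens} {W : S.Opens} (hW : W ≤ U)
    (hW' : W ≤ F' ⁻¹ᵁ W') {W₁ : B.Opens} (h₁ : W₁ ≤ q ⁻¹ᵁ W') (hW₁ : W ≤ F ⁻¹ᵁ W₁) (a : Γ(B', W')) :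
    (δ.comp hF he).app W' W hW hW' a = δ.app W₁ W hW hW₁ ((q.appLE W' W₁ h₁).hom a) :=
  δ.toADer.comp_app hF hW hW' h₁ hW₁ a

/-- This passes between `ζ` for the relative and for the absolute Frobenius: it is used along the
projection `S' ⟶ S` and along its inverse. -/
lemma IsZeta.comp {p : ℕ} {S B B' T T' T₁ S₂ B₂ B₂' T₂ : Scheme.{u}} {F : S ⟶ B} {s : S ⟶ T}
    {b : B ⟶ T'} {iS : S ⟶ S₂} {iB : B ⟶ B₂} {F₂ : S₂ ⟶ B₂} {s₂ : S₂ ⟶ T₂} {U : S.Opens}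
    {D : VectorField s U} {δ : DerivationAlong F b U} (H : IsZeta p F iS iB F₂ s₂ D δ)
    {q : B ⟶ B'} {F' : S ⟶ B'} (hF : F ≫ q = F') {b' : B' ⟶ T₁} {e : T' ⟶ T₁}
    (he : b ≫ e = q ≫ b') {q₂ : B₂ ⟶ B₂'} {F₂' : S₂ ⟶ B₂'} (hF₂ : F₂ ≫ q₂ = F₂') {iB' : B' ⟶ B₂'}
    (hi : iB ≫ q₂ = q ≫ iB') : IsZeta p F' iS iB' F₂' s₂ D (δ.comp hF he) := by
  intro V U₂ hUV D₂ W hW hWU hWF hrel b₂ c₂ hc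
  have i₁ : U₂ ≤ F₂ ⁻¹ᵁ (q₂ ⁻¹ᵁ V) := le_preimage_of_comp hF₂ hUV
  have i₂ : iB ⁻¹ᵁ (q₂ ⁻¹ᵁ V) ≤ q ⁻¹ᵁ (iB' ⁻¹ᵁ V) :=
    le_preimage_of_comp hi.symm (preimage_comp_le rfl le_rfl le_rfl)
  have i₃ : W ≤ F ⁻¹ᵁ (iB ⁻¹ᵁ (q₂ ⁻¹ᵁ V)) := by
    refine le_preimage_of_comp (k := F ≫ iB) rfl (le_preimage_of_comp (k := F' ≫ iB') ?_ hWF)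
    rw [Category.assoc, hi, reassoc_of% hF]
  have := H (q₂ ⁻¹ᵁ V) U₂ i₁ D₂ W hW hWU i₃ hrel ((q₂.app V).hom b₂) c₂ (by
    rw [← hc, Scheme.Hom.app_eq_appLE, appLE_comp_eq hF₂ le_rfl i₁ hUV])
  rw [← this, δ.comp_app hF he hW hWF i₂ i₃]
  congr 1
  rw [Scheme.Hom.app_eq_appLE, Scheme.Hom.app_eq_appLE, Scheme.Hom.app_eq_appLE, appLE_appLE,
    appLE_appLE]
  exact appLE_congr_hom hi.symm _ _

/-! ### Local existence of `ζ`. -/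

namespace FrobeniusLifting

variable {k : Type u} [Field k] [PerfectField k] {p : ℕ} [Fact p.Prime] [CharP k p]
  {S : Scheme.{u}} {s : S ⟶ Spec (.of k)} (L : FrobeniusLifting p s)

/-- The formula holds for every lift `b` and every `g`, without a preferred choice. This is what
makes the construction compatible with shrinking the affine open. -/
lemma exists_affine_zeta {U : L.lift.Opens} (hU : IsAffineOpen U)
    (D : VectorField s (L.incl ⁻¹ᵁ U)) : ∃ δ : ADer (frob p s) (L.incl ⁻¹ᵁ U),
    ∀ b g : Γ(L.lift, U), (L.F.appLE U U (L.le_F le_rfl)).hom b = b ^ p + p * g →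
      δ.app (L.incl ⁻¹ᵁ U) (L.incl ⁻¹ᵁ U) le_rfl (frob_preimage s _).ge ((L.incl.app U).hom b) =
        (L.incl.app U).hom b ^ (p - 1) * D.app _ le_rfl ((L.incl.app U).hom b) +
          D.app _ le_rfl ((L.incl.app U).hom g) := by
  obtain ⟨d, dadd, dmul, hd⟩ := exists_dividedFrobenius (Fact.out : p.Prime) (L.incl.app U).hom
    (L.surjective_app hU) (fun a => L.exists_eq_mul hU) (fun a => L.app_eq_zero_of_mul hU)
    (natCast_eq_zero p s _) (L.F.appLE U U (L.le_F le_rfl)).hom (L.exists_F_eq hU)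
    (D.toDerivation _ le_rfl)
  obtain ⟨δ, hδ⟩ := ADer.exists_of_affine (h := frob p s) (L.isAffineOpen_preimage hU)
    (frob_preimage s _).ge d dadd (fun a b => by
      rw [dmul, frob_appLE s _ le_rfl, frob_appLE s _ le_rfl, res_self, res_self])
  exact ⟨δ, fun b g hg => (hδ _).trans (hd b g hg)⟩

/-- The map `ζ` exists locally. -/
theorem exists_zeta {U : L.lift.Opens} (hU : IsAffineOpen U) (D : VectorField s (L.incl ⁻¹ᵁ U)) :
    ∃ δ : DerivationAlong (frob p s) s (L.incl ⁻¹ᵁ U),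
      IsZeta p (frob p s) L.incl L.incl L.F L.str D δ := by
  obtain ⟨δ, hδ⟩ := L.exists_affine_zeta hU D
  refine ⟨δ.toDerivationAlong p s, ?_⟩
  intro V U₂ hUV D₂ W hW hWU hWF hrel b₂ c₂ hc
  change δ.app _ _ _ _ _ = _
  refine section_ext fun x hx => ?_
  obtain ⟨U', hU', hU'W, hxU'⟩ := L.exists_affine W hx
  refine ⟨L.incl ⁻¹ᵁ U', hU'W, hxU', ?_⟩
  have iU : U' ≤ U := L.le_of_preimage_incl_le (hU'W.trans hW)
  have iU₂ : U' ≤ U₂ := L.le_of_preimage_incl_le (hU'W.trans hWU)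
  have iV : U' ≤ V := L.le_of_preimage_incl_le (hU'W.trans hWF)
  have hres : ∀ {V : L.lift.Opens} (i : U' ≤ V) (a : Γ(L.lift, V)),
      res S (L.incl.preimage_mono i) ((L.incl.app V).hom a) =
        (L.incl.app U').hom (res L.lift i a) := fun i a => by
    rw [Scheme.Hom.app_eq_appLE, Scheme.Hom.app_eq_appLE, res_appLE, appLE_res]
  have hFres : ∀ {V : L.lift.Opens} (i : U' ≤ V) (hV : V ≤ L.F ⁻¹ᵁ V) (a g : Γ(L.lift, V)),
      (L.F.appLE V V hV).hom a = a ^ p + p * g →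
      (L.F.appLE U' U' (L.le_F le_rfl)).hom (res L.lift i a) =
        res L.lift i a ^ p + p * res L.lift i g := fun i hV a g h => by
    have := congrArg (res L.lift i) h
    rw [res_appLE] at this
    rw [appLE_res, this, map_add, map_mul, map_pow, map_natCast]
  -- The defining property of `ζ` involves arbitrary opens, while the formula is available on affine
  -- ones. Near each point a smaller affine `U'` is used, and the derivation built there is the
  -- restriction of `δ`, since both obey the same formula.
  obtain ⟨δ', hδ'⟩ := L.exists_affine_zeta hU' (D.restrict (L.incl.preimage_mono iU))
  have hδδ' : δ.restrict (L.incl.preimage_mono iU) = δ' := by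
    refine ADer.ext_of_affine (L.isAffineOpen_preimage hU) (L.incl.preimage_mono iU) fun a => ?_
    obtain ⟨b, rfl⟩ := L.surjective_app hU a
    obtain ⟨g, hg⟩ := L.exists_F_eq hU b
    have h₁ := congrArg (res S (L.incl.preimage_mono iU)) (hδ b g hg)
    rw [δ.res_app] at h₁
    refine h₁.trans ?_
    have h₂ := hδ' _ _ (hFres iU _ b g hg)
    have h₃ := δ'.app_res (L.incl.preimage_mono iU) le_rfl (frob_preimage s (L.incl ⁻¹ᵁ U')).ge
      ((L.incl.app U).hom b)
    rw [hres iU] at h₃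
    refine Eq.trans ?_ (h₂.symm.trans h₃)
    rw [map_add, map_mul, map_pow, ← D.app_map (L.incl.preimage_mono iU), 
      ← D.app_map (L.incl.preimage_mono iU), hres, hres]
    rfl
  set b' := res L.lift iV b₂
  obtain ⟨g, hg⟩ := L.exists_F_eq hU' b'
  have h₁ : res S hU'W (δ.app (L.incl ⁻¹ᵁ V) W hW hWF ((L.incl.app V).hom b₂)) =
      δ'.app (L.incl ⁻¹ᵁ U') (L.incl ⁻¹ᵁ U') le_rfl (frob_preimage s _).ge
        ((L.incl.app U').hom b') := by
    rw [δ.res_app, ← hres iV, δ'.app_res (L.incl.preimage_mono iV), ← hδδ']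
    rfl
  refine h₁.trans ((hδ' _ _ hg).trans ?_)
  have h₂ : D₂.app U' iU₂ (b' ^ p + p * g) = p * res L.lift iU₂ c₂ := by
    rw [← hg, appLE_res]
    have := congrArg (res L.lift iU₂) hc
    rw [← D₂.app_map iU₂ le_rfl, res_appLE, map_mul, map_natCast] at this
    exact this
  -- Applying `D₂` to `F̃ b' = b' ^ p + p g` gives `p` times the formula for `ζ`, while by
  -- assumption the same value is `p` times `c₂`. As `p`-torsion reduces to zero, the two sides
  -- agree modulo `p`.
  have h₃ : p * (b' ^ (p - 1) * D₂.app U' iU₂ b' + D₂.app U' iU₂ g - res L.lift iU₂ c₂) = 0 := by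
    rw [← D₂.toDerivation_apply, map_add, Derivation.leibniz_pow, Derivation.leibniz,
      Derivation.map_natCast] at h₂
    simp only [smul_eq_mul, nsmul_eq_mul, mul_zero, add_zero, D₂.toDerivation_apply] at h₂
    linear_combination h₂
  have h₄ := L.app_eq_zero_of_mul hU' h₃
  have hD : ∀ a : Γ(L.lift, U'), (L.incl.app U').hom (D₂.app U' iU₂ a) =
      D.app (L.incl ⁻¹ᵁ U') (L.incl.preimage_mono iU) ((L.incl.app U').hom a) := fun a => by
    have := hrel U' iU₂ (L.incl ⁻¹ᵁ U') hU'W le_rfl a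
    rw [Scheme.Hom.app_eq_appLE]
    exact this.symm
  rw [map_sub, map_add, map_mul, map_pow, hD, hD, sub_eq_zero] at h₄
  refine h₄.trans ?_
  rw [res_appLE, Scheme.Hom.app_eq_appLE, appLE_res]

end FrobeniusLifting

/-! ### `p`-th powers of derivations -/

section Iterate

/-- The ring is not assumed to have characteristic `p`: the lemma is used for endomorphisms of
tensor products over `ℤ`, where `p` is killed only after mapping to `A`. -/
lemma exists_sum_pow_prime_eq {R : Type*} [Ring R] {p : ℕ} (hp : p.Prime) {ι : Type*}
    (t : Finset ι) (N : ι → R) (hN : ∀ i j, Commute (N i) (N j)) :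
    ∃ r : R, (∑ i ∈ t, N i) ^ p = ∑ i ∈ t, N i ^ p + p * r := by
  classical
  induction t using Finset.induction_on with
  | empty => exact ⟨0, by simp [hp.ne_zero]⟩
  | insert i t hi ih =>
    obtain ⟨r, hr⟩ := ih
    have hc : Commute (N i) (∑ j ∈ t, N j) := Commute.sum_right _ _ _ fun j _ => hN i j
    obtain ⟨q, hq⟩ : ∃ q, (N i + ∑ j ∈ t, N j) ^ p = N i ^ p + (∑ j ∈ t, N j) ^ p + p * q :=
      ⟨_, (hc.add_pow_prime_eq hp).trans (by rw [mul_assoc, mul_assoc])⟩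
    refine ⟨r + q, ?_⟩
    rw [Finset.sum_insert hi, Finset.sum_insert hi, hq, hr, mul_add]
    abel

/-- If `E` is induced by a sum of commuting operators, then its `p`-th iterate is induced by the sum
of their `p`-th powers, when `p = 0`. -/
lemma iterate_prime_eq_sum {M A : Type*} [AddCommGroup M] [AddCommGroup A] {p : ℕ} (hp : p.Prime)
    (hA : ∀ a : A, p • a = 0) (μ : M →+ A) (E : A → A) {ι : Type*} [Fintype ι]
    (N : ι → Module.End ℤ M) (hN : ∀ i j, Commute (N i) (N j))
    (hE : ∀ m, E (μ m) = μ ((∑ i, N i) m)) (m : M) :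
    E^[p] (μ m) = ∑ i, μ ((N i ^ p) m) := by
  have h : ∀ n m, E^[n] (μ m) = μ (((∑ i, N i) ^ n) m) := fun n => by
    induction n with
    | zero => intro m; rfl
    | succ n ih => intro m; rw [Function.iterate_succ_apply, hE, ih, pow_succ]; rfl
  obtain ⟨r, hr⟩ := exists_sum_pow_prime_eq hp Finset.univ N hN
  rw [h, hr, LinearMap.add_apply, map_add, Module.End.mul_apply, Module.End.natCast_apply,
    map_nsmul, hA, add_zero, LinearMap.sum_apply, map_sum]

/-- By the Leibniz rule, multiplication `A ⊗ A → A` intertwines `D ⊗ 1 + 1 ⊗ D` with `D`. The two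
summands commute, so their `p`-th powers add up modulo `p`. -/
lemma iterate_prime_mul {A : Type*} [CommRing A] {p : ℕ} (hp : p.Prime) (hA : (p : A) = 0)
    (D : A →+ A) (hD : ∀ x y, D (x * y) = x * D y + y * D x) (x y : A) :
    D^[p] (x * y) = x * D^[p] y + y * D^[p] x := by
  let d : Module.End ℤ A := D.toIntLinearMap
  let N : Fin 2 → Module.End ℤ (TensorProduct ℤ A A) :=
    ![TensorProduct.map d 1, TensorProduct.map 1 d]
  have hc : Commute (TensorProduct.map d (1 : Module.End ℤ A)) (TensorProduct.map 1 d) := by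
    refine TensorProduct.ext' fun a b => ?_
    rfl
  have hN : ∀ i j, Commute (N i) (N j) := by
    intro i j
    fin_cases i <;> fin_cases j
    · exact Commute.refl _
    · exact hc
    · exact hc.symm
    · exact Commute.refl _
  have hpow : ∀ n, (⇑d)^[n] = ⇑(d ^ n) := fun n => (Module.End.coe_pow d n).symm
  have h := iterate_prime_eq_sum hp (fun a => by rw [nsmul_eq_mul, hA, zero_mul])
    (LinearMap.mul' ℤ A).toAddMonoidHom D N hN (fun m => by
      induction m using TensorProduct.induction_on with
      | zero => simp
      | tmul a b =>
        rw [Fin.sum_univ_two, LinearMap.add_apply, map_add]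
        change D (a * b) = D a * b + a * D b
        rw [hD]; ring
      | add a b ha hb => rw [map_add, map_add, map_add, map_add, ha, hb]) (TensorProduct.tmul ℤ x y)
  have h1p : (1 : Module.End ℤ A) ^ p = 1 := one_pow p
  have h₀ : N 0 ^ p = TensorProduct.map (d ^ p) (1 ^ p) := TensorProduct.map_pow d 1 p
  have h₁ : N 1 ^ p = TensorProduct.map (1 ^ p) (d ^ p) := TensorProduct.map_pow 1 d p
  rw [h1p] at h₀ h₁
  rw [Fin.sum_univ_two, h₀, h₁] at h
  have h' : D^[p] (x * y) = (d ^ p) x * y + x * (d ^ p) y := h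
  rw [h', ← hpow]
  change D^[p] x * y + x * D^[p] y = _
  ring

/-- A linear combination of commuting operators with vanishing `p`-th powers. -/
lemma iterate_prime_eq_zero {C Y A : Type*} [CommRing C] [AddCommGroup Y] [CommRing A] {p : ℕ}
    (hp : p.Prime) (hA : (p : A) = 0) (α : C →+* A) (β : Y →+ A) (E : A →+ A)
    (hE : ∀ c a, E (α c * a) = α c * E a) {n : ℕ} (c : Fin n → C) (θ : Fin n → Y →+ Y)
    (hcomm : ∀ i j y, θ i (θ j y) = θ j (θ i y)) (hθ : ∀ i y, (θ i)^[p] y = 0)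
    (hEβ : ∀ y, E (β y) = ∑ i, α (c i) * β (θ i y)) (y : Y) : E^[p] (β y) = 0 := by
  -- The map `c ⊗ y ↦ α c * β y` intertwines `∑ cᵢ ⊗ θᵢ` with `E`. The operators `cᵢ ⊗ θᵢ` commute,
  -- and `θᵢ ^ p = 0` makes their `p`-th powers vanish.
  let N : Fin n → Module.End ℤ (TensorProduct ℤ C Y) := fun i =>
    TensorProduct.map (LinearMap.mulLeft ℤ (c i)) (θ i).toIntLinearMap
  let μ : TensorProduct ℤ C Y →ₗ[ℤ] A := TensorProduct.lift
    ((LinearMap.mul ℤ A).compl₁₂ α.toAddMonoidHom.toIntLinearMap β.toIntLinearMap)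
  have hμ : ∀ c y, μ (TensorProduct.tmul ℤ c y) = α c * β y := fun c y => rfl
  have hN : ∀ i j, Commute (N i) (N j) := by
    intro i j
    refine TensorProduct.ext' fun a b => ?_
    change TensorProduct.tmul ℤ (c i * (c j * a)) (θ i (θ j b)) =
      TensorProduct.tmul ℤ (c j * (c i * a)) (θ j (θ i b))
    rw [hcomm, mul_left_comm]
  have h := iterate_prime_eq_sum hp (fun a => by rw [nsmul_eq_mul, hA, zero_mul])
    μ.toAddMonoidHom E N hN (fun m => by
      induction m using TensorProduct.induction_on with
      | zero => simp
      | tmul a b =>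
        rw [LinearMap.sum_apply, map_sum]
        change E (α a * β b) = ∑ i, α (c i * a) * β (θ i b)
        rw [hE, hEβ, Finset.mul_sum]
        refine Finset.sum_congr rfl fun i _ => ?_
        rw [map_mul]; ring
      | add a b ha hb => rw [map_add, map_add, map_add, map_add, ha, hb]) (TensorProduct.tmul ℤ 1 y)
  have h₁ : μ.toAddMonoidHom (TensorProduct.tmul ℤ 1 y) = β y := by
    change α 1 * β y = _
    rw [map_one, one_mul]
  rw [h₁] at h
  rw [h]
  refine Finset.sum_eq_zero fun i _ => ?_
  have h₂ : ((θ i).toIntLinearMap ^ p) y = 0 := by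
    rw [Module.End.coe_pow]
    exact hθ i y
  have h₃ : N i ^ p = TensorProduct.map (LinearMap.mulLeft ℤ (c i) ^ p)
      ((θ i).toIntLinearMap ^ p) := TensorProduct.map_pow _ _ _
  rw [h₃]
  change μ (TensorProduct.tmul ℤ _ (((θ i).toIntLinearMap ^ p) y)) = 0
  rw [h₂, TensorProduct.tmul_zero, map_zero]

end Iterate

/-- The `p`-th power of a vector field in characteristic `p`. -/
def VectorField.powPrime {X T : Scheme.{u}} {x : X ⟶ T} {V : X.Opens} (D : VectorField x V) (p : ℕ)
    [Fact p.Prime] (hX : ∀ U : X.Opens, (p : Γ(X, U)) = 0) : VectorField x V where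
  app W hW := (D.app W hW)^[p]
  map_add W hW a b := iterate_map_add (D.toAddHom W hW) p a b
  leibniz W hW a b := iterate_prime_mul Fact.out (hX W) (D.toAddHom W hW) (D.leibniz W hW) a b
  map_base W hW U hU a := by
    obtain ⟨n, hn⟩ : ∃ n, p = n + 1 :=
      ⟨p - 1, by have := (Fact.out : p.Prime).pos; omega⟩
    rw [hn, Function.iterate_succ_apply, D.map_base]
    exact iterate_map_zero (D.toAddHom W hW) n
  map_res W W' h hW a := by
    refine (Function.Semiconj.iterate_right (fun b => ?_) p a).symm
    exact (D.map_res W W' h hW b).symm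

lemma VectorField.powPrime_app {X T : Scheme.{u}} {x : X ⟶ T} {V : X.Opens} (D : VectorField x V)
    (p : ℕ) [Fact p.Prime] (hX : ∀ U : X.Opens, (p : Γ(X, U)) = 0) (W hW a) :
    (D.powPrime p hX).app W hW a = (D.app W hW)^[p] a := rfl

/-! ### Local decompositions -/

section Decomposition

/-- For a smooth homomorphism the module of differentials is finite projective, hence a direct
summand of a free module. The coordinates of the embedding are the derivations `D i`, and any other
derivation factors through the differentials and is a combination of them. The `D i` do not depend
on the target `C`. -/
lemma exists_derivation_decomposition {R₀ R : Type u} [CommRing R₀] [CommRing R] (f : R₀ →+* R)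
    (hf : f.Smooth) : ∃ (n : ℕ) (D : Fin n → R → R),
      (∀ i a b, D i (a + b) = D i a + D i b) ∧ (∀ i a b, D i (a * b) = a * D i b + b * D i a) ∧
      ∀ (C : Type u) [CommRing C] (g : R →+* C) (δ : R → C), (∀ a b, δ (a + b) = δ a + δ b) →
        (∀ a b, δ (a * b) = g a * δ b + g b * δ a) → (∀ a, δ (f a) = 0) →
        ∃ c : Fin n → C, ∀ a, δ a = ∑ i, c i * g (D i a) := by
  algebraize [f]
  have : Module.Projective R (Ω[R⁄R₀]) := inferInstance
  have : Module.Finite R (Ω[R⁄R₀]) := inferInstance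
  obtain ⟨n, φ, ψ, -, -, hφψ⟩ := Module.Finite.exists_comp_eq_id_of_projective R (Ω[R⁄R₀])
  refine ⟨n, fun i a => ψ (KaehlerDifferential.D R₀ R a) i, fun i a b => ?_,
    fun i a b => ?_, fun C _ g δ h₁ h₂ h₃ => ?_⟩
  · beta_reduce
    rw [map_add, map_add, Pi.add_apply]
  · beta_reduce
    rw [Derivation.leibniz, map_add, map_smul, map_smul]; rfl
  · let _ := g.toAlgebra
    let _ := (g.comp f).toAlgebra
    have : IsScalarTower R₀ R C := IsScalarTower.of_algebraMap_eq' rfl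
    have h0 : δ 0 = 0 := by simpa using h₁ 0 0
    let d : Derivation R₀ R C := Derivation.mk'
      { toFun := δ
        map_add' := h₁
        map_smul' := fun a b => by
          rw [Algebra.smul_def, h₂, RingHom.id_apply, Algebra.smul_def]
          have : δ (algebraMap R₀ R a) = 0 := h₃ a
          rw [this, mul_zero, add_zero]
          rfl } (fun a b => by
            change δ (a * b) = g a * δ b + g b * δ a
            exact h₂ a b)
    refine ⟨fun i => d.liftKaehlerDifferential (φ (Pi.single i 1)), fun a => ?_⟩
    have e₁ : δ a = d.liftKaehlerDifferential (φ (ψ (KaehlerDifferential.D R₀ R a))) := by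
      have := congrArg (fun l => l (KaehlerDifferential.D R₀ R a)) hφψ
      simp only [LinearMap.comp_apply, LinearMap.id_apply] at this
      rw [this, d.liftKaehlerDifferential_comp_D]
      rfl
    have e₂ : ψ (KaehlerDifferential.D R₀ R a) =
        ∑ i, ψ (KaehlerDifferential.D R₀ R a) i • Pi.single i (1 : R) := by
      ext j
      simp [Finset.sum_apply, Pi.single_apply]
    rw [e₁]
    conv_lhs => rw [e₂]
    rw [map_sum, map_sum]
    refine Finset.sum_congr rfl fun i _ => ?_
    rw [map_smul, map_smul, mul_comm]
    rfl

/-- A linear combination of pullbacks of vector fields. -/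
def ADer.lincomb {S B T : Scheme.{u}} {F : S ⟶ B} {b : B ⟶ T} {U : S.Opens} {V : B.Opens}
    (hU : U ≤ F ⁻¹ᵁ V) {n : ℕ} (c : Fin n → Γ(S, U)) (D : Fin n → VectorField b V) : ADer F U where
  app W' W hW hW' a := ∑ i, res S hW (c i) * ((D i).pull F hU).app W' W hW hW' a
  app_add W' W hW hW' a a' := by
    rw [← Finset.sum_add_distrib]
    exact Finset.sum_congr rfl fun i _ => by rw [ADer.app_add, mul_add]
  app_mul W' W hW hW' a a' := by
    rw [Finset.mul_sum, Finset.mul_sum, ← Finset.sum_add_distrib]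
    exact Finset.sum_congr rfl fun i _ => by rw [ADer.app_mul]; ring
  app_map W₁' W₂' W₁ W₂ i j h₁ h₁' h₂' a := by
    rw [map_sum]
    refine Finset.sum_congr rfl fun l _ => ?_
    rw [ADer.app_map _ W₁' W₂' W₁ W₂ i j h₁ h₁', map_mul]
    congr 1
    exact (res_res h₁ j _).symm

lemma ADer.lincomb_app {S B T : Scheme.{u}} {F : S ⟶ B} {b : B ⟶ T} {U : S.Opens} {V : B.Opens}
    (hU : U ≤ F ⁻¹ᵁ V) {n : ℕ} (c : Fin n → Γ(S, U)) (D : Fin n → VectorField b V) (W' W hW hW' a) :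
    (ADer.lincomb hU c D).app W' W hW hW' a =
      ∑ i, res S hW (c i) * ((D i).pull F hU).app W' W hW hW' a := rfl

/-- As an equality of derivations along `F`, a decomposition can be checked on the coordinate ring
of one affine open. -/
lemma isDecomposition_iff {S B T : Scheme.{u}} {F : S ⟶ B} {b : B ⟶ T} {U : S.Opens}
    {δ : DerivationAlong F b U} {V : B.Opens} {U' : S.Opens} (hU' : U' ≤ U) (hU : U' ≤ F ⁻¹ᵁ V)
    {n : ℕ} {c : Fin n → Γ(S, U')} {D : Fin n → VectorField b V} :
    IsDecomposition δ hU' c D ↔ δ.toADer.restrict hU' = ADer.lincomb hU c D := by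
  constructor
  · rintro ⟨-, H⟩
    ext W' W hW hW' a
    have h := δ.toADer.app_res (inf_le_left : W' ⊓ V ≤ W') (hW.trans hU')
      (le_inf_preimage hW' (hW.trans hU)) a
    refine h.symm.trans ?_
    exact H (W' ⊓ V) inf_le_right W hW (le_inf_preimage hW' (hW.trans hU)) _
  · intro H
    refine ⟨hU, fun W' hW' W hW hWW' a => ?_⟩
    have h := congrArg (fun d : ADer F U' => d.app W' W hW hWW' a) H
    refine h.trans ((ADer.lincomb_app hU c D W' W hW hWW' a).trans
      (Finset.sum_congr rfl fun i _ => ?_))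
    rw [VectorField.pull_app _ F hU _ _ _ _ _ W' le_rfl hW' hWW', res_self]

/-- Derivations along `F : S ⟶ B` decompose locally when `B` is smooth. -/
theorem exists_isDecomposition {k : Type u} [Field k] [PerfectField k] (p : ℕ) [Fact p.Prime]
    [CharP k p] {S B : Scheme.{u}} {F : S ⟶ B} {b : B ⟶ Spec (.of k)} [Smooth b]
    {U : S.Opens} (δ : DerivationAlong F b U) {x : S} (hx : x ∈ U) {W₀ : B.Opens}
    (hW₀ : F x ∈ W₀) :
    ∃ (V : B.Opens) (U' : S.Opens) (hU' : U' ≤ U) (n : ℕ) (c : Fin n → Γ(S, U'))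
      (D : Fin n → VectorField b V), x ∈ U' ∧ V ≤ W₀ ∧ IsDecomposition δ hU' c D := by
  obtain ⟨V, hV, hxV, hVW⟩ := exists_isAffineOpen_mem_and_subset (X := B) (x := F x)
    (U := W₀) hW₀
  have e : V ≤ b ⁻¹ᵁ ⊤ := fun _ _ => trivial
  obtain ⟨n, d, dadd, dmul, hd⟩ := exists_derivation_decomposition _
    (Scheme.Hom.smooth_appLE b (isAffineOpen_top _) hV e)
  have hD : ∀ i, ∃ D : VectorField b V, ∀ a, D.app V le_rfl a = d i a := fun i => by
    obtain ⟨η, hη⟩ := ADer.exists_of_affine (h := 𝟙 B) hV (le_preimage_id le_rfl) (d i) (dadd i)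
      (fun a a' => by
        rw [id_appLE _ le_rfl, id_appLE _ le_rfl, res_self, res_self]
        exact dmul i a a')
    exact ⟨η.toVectorField b fun U a W hW hU => ADer.app_eq_zero_of_perfect p _ _ _ _ _ _, hη⟩
  choose D hD using hD
  have hU₁ : U ⊓ F ⁻¹ᵁ V ≤ U := inf_le_left
  have hU₂ : U ⊓ F ⁻¹ᵁ V ≤ F ⁻¹ᵁ V := inf_le_right
  obtain ⟨c, hc⟩ := hd Γ(S, U ⊓ F ⁻¹ᵁ V) (F.appLE V _ hU₂).hom (δ.app V _ hU₁ hU₂)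
    (δ.map_add _ _ _ _) (δ.leibniz _ _ _ _) (δ.map_base _ _ _ _ _ e)
  refine ⟨V, U ⊓ F ⁻¹ᵁ V, hU₁, n, c, D, ⟨hx, hxV⟩, hVW, ?_⟩
  rw [isDecomposition_iff hU₁ hU₂]
  refine ADer.ext_of_affine hV hU₂ fun a => ?_
  refine (hc a).trans (Eq.trans (Finset.sum_congr rfl fun i _ => ?_)
    (ADer.lincomb_app hU₂ c D V _ le_rfl hU₂ a).symm)
  rw [VectorField.pull_app _ F hU₂ _ _ _ _ _ V le_rfl le_rfl hU₂, res_self, res_self, hD]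

end Decomposition

/-! ### Vanishing of `p`-th powers under pullback. -/

section PowZero

/-- A Higgs field that is pulled back from an integrable Higgs field `θ` with `[p] ∘ θ = 0` has
vanishing `p`-th powers. -/
theorem iterate_prime_eq_zero_of_isPullbackValue {k : Type u} [Field k] [PerfectField k] {p : ℕ}
    [Fact p.Prime] [CharP k p] {X Y S B T : Scheme.{u}} {π : X ⟶ Y} {f : X ⟶ S} {F : S ⟶ B}
    {g : Y ⟶ B} (H : IsPullback π f g F) {b : B ⟶ Spec (.of k)} [Smooth b] {s : S ⟶ Spec (.of k)}
    {x : X ⟶ T} {θ : HiggsField g b}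
    (hθ : θ.Integrable) (hθp : θ.PowZero p 1) {U : S.Opens} {δ : DerivationAlong F b U}
    {E : VectorField x (f ⁻¹ᵁ U)} (hE : IsPullbackValue π f F θ δ E)
    (hES : ∀ (W : S.Opens) (V : X.Opens) (hV : V ≤ f ⁻¹ᵁ U) (hVW : V ≤ f ⁻¹ᵁ W) (a : Γ(S, W)),
      E.app V hV ((f.appLE W V hVW).hom a) = 0) (W : X.Opens) (hW : W ≤ f ⁻¹ᵁ U) (a : Γ(X, W)) :
    (E.app W hW)^[p] a = 0 := by
  have hp : p.Prime := Fact.out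
  have hX : ∀ U : X.Opens, (p : Γ(X, U)) = 0 := natCast_eq_zero p (f ≫ s)
  -- The `p`-th power of `E` is again a vector field, so it suffices to see that it kills the
  -- functions from `Y` and from `S`. The former uses a local decomposition of `δ`; for the latter
  -- already `E` gives zero.
  have key := VectorField.app_eq_of_isPullback H (E := E.powPrime p hX)
    (E' := (0 : VectorField x (f ⁻¹ᵁ U))) ?_ ?_ W hW a
  · exact key
  · ext W' W hW hW' y
    rw [VectorField.along_app, VectorField.along_app, VectorField.zero_app]
    refine section_ext fun z hz => ?_
    have hFz : F (f z) ∈ (⊤ : B.Opens) := trivial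
    obtain ⟨V, U', hU', n, c, D, hzU', -, hdec⟩ := exists_isDecomposition p δ (hW hz) hFz
    have hU'V := hdec.1
    have hzV : g (π z) ∈ V := by
      have : (π ≫ g) z = (f ≫ F) z := by rw [H.w]
      change (π ≫ g) z ∈ V
      rw [this]
      exact hU'V hzU'
    refine ⟨W ⊓ f ⁻¹ᵁ U' ⊓ π ⁻¹ᵁ (W' ⊓ g ⁻¹ᵁ V), inf_le_left.trans inf_le_left,
      ⟨⟨hz, hzU'⟩, hW' hz, hzV⟩, ?_⟩
    set W₁ := W ⊓ f ⁻¹ᵁ U' ⊓ π ⁻¹ᵁ (W' ⊓ g ⁻¹ᵁ V) with hW₁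
    have i₁ : W₁ ≤ W := inf_le_left.trans inf_le_left
    have i₂ : W₁ ≤ f ⁻¹ᵁ U' := inf_le_left.trans inf_le_right
    have i₃ : W₁ ≤ π ⁻¹ᵁ (W' ⊓ g ⁻¹ᵁ V) := inf_le_right
    have i₄ : W' ⊓ g ⁻¹ᵁ V ≤ g ⁻¹ᵁ V := inf_le_right
    have i₅ : W' ⊓ g ⁻¹ᵁ V ≤ W' := inf_le_left
    rw [map_zero, ← VectorField.app_map _ i₁, res_appLE, ← appLE_res π i₅ i₃,
      VectorField.powPrime_app]
    refine iterate_prime_eq_zero hp (hX W₁) (f.appLE U' W₁ i₂).hom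
      (π.appLE (W' ⊓ g ⁻¹ᵁ V) W₁ i₃).hom.toAddMonoidHom (E.toAddHom W₁ (i₁.trans hW)) ?_ c
      (fun i => (θ.toFun V (D i)).toAddHom _ i₄) ?_ ?_ ?_ _
    · intro c a
      change E.app W₁ _ _ = _ * E.app W₁ _ _
      rw [E.leibniz, hES, mul_zero, add_zero]
    · intro i j y
      have := hθ V (D i) (D j) _ i₄ y
      rw [VectorField.bracket_app, map_zero, zero_mul, sub_eq_zero] at this
      exact this
    · intro i y
      have := hθp V (D i) _ i₄ y
      rw [pow_one] at this
      exact this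
    · intro y
      exact hE V U' hU' n c D hdec _ i₄ W₁ i₂ i₃ y
  · ext W' W hW hW' y
    rw [VectorField.along_app, VectorField.along_app, VectorField.zero_app,
      VectorField.powPrime_app]
    obtain ⟨n, hn⟩ : ∃ n, p = n + 1 := ⟨p - 1, by have := hp.pos; omega⟩
    rw [hn, Function.iterate_succ_apply, hES]
    exact iterate_map_zero (E.toAddHom W hW) n

end PowZero

/-! ### The affine line -/

section Line

variable {k : Type u} [Field k] {S Z : Scheme.{u}} (s : S ⟶ Spec (.of k))

lemma sec_toLine (a : k) : sec s a ≫ toLine s =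
    s ≫ Spec.map (CommRingCat.ofHom (Polynomial.evalRingHom a)) := pullback.lift_fst _ _ _

lemma sec_toBase (a : k) : sec s a ≫ toBase s = 𝟙 S := pullback.lift_snd _ _ _

lemma appTop_coord_eval (g : Z ⟶ Spec (.of k)) (a : k) :
    (g ≫ Spec.map (CommRingCat.ofHom (Polynomial.evalRingHom a))).appTop.hom (coord k) =
      g.appTop.hom ((Scheme.ΓSpecIso (.of k)).inv.hom a) := by
  have h := Scheme.ΓSpecIso_inv_naturality (CommRingCat.ofHom (Polynomial.evalRingHom a))
  have h₂ := congrArg (fun φ => CommRingCat.Hom.hom φ Polynomial.X) h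
  have h₃ : (Scheme.ΓSpecIso (.of k)).inv.hom (Polynomial.evalRingHom a Polynomial.X) =
    (Spec.map (CommRingCat.ofHom (Polynomial.evalRingHom a))).appTop.hom (coord k) := h₂
  have h₄ : Polynomial.evalRingHom a Polynomial.X = a := by simp
  rw [h₄] at h₃
  rw [h₃]
  rfl

lemma line_hom_ext {g h : Z ⟶ line k} (hs : g ≫ lineStr k = h ≫ lineStr k)
    (hc : g.appTop.hom (coord k) = h.appTop.hom (coord k)) : g = h := by
  apply ext_to_Spec
  refine CommRingCat.hom_ext (Polynomial.ringHom_ext (fun c => ?_) hc)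
  have hn := Scheme.ΓSpecIso_inv_naturality (CommRingCat.ofHom (Polynomial.C (R := k)))
  have h₂ := congrArg (fun φ => CommRingCat.Hom.hom φ c) hn
  have h₃ : (Scheme.ΓSpecIso (.of (Polynomial k))).inv.hom (Polynomial.C c) =
    (lineStr k).appTop.hom ((Scheme.ΓSpecIso (.of k)).inv.hom c) := h₂
  change g.appTop.hom ((Scheme.ΓSpecIso (.of (Polynomial k))).inv.hom (Polynomial.C c)) =
    h.appTop.hom ((Scheme.ΓSpecIso (.of (Polynomial k))).inv.hom (Polynomial.C c))
  rw [h₃]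
  have h₄ := congrArg (fun φ : Z ⟶ Spec (.of k) =>
    φ.appTop.hom ((Scheme.ΓSpecIso (.of k)).inv.hom c)) hs
  exact h₄

variable {s}

/-- Vector fields on `S` lift to invariant vector fields on the affine line over `S`. -/
lemma exists_lift_toBase [PerfectField k] (p : ℕ) [Fact p.Prime] [CharP k p] {U : S.Opens}
    (D : VectorField s U) :
    ∃ D₁ : VectorField (toLine s) (toBase s ⁻¹ᵁ U), Related (toBase s) D₁ D := by
  have hc : toLine s ≫ lineStr k = toBase s ≫ s := pullback.condition
  obtain ⟨δ, h₁, h₂⟩ := ADer.exists_of_isPullback (IsPullback.of_hasPullback (lineStr k) s)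
    (Category.id_comp _) (Category.id_comp _) hc rfl
    ((0 : VectorField (toLine s) (toBase s ⁻¹ᵁ U)).along (toLine s)) (D.pull (toBase s) le_rfl)
    (by
      ext W' W hW hW' b
      rw [ADer.app_eq_zero_of_perfect p, ADer.app_eq_zero_of_perfect p])
  refine ⟨δ.toVectorField (toLine s) fun U' a W hW hU => ?_, ?_⟩
  · rw [h₁]; rfl
  · rw [related_iff le_rfl, ADer.toVectorField_along]
    exact h₂

/-- An invariant lift of `D` is tangent to each section `t = a`: it kills the functions from the
line, and along the section these become constants, which `D` kills too. -/
lemma related_sec {U : S.Opens} {D : VectorField s U}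
    {D₁ : VectorField (toLine s) (toBase s ⁻¹ᵁ U)} (h : Related (toBase s) D₁ D) (a : k)
    (hU : U ≤ sec s a ⁻¹ᵁ (toBase s ⁻¹ᵁ U)) : Related (sec s a) D D₁ := by
  refine related_of_isPullback (IsPullback.of_hasPullback (lineStr k) s) (sec_toLine s a)
    (sec_toBase s a) hU ?_ ?_
  · intro W' W₁ e hV₁ W hW hW' hW₁ b
    rw [D₁.map_base, map_zero]
    have i₁ : W ≤ s ⁻¹ᵁ ((Spec.map (CommRingCat.ofHom (Polynomial.evalRingHom a))) ⁻¹ᵁ W') :=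
      le_preimage_of_comp rfl hW'
    rw [← appLE_comp_eq (f := s) rfl le_rfl i₁ hW', D.map_base]
  · intro W' W₁ e hV₁ W hW hW' hW₁ b
    have i₁ : W ≤ W' := hW'
    have i₂ : W₁ ≤ toBase s ⁻¹ᵁ (W' ⊓ U) := le_inf_preimage e hV₁
    have i₃ : W ≤ W' ⊓ U := le_inf i₁ hW
    have i₄ : W' ⊓ U ≤ W' := inf_le_left
    rw [id_appLE _ i₁, ← appLE_res (toBase s) i₄ i₂, h _ inf_le_right,
      appLE_comp_eq (sec_toBase s a) i₂ hW₁ (le_preimage_id i₃), id_appLE _ i₃,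
      ← D.app_map i₃ inf_le_right, res_res]

end Line

lemma Related.app_appLE {X Y T T' : Scheme.{u}} {h : X ⟶ Y} {x : X ⟶ T} {y : Y ⟶ T'} {V : X.Opens}
    {V' : Y.Opens} {E : VectorField x V} {E' : VectorField y V'} (H : Related h E E')
    {W' W₁ : Y.Opens} (h₁ : W₁ ≤ W') (h₁' : W₁ ≤ V') {W : X.Opens} (hW : W ≤ V)
    (hWW' : W ≤ h ⁻¹ᵁ W') (hWW₁ : W ≤ h ⁻¹ᵁ W₁) (b : Γ(Y, W')) :
    E.app W hW ((h.appLE W' W hWW').hom b) =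
      (h.appLE W₁ W hWW₁).hom (E'.app W₁ h₁' (res Y h₁ b)) := by
  rw [← appLE_res h h₁ hWW₁, H W₁ h₁']

/-- Derivations along a morphism to an open subscheme are determined on the ambient scheme. -/
lemma ADer.ext_of_isOpenImmersion {Z Q A : Scheme.{u}} {n : Z ⟶ Q} {j : Q ⟶ A} [IsOpenImmersion j]
    {n₀ : Z ⟶ A} (hn : n ≫ j = n₀) {V : Z.Opens} {δ δ' : ADer n V}
    (h : δ.comp j n₀ hn = δ'.comp j n₀ hn) : δ = δ' := by
  ext W' W hW hW' b
  have i₁ := le_preimage_image j W'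
  have i₂ : W ≤ n₀ ⁻¹ᵁ (j ''ᵁ W') := preimage_comp_le hn hW' i₁
  rw [← appLE_push j W' i₁ b, ← δ.comp_app hn hW i₂ i₁ hW', ← δ'.comp_app hn hW i₂ i₁ hW', h]

/-! ### The `t`-connection where `t` is invertible, and integrability of `θ`. -/

namespace FontaineModule

variable {p : ℕ} [Fact p.Prime] {k : Type u} [Field k] [CharP k p] {S : Scheme.{u}}
  {s : S ⟶ Spec (.of k)} {L : FrobeniusLifting p s} (M : FontaineModule L)

/-- The coordinate of the base as a function on the total space of the filtration. -/
noncomputable def tcoord : Γ(M.total, ⊤) := (M.ft ≫ toLine s).appTop.hom (coord k)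

section Point

variable {Z : Scheme.{u}} {ι : Z ⟶ M.total} {a : (Γ(Z, ⊤))ˣ}
  (ha : (a : Γ(Z, ⊤)) * ι.appTop.hom M.tcoord = 1)

/-- The unit `a` is `t⁻¹`. Since the action multiplies `t` by `a`, the translate by `a` lies over `t
= 1`, so every such point can be moved into `X`. -/
lemma smul_ft (ha : (a : Γ(Z, ⊤)) * ι.appTop.hom M.tcoord = 1) :
    M.action.smul a ι ≫ M.ft = (ι ≫ M.ft ≫ toBase s) ≫ sec s 1 := by
  obtain ⟨h₁, h₂⟩ := M.covers a ι
  have hc : toLine s ≫ lineStr k = toBase s ≫ s := pullback.condition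
  apply pullback.hom_ext
  · change (M.action.smul a ι ≫ M.ft) ≫ toLine s = ((ι ≫ M.ft ≫ toBase s) ≫ sec s 1) ≫ toLine s
    have e : ((ι ≫ M.ft ≫ toBase s) ≫ sec s 1) ≫ toLine s = ((ι ≫ M.ft ≫ toBase s) ≫ s) ≫
        Spec.map (CommRingCat.ofHom (Polynomial.evalRingHom 1)) := by
      simp only [Category.assoc, sec_toLine]
    refine line_hom_ext ?_ ?_
    · simp only [Category.assoc, hc, reassoc_of% (sec_toBase s (1 : k)), reassoc_of% h₁]
    · rw [e, appTop_coord_eval, map_one, map_one, Category.assoc, h₂]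
      exact ha
  · change (M.action.smul a ι ≫ M.ft) ≫ toBase s = ((ι ≫ M.ft ≫ toBase s) ≫ sec s 1) ≫ toBase s
    rw [Category.assoc, h₁, Category.assoc, sec_toBase, Category.comp_id]

/-- The translate of a point of the total space to the fibre over `t = 1`. -/
noncomputable def toFibre (ha : (a : Γ(Z, ⊤)) * ι.appTop.hom M.tcoord = 1) : Z ⟶ M.X :=
  M.isPullback.lift (M.action.smul a ι) (ι ≫ M.ft ≫ toBase s) (M.smul_ft ha)

lemma toFibre_incl : M.toFibre ha ≫ M.incl = M.action.smul a ι := M.isPullback.lift_fst _ _ _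

lemma toFibre_f : M.toFibre ha ≫ M.f = ι ≫ M.ft ≫ toBase s := M.isPullback.lift_snd _ _ _

lemma str_comp : (M.ft ≫ toLine s) ≫ lineStr k = M.ft ≫ toBase s ≫ s := by
  rw [Category.assoc]
  exact congrArg (M.ft ≫ ·) pullback.condition

variable [IsOpenImmersion ι] {U : S.Opens}

/-- The restriction of `∇̃ D₁` to an open subscheme of the total space. -/
noncomputable def fieldOn (ι : Z ⟶ M.total) [IsOpenImmersion ι]
    (D₁ : VectorField (toLine s) (toBase s ⁻¹ᵁ U)) :
    VectorField (ι ≫ M.ft ≫ toBase s ≫ s) (ι ⁻¹ᵁ (M.ft ⁻¹ᵁ (toBase s ⁻¹ᵁ U))) :=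
  ((M.connT.toFun _ D₁).rebase (lineStr k) (M.ft ≫ toBase s ≫ s) M.str_comp).pullOpen ι le_rfl
    (e := 𝟙 _) (Category.comp_id _)

lemma related_fieldOn (D₁ : VectorField (toLine s) (toBase s ⁻¹ᵁ U)) :
    Related ι (M.fieldOn ι D₁) (M.connT.toFun _ D₁) :=
  VectorField.related_pullOpen ((M.connT.toFun _ D₁).rebase (lineStr k) (M.ft ≫ toBase s ≫ s)
    M.str_comp) ι le_rfl (e := 𝟙 _) (Category.comp_id _)

lemma fieldOn_line (D₁ : VectorField (toLine s) (toBase s ⁻¹ᵁ U)) (W hW) (W' : (line k).Opens)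
    (hW' : W ≤ (ι ≫ M.ft ≫ toLine s) ⁻¹ᵁ W') (b : Γ(line k, W')) :
    (M.fieldOn ι D₁).app W hW (((ι ≫ M.ft ≫ toLine s).appLE W' W hW').hom b) = 0 := by
  have i₁ : W ≤ ι ⁻¹ᵁ ((M.ft ≫ toLine s) ⁻¹ᵁ W') := le_preimage_of_comp rfl hW'
  have i₂ : (M.ft ≫ toLine s) ⁻¹ᵁ W' ⊓ M.ft ⁻¹ᵁ (toBase s ⁻¹ᵁ U) ≤ (M.ft ≫ toLine s) ⁻¹ᵁ W' :=
    inf_le_left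
  rw [← appLE_comp_eq (f := ι) rfl i₂ (le_inf_preimage i₁ hW) hW',
    M.related_fieldOn D₁ _ inf_le_right, VectorField.map_base, map_zero]

/-- The field is linear over the affine line and kills `t`, so differentiating `a t = 1` shows that
it kills `a`. Equivariance is available only for such `a`. -/
lemma fieldOn_unit (ha : (a : Γ(Z, ⊤)) * ι.appTop.hom M.tcoord = 1)
    (D₁ : VectorField (toLine s) (toBase s ⁻¹ᵁ U)) (W hW) :
    (M.fieldOn ι D₁).app W hW (res Z le_top (a : Γ(Z, ⊤))) = 0 := by
  have e : W ≤ (ι ≫ M.ft ≫ toLine s) ⁻¹ᵁ ⊤ := fun _ _ => trivial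
  have h₁ := M.fieldOn_line D₁ W hW ⊤ e (coord k)
  have h₂ : res Z (le_top : W ≤ ⊤) (ι.appTop.hom M.tcoord) =
      ((ι ≫ M.ft ≫ toLine s).appLE ⊤ W e).hom (coord k) := rfl
  rw [← h₂] at h₁
  have h₃ := congrArg (res Z (le_top : W ≤ ⊤)) ha
  rw [map_mul, map_one] at h₃
  have h₄ := (M.fieldOn ι D₁).leibniz W hW (res Z le_top (a : Γ(Z, ⊤)))
    (res Z le_top (ι.appTop.hom M.tcoord))
  rw [h₃, VectorField.app_one, h₁, mul_zero, zero_add] at h₄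
  have h₅ := congrArg (fun z => res Z (le_top : W ≤ ⊤) (a : Γ(Z, ⊤)) * z) h₄
  simp only [mul_zero, ← mul_assoc, h₃, one_mul] at h₅
  exact h₅.symm

/-- The field `t⁻¹ ∇̃ D₁`. -/
noncomputable def unitField (ι : Z ⟶ M.total) [IsOpenImmersion ι] (a : (Γ(Z, ⊤))ˣ)
    (D₁ : VectorField (toLine s) (toBase s ⁻¹ᵁ U)) :
    VectorField (ι ≫ M.ft ≫ toBase s ≫ s) (ι ⁻¹ᵁ (M.ft ⁻¹ᵁ (toBase s ⁻¹ᵁ U))) :=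
  res Z (le_top : ι ⁻¹ᵁ (M.ft ⁻¹ᵁ (toBase s ⁻¹ᵁ U)) ≤ ⊤) (a : Γ(Z, ⊤)) • M.fieldOn ι D₁

lemma unitField_app (D₁ : VectorField (toLine s) (toBase s ⁻¹ᵁ U)) (W hW b) :
    (M.unitField ι a D₁).app W hW b =
      res Z le_top (a : Γ(Z, ⊤)) * (M.fieldOn ι D₁).app W hW b := by
  rw [unitField, VectorField.smul_app, res_res]

/-- Equivariance says that translation by `a = t⁻¹` carries `t⁻¹ ∇̃ D₁` to `∇̃ D₁`. The translate
lies in the fibre over `t = 1`, where `∇̃` restricts to `∇`. -/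
lemma related_unitField {D : VectorField s U} {D₁ : VectorField (toLine s) (toBase s ⁻¹ᵁ U)}
    (hD : Related (toBase s) D₁ D) :
    Related (M.toFibre ha) (M.unitField ι a D₁) (M.conn.toFun U D) := by
  have hV : ι ⁻¹ᵁ (M.ft ⁻¹ᵁ (toBase s ⁻¹ᵁ U)) ≤ M.toFibre ha ⁻¹ᵁ (M.f ⁻¹ᵁ U) :=
    le_preimage_of_comp (M.toFibre_f ha) le_rfl
  have hact : Related (M.action.smul a ι) (M.unitField ι a D₁) (M.connT.toFun _ D₁) :=
    M.equivariant U D D₁ hD a ι _ (M.fieldOn ι D₁) le_rfl (M.related_fieldOn D₁)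
      (fun W hW => M.fieldOn_unit ha D₁ W hW)
  have hU : U ≤ sec s (1 : k) ⁻¹ᵁ (toBase s ⁻¹ᵁ U) := le_preimage_of_comp (sec_toBase s 1) le_rfl
  have hincl : Related M.incl (M.conn.toFun U D) (M.connT.toFun _ D₁) :=
    M.extends_conn _ U hU D₁ D (related_sec hD 1 hU)
  refine related_of_isPullback M.isPullback (M.toFibre_incl ha) (M.toFibre_f ha) hV ?_ ?_
  · intro W' W₁ e hV₁ W hW hW' hW₁ b
    have i : M.f ⁻¹ᵁ U ≤ M.incl ⁻¹ᵁ (M.ft ⁻¹ᵁ (toBase s ⁻¹ᵁ U)) := by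
      refine le_preimage_of_comp M.isPullback.w ?_
      exact preimage_comp_le rfl le_rfl hU
    have j₁ : W' ⊓ M.ft ⁻¹ᵁ (toBase s ⁻¹ᵁ U) ≤ W' := inf_le_left
    have j₂ : W' ⊓ M.ft ⁻¹ᵁ (toBase s ⁻¹ᵁ U) ≤ M.ft ⁻¹ᵁ (toBase s ⁻¹ᵁ U) := inf_le_right
    have j₃ : W₁ ≤ M.incl ⁻¹ᵁ (W' ⊓ M.ft ⁻¹ᵁ (toBase s ⁻¹ᵁ U)) := le_inf_preimage e (hV₁.trans i)
    have j₄ : W ≤ M.action.smul a ι ⁻¹ᵁ (W' ⊓ M.ft ⁻¹ᵁ (toBase s ⁻¹ᵁ U)) :=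
      preimage_comp_le (M.toFibre_incl ha) hW₁ j₃
    rw [hact.app_appLE j₁ j₂ hW hW' j₄, hincl.app_appLE j₁ j₂ hV₁ e j₃,
      appLE_comp_eq (M.toFibre_incl ha) j₃ hW₁ j₄]
  · intro W' W₁ e hV₁ W hW hW' hW₁ b
    have j₀ : W' ⊓ U ≤ W' := inf_le_left
    have jU : W' ⊓ U ≤ U := inf_le_right
    have j₁ : W₁ ≤ M.f ⁻¹ᵁ (W' ⊓ U) := le_inf_preimage e hV₁
    have j₂ : W ≤ (ι ≫ M.ft ≫ toBase s) ⁻¹ᵁ (W' ⊓ U) := le_inf_preimage hW' hW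
    have j₃ : M.ft ⁻¹ᵁ (toBase s ⁻¹ᵁ (W' ⊓ U)) ≤ (M.ft ≫ toBase s) ⁻¹ᵁ (W' ⊓ U) :=
      preimage_comp_le rfl le_rfl le_rfl
    have j₄ : W ≤ ι ⁻¹ᵁ (M.ft ⁻¹ᵁ (toBase s ⁻¹ᵁ (W' ⊓ U))) := le_preimage_of_comp rfl j₂
    have j₅ : M.ft ⁻¹ᵁ (toBase s ⁻¹ᵁ (W' ⊓ U)) ≤ M.ft ⁻¹ᵁ (toBase s ⁻¹ᵁ U) :=
      M.ft.preimage_mono ((toBase s).preimage_mono jU)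
    have ej : ∀ c : Γ(S, W' ⊓ U), ((ι ≫ M.ft ≫ toBase s).appLE (W' ⊓ U) W j₂).hom c =
        (ι.appLE _ W j₄).hom ((M.ft.appLE (toBase s ⁻¹ᵁ (W' ⊓ U)) _ le_rfl).hom
          (((toBase s).appLE (W' ⊓ U) _ le_rfl).hom c)) := fun c => by
      rw [appLE_appLE, appLE_appLE]
      exact appLE_congr_hom (Category.assoc _ _ _).symm _ _
    rw [← appLE_res M.f j₀ j₁, M.conn.proj U D _ jU W₁ hV₁ j₁, map_one, one_mul,
      appLE_comp_eq (M.toFibre_f ha) j₁ hW₁ j₂, ← appLE_res (ι ≫ M.ft ≫ toBase s) j₀ j₂,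
      M.unitField_app, ej, ej, M.related_fieldOn D₁ _ j₅,
      M.connT.proj _ D₁ _ ((toBase s).preimage_mono jU) _ j₅ le_rfl,
      hD _ jU _ ((toBase s).preimage_mono jU) le_rfl, map_mul, ← mul_assoc]
    -- On functions from `S` a `t`-connection acts as `t D`; the factor `a` cancels `t`, and what
    -- remains is the action of a `1`-connection.
    have h₁ := congrArg (res Z (le_top : W ≤ ⊤)) ha
    rw [map_mul, map_one] at h₁
    have h₂ : (ι.appLE _ W j₄).hom (((M.ft ≫ toLine s).appLE ⊤ _ le_top).hom (coord k)) =
        res Z (le_top : W ≤ ⊤) (ι.appTop.hom M.tcoord) := by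
      have e₁ : W ≤ (ι ≫ M.ft ≫ toLine s) ⁻¹ᵁ ⊤ := fun _ _ => trivial
      have e₂ : M.ft ⁻¹ᵁ (toBase s ⁻¹ᵁ (W' ⊓ U)) ≤ (M.ft ≫ toLine s) ⁻¹ᵁ ⊤ := fun _ _ => trivial
      exact (appLE_appLE ι (M.ft ≫ toLine s) e₂ j₄ (coord k))
    rw [h₂, h₁, one_mul]

/-- Vector fields on `Z` that agree on functions from `X` and from the affine line are equal. -/
lemma app_eq_of_toFibre (ha : (a : Γ(Z, ⊤)) * ι.appTop.hom M.tcoord = 1) {T T' : Scheme.{u}}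
    {z : Z ⟶ T} {z' : Z ⟶ T'} {V : Z.Opens} {E : VectorField z V} {E' : VectorField z' V}
    (h₁ : E.along (M.toFibre ha) = E'.along (M.toFibre ha))
    (h₂ : E.along (ι ≫ M.ft ≫ toLine s) = E'.along (ι ≫ M.ft ≫ toLine s)) (W : Z.Opens)
    (hW : W ≤ V) (b : Γ(Z, W)) : E.app W hW b = E'.app W hW b := by
  -- The open `Q` of the affine line over `X` where the coordinate is invertible is `𝔾ₘ × X`. The
  -- morphism `n` has components `t` and `toFibre`, and `m` is the action `(t, x) ↦ t x`. Since
  -- `toFibre` is translation by `t⁻¹`, the composite of `n` and `m` is `ι`, so functions on `Z`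
  -- come from those on `𝔾ₘ × X`.
  let x := M.f ≫ s
  let c : Γ(A1 x, ⊤) := (toLine x).appTop.hom (coord k)
  let Q := (A1 x).basicOpen c
  have hcomm : (ι ≫ M.ft ≫ toLine s) ≫ lineStr k = M.toFibre ha ≫ x := by
    rw [Category.assoc, M.str_comp, ← Category.assoc (M.toFibre ha), M.toFibre_f ha]
    simp only [Category.assoc]
  let n₀ : Z ⟶ A1 x := pullback.lift (ι ≫ M.ft ≫ toLine s) (M.toFibre ha) hcomm
  have hn₀ : n₀ ≫ toLine x = ι ≫ M.ft ≫ toLine s := pullback.lift_fst _ _ _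
  have hn₀' : n₀ ≫ toBase x = M.toFibre ha := pullback.lift_snd _ _ _
  have hc : n₀.appTop.hom c = ι.appTop.hom M.tcoord :=
    congrArg (fun φ : Z ⟶ line k => φ.appTop.hom (coord k)) hn₀
  have hunit : IsUnit (n₀.appTop.hom c) := by
    rw [hc]
    exact IsUnit.of_mul_eq_one_right _ ha
  have hQ : n₀ ⁻¹ᵁ Q = ⊤ := by
    rw [Scheme.Hom.preimage_basicOpen_top]
    exact Scheme.basicOpen_of_isUnit _ hunit
  have hrange : Set.range n₀ ⊆ Set.range Q.ι := by
    rw [Scheme.Opens.range_ι]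
    rintro _ ⟨y, rfl⟩
    have : y ∈ n₀ ⁻¹ᵁ Q := hQ ▸ trivial
    exact this
  let n := IsOpenImmersion.lift Q.ι n₀ hrange
  have hn : n ≫ Q.ι = n₀ := IsOpenImmersion.lift_fac _ _ _
  have hu : IsUnit (Q.ι.appTop.hom c) := by
    have e : (⊤ : Q.toScheme.Opens) ≤ Q.ι ⁻¹ᵁ Q := fun y _ => y.2
    have := ((A1 x).toRingedSpace.isUnit_res_basicOpen c).map (Q.ι.appLE Q ⊤ e).hom
    have h : (Q.ι.appLE Q ⊤ e).hom (res (A1 x) ((A1 x).basicOpen_le c) c) = Q.ι.appTop.hom c := by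
      rw [appLE_res]
      exact congrArg (fun φ => CommRingCat.Hom.hom φ c) Q.ι.app_eq_appLE.symm
    rw [← h]
    exact this
  let m : Q.toScheme ⟶ M.total := M.action.smul hu.unit (Q.ι ≫ toBase x ≫ M.incl)
  have hm : n ≫ m = ι := by
    rw [M.action.naturality, reassoc_of% hn, reassoc_of% hn₀', M.toFibre_incl, ← M.action.mul_smul]
    have : Units.map n.appTop.hom.toMonoidHom hu.unit * a = 1 := by
      ext
      have h : n.appTop.hom (Q.ι.appTop.hom c) = ι.appTop.hom M.tcoord := by
        rw [← hc]
        exact congrArg (fun φ : Z ⟶ A1 x => φ.appTop.hom c) hn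
      change n.appTop.hom (Q.ι.appTop.hom c) * a = 1
      rw [h, mul_comm, ha]
    rw [this, M.action.one_smul]
  have hE : E.along n = E'.along n := by
    refine ADer.ext_of_isOpenImmersion hn ?_
    rw [VectorField.along_comp, VectorField.along_comp]
    refine ADer.ext_of_isPullback (IsPullback.of_hasPullback (lineStr k) x) hn₀ hn₀' ?_ ?_
    · rw [VectorField.along_comp, VectorField.along_comp, h₂]
    · rw [VectorField.along_comp, VectorField.along_comp, h₁]
  have hE' : E.along ι = E'.along ι := by
    rw [← E.along_comp n m ι hm, ← E'.along_comp n m ι hm, hE]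
  have i₁ := le_preimage_image ι W
  have := congrArg (fun d : ADer ι V => d.app (ι ''ᵁ W) W hW i₁ (push ι W b)) hE'
  simp only [VectorField.along_app, appLE_push] at this
  exact this

/-- Integrability of the `t`-connection where `t` is invertible. -/
lemma fieldOn_bracket (ha : (a : Γ(Z, ⊤)) * ι.appTop.hom M.tcoord = 1) {D E : VectorField s U}
    {D₁ E₁ : VectorField (toLine s) (toBase s ⁻¹ᵁ U)} (hD : Related (toBase s) D₁ D)
    (hE : Related (toBase s) E₁ E) (W hW b) :
    ((M.fieldOn ι D₁).bracket (M.fieldOn ι E₁)).app W hW b =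
      res Z le_top (ι.appTop.hom M.tcoord) * (M.fieldOn ι (D₁.bracket E₁)).app W hW b := by
  have hV : ι ⁻¹ᵁ (M.ft ⁻¹ᵁ (toBase s ⁻¹ᵁ U)) ≤ M.toFibre ha ⁻¹ᵁ (M.f ⁻¹ᵁ U) :=
    le_preimage_of_comp (M.toFibre_f ha) le_rfl
  have hline : ∀ (D₁ : VectorField (toLine s) (toBase s ⁻¹ᵁ U)) (W hW) (W' : (line k).Opens)
    (hW' : W ≤ (ι ≫ M.ft ≫ toLine s) ⁻¹ᵁ W') (b : Γ(line k, W')),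
    (M.unitField ι a D₁).app W hW (((ι ≫ M.ft ≫ toLine s).appLE W' W hW').hom b) = 0 :=
    fun D₁ W hW W' hW' b => by rw [unitField_app, fieldOn_line, mul_zero]
  -- For the fields `t⁻¹ ∇̃` ordinary integrability holds: on functions from `X` it is that of `∇`,
  -- and functions from the affine line are killed by all three fields.
  have key := M.app_eq_of_toFibre ha (E := (M.unitField ι a D₁).bracket (M.unitField ι a E₁))
    (E' := M.unitField ι a (D₁.bracket E₁)) (by
      have h₁ := (M.related_unitField ha hD).bracket (M.related_unitField ha hE)
      have h₂ := M.related_unitField ha (hD.bracket hE)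
      have h₃ : Related (M.toFibre ha) ((M.unitField ι a D₁).bracket (M.unitField ι a E₁))
          (M.conn.toFun U (D.bracket E)) := fun W' hW' W hW hWW' b => by
        rw [h₁ W' hW' W hW hWW', M.integrable, map_one, one_mul]
      rw [(related_iff hV).mp h₂, (related_iff hV).mp h₃]) (by
      ext W W' hW hW' b
      rw [VectorField.along_app, VectorField.along_app, VectorField.bracket_app, hline, hline,
        hline, VectorField.app_zero, VectorField.app_zero, sub_zero]) W hW b
  have h₁ := congrArg (res Z (le_top : W ≤ ⊤)) ha
  rw [map_mul, map_one] at h₁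
  have hu : IsUnit (res Z (le_top : W ≤ ⊤) (a : Γ(Z, ⊤))) := a.isUnit.map _
  rw [VectorField.bracket_app, unitField_app, unitField_app, unitField_app, unitField_app,
    unitField_app, VectorField.leibniz, VectorField.leibniz, M.fieldOn_unit ha, M.fieldOn_unit ha,
    mul_zero, mul_zero, add_zero, add_zero] at key
  rw [VectorField.bracket_app]
  -- As `a` is killed, it comes out of the bracket twice but occurs once on the other side.
  -- Cancelling `a ^ 2` leaves the factor `a⁻¹ = t`.
  refine hu.mul_left_cancel (hu.mul_left_cancel ?_)
  linear_combination key - res Z (le_top : W ≤ ⊤) (a : Γ(Z, ⊤)) *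
    (M.fieldOn ι (D₁.bracket E₁)).app W hW b * h₁

end Point

/-- Integrability of the `t`-connection on invariant vector fields. -/
lemma connT_bracket [Flat s] {U : S.Opens} {D E : VectorField s U}
    {D₁ E₁ : VectorField (toLine s) (toBase s ⁻¹ᵁ U)} (hD : Related (toBase s) D₁ D)
    (hE : Related (toBase s) E₁ E) (W hW b) :
    ((M.connT.toFun _ D₁).bracket (M.connT.toFun _ E₁)).app W hW b =
      res M.total le_top M.tcoord * (M.connT.toFun _ (D₁.bracket E₁)).app W hW b := by
  have := M.flat_ft
  rw [← sub_eq_zero]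
  set Δ := ((M.connT.toFun _ D₁).bracket (M.connT.toFun _ E₁)).app W hW b -
    res M.total le_top M.tcoord * (M.connT.toFun _ (D₁.bracket E₁)).app W hW b with hΔ
  refine section_ext fun x hx => ?_
  obtain ⟨P, hP, hxP, hPW⟩ := exists_isAffineOpen_mem_and_subset (X := M.total) (x := x)
    (U := W) hx
  have hPW : P ≤ W := hPW
  refine ⟨P, hPW, hxP, ?_⟩
  rw [map_zero]
  let τ : Γ(M.total, P) := res M.total le_top M.tcoord
  -- The total space is flat over the affine line over `S`, which is flat over the affine line over
  -- `k`. Hence `t` remains a nonzerodivisor.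
  have hτ : ∀ y, τ * y = 0 → y = 0 := by
    intro y hy
    have e : P ≤ (M.ft ≫ toLine s) ⁻¹ᵁ ⊤ := fun _ _ => trivial
    have hfl := Scheme.Hom.flat_appLE (M.ft ≫ toLine s) (isAffineOpen_top _) hP e
    refine map_eq_zero_of_flat ((M.ft ≫ toLine s).appLE ⊤ P e).hom hfl (RingHom.id _) (coord k)
      (fun c hc => ?_) hy
    have : c = 0 := by
      obtain ⟨c, rfl⟩ := (ConcreteCategory.bijective_of_isIso
        (Scheme.ΓSpecIso (.of (Polynomial k))).inv).2 c
      have h₁ : (Scheme.ΓSpecIso (.of (Polynomial k))).inv.hom (Polynomial.X * c) =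
          (Scheme.ΓSpecIso (.of (Polynomial k))).inv.hom 0 := by
        rw [map_mul, map_zero]; exact hc
      have h₂ := (ConcreteCategory.bijective_of_isIso
        (Scheme.ΓSpecIso (.of (Polynomial k))).inv).1 h₁
      have h₃ : c = 0 := (mul_eq_zero.mp h₂).resolve_left Polynomial.X_ne_zero
      rw [h₃]
      exact map_zero (Scheme.ΓSpecIso (.of (Polynomial k))).inv.hom
    rw [this, map_zero, map_zero]
  let Q := M.total.basicOpen τ
  have hQP : Q ≤ P := M.total.basicOpen_le τ
  -- On the open subscheme where `t` is invertible the defect `Δ` vanishes by the translation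
  -- argument, with `a = t⁻¹`.
  have hQ : res M.total (hQP.trans hPW) Δ = 0 := by
    let Z := M.total.basicOpen M.tcoord
    have hQZ : Q ≤ Z := by
      have : Q = P ⊓ Z := M.total.basicOpen_res M.tcoord (homOfLE le_top).op
      rw [this]; exact inf_le_right
    have hu : IsUnit (Z.ι.appTop.hom M.tcoord) := by
      have e : (⊤ : Z.toScheme.Opens) ≤ Z.ι ⁻¹ᵁ Z := fun y _ => y.2
      have := (M.total.toRingedSpace.isUnit_res_basicOpen M.tcoord).map (Z.ι.appLE Z ⊤ e).hom
      have h : (Z.ι.appLE Z ⊤ e).hom (res M.total (M.total.basicOpen_le M.tcoord) M.tcoord) =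
          Z.ι.appTop.hom M.tcoord := by
        rw [appLE_res]
        exact congrArg (fun φ => CommRingCat.Hom.hom φ M.tcoord) Z.ι.app_eq_appLE.symm
      rw [← h]
      exact this
    have ha : ((hu.unit⁻¹ : (Γ(Z, ⊤))ˣ) : Γ(Z, ⊤)) * Z.ι.appTop.hom M.tcoord = 1 :=
      hu.val_inv_mul
    have iW : Z.ι ⁻¹ᵁ Q ≤ Z.ι ⁻¹ᵁ W := Z.ι.preimage_mono (hQP.trans hPW)
    have h := M.fieldOn_bracket ha hD hE (Z.ι ⁻¹ᵁ Q) (iW.trans (Z.ι.preimage_mono hW))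
      ((Z.ι.appLE W _ iW).hom b)
    have r₁ := (M.related_fieldOn (ι := Z.ι) D₁).bracket (M.related_fieldOn E₁) W hW (Z.ι ⁻¹ᵁ Q)
      (iW.trans (Z.ι.preimage_mono hW)) iW b
    have r₂ := M.related_fieldOn (ι := Z.ι) (D₁.bracket E₁) W hW (Z.ι ⁻¹ᵁ Q)
      (iW.trans (Z.ι.preimage_mono hW)) iW b
    have r₃ : res Z (le_top : Z.ι ⁻¹ᵁ Q ≤ ⊤) (Z.ι.appTop.hom M.tcoord) =
        (Z.ι.appLE W _ iW).hom (res M.total le_top M.tcoord) := by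
      rw [appLE_res]
      exact (congrArg (res Z (le_top : Z.ι ⁻¹ᵁ Q ≤ ⊤))
        (congrArg (fun φ => CommRingCat.Hom.hom φ M.tcoord) Z.ι.app_eq_appLE)).trans
          (res_appLE Z.ι _ _ _)
    rw [r₁, r₂, r₃, ← map_mul, ← sub_eq_zero, ← map_sub, ← hΔ] at h
    have h' : (Z.ι.appLE Q (Z.ι ⁻¹ᵁ Q) le_rfl).hom (res M.total (hQP.trans hPW) Δ) = 0 := by
      rw [appLE_res]; exact h
    have him : Z.ι ''ᵁ (Z.ι ⁻¹ᵁ Q) = Q := by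
      rw [Scheme.Hom.image_preimage_eq_opensRange_inf, Scheme.Opens.opensRange_ι]
      exact inf_eq_right.mpr hQZ
    have h'' := push_appLE Z.ι (W := Z.ι ⁻¹ᵁ Q) le_rfl him.le (res M.total (hQP.trans hPW) Δ)
    rw [h', map_zero] at h''
    have h₃ := congrArg (res M.total him.ge) h''
    rw [map_zero, res_res, res_self] at h₃
    exact h₃.symm
  -- On an affine open, vanishing where `t` is invertible means that a power of `t` kills `Δ`; this
  -- power can be cancelled.
  obtain ⟨n, hn⟩ := exists_pow_mul_eq_zero_of_res_basicOpen_eq_zero_of_isAffineOpen M.total hP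
    (res M.total hPW Δ) τ (by
      refine Eq.trans ?_ hQ
      exact res_res hPW hQP Δ)
  induction n with
  | zero => rwa [pow_zero, one_mul] at hn
  | succ n ih =>
    rw [pow_succ', mul_assoc] at hn
    exact ih (hτ _ hn)

/-- The Higgs field `θ` is integrable. -/
theorem integrable_θ [PerfectField k] [Flat s] : M.θ.Integrable := by
  intro U D E W hW b
  obtain ⟨D₁, hD⟩ := exists_lift_toBase p D
  obtain ⟨E₁, hE⟩ := exists_lift_toBase p E
  have hU : U ≤ sec s (0 : k) ⁻¹ᵁ (toBase s ⁻¹ᵁ U) := le_preimage_of_comp (sec_toBase s 0) le_rfl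
  have rD := M.isBaseChange_θ _ U hU D₁ D (related_sec hD 0 hU)
  have rE := M.isBaseChange_θ _ U hU E₁ E (related_sec hE 0 hU)
  have hV : M.f₀ ⁻¹ᵁ U ≤ pullback.fst M.ft (sec s 0) ⁻¹ᵁ (M.ft ⁻¹ᵁ (toBase s ⁻¹ᵁ U)) :=
    le_preimage_of_comp pullback.condition (preimage_comp_le rfl le_rfl hU)
  rw [map_zero, zero_mul]
  refine (VectorField.app_eq_of_isPullback (IsPullback.of_hasPullback M.ft (sec s 0))
    (E' := (0 : VectorField (M.f₀ ≫ s) (M.f₀ ⁻¹ᵁ U))) ?_ ?_ W hW b).trans rfl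
  · rw [(related_iff hV).mp (rD.bracket rE)]
    ext W' W hW hW' b
    rw [VectorField.along_app, VectorField.zero_app]
    have i₁ : W' ⊓ M.ft ⁻¹ᵁ (toBase s ⁻¹ᵁ U) ≤ W' := inf_le_left
    have i₂ : W ≤ pullback.fst M.ft (sec s 0) ⁻¹ᵁ (W' ⊓ M.ft ⁻¹ᵁ (toBase s ⁻¹ᵁ U)) :=
      le_inf_preimage hW' (hW.trans hV)
    rw [VectorField.pull_app _ _ hV _ _ _ _ _ _ i₁ inf_le_right i₂, M.connT_bracket hD hE, map_mul,
      appLE_res]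
    have e₁ : W ≤ pullback.fst M.ft (sec s 0) ⁻¹ᵁ ⊤ := fun _ _ => trivial
    have e₂ : (⊤ : M.total.Opens) ≤ (M.ft ≫ toLine s) ⁻¹ᵁ ⊤ := fun _ _ => trivial
    -- The factor `t` in the integrability identity vanishes on the fibre over `t = 0`, so the
    -- bracket kills all functions from the total space.
    have h₀ : ((pullback.fst M.ft (sec s 0)).appLE ⊤ W e₁).hom M.tcoord = 0 := by
      have hc : pullback.fst M.ft (sec s 0) ≫ M.ft ≫ toLine s = (M.f₀ ≫ s) ≫
          Spec.map (CommRingCat.ofHom (Polynomial.evalRingHom 0)) := by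
        rw [Category.assoc, ← sec_toLine s 0, ← Category.assoc, pullback.condition, Category.assoc]
      have h₁ := appTop_coord_eval (M.f₀ ≫ s) (0 : k)
      rw [← hc, map_zero, map_zero] at h₁
      have h₂ := congrArg (res M.X₀ (le_top : W ≤ ⊤)) h₁
      rw [map_zero] at h₂
      refine Eq.trans ?_ h₂
      rfl
    rw [h₀, zero_mul]
  · ext W' W hW hW' b
    have i₀ : W' ⊓ U ≤ W' := inf_le_left
    have i₁ : W' ⊓ U ≤ U := inf_le_right
    have i₂ : W ≤ M.f₀ ⁻¹ᵁ (W' ⊓ U) := le_inf_preimage hW' hW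
    have h : ∀ (D : VectorField s U), (M.θ.toFun U D).app W hW ((M.f₀.appLE W' W hW').hom b) = 0 :=
      fun D => by
        rw [← appLE_res M.f₀ i₀ i₂, M.θ.proj U D _ i₁ W hW i₂, map_zero, zero_mul]
    rw [VectorField.along_app, VectorField.along_app, VectorField.zero_app,
      VectorField.bracket_app, h, h, VectorField.app_zero, VectorField.app_zero, sub_zero]

end FontaineModule

/-! ### Images of varieties under integral dominant morphisms -/

section Image

/-- The **Artin–Tate lemma** for ring homomorphisms. -/
lemma finiteType_of_finite_of_comp {A B C : Type*} [CommRing A] [CommRing B] [CommRing C]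
    [IsNoetherianRing A] (f : A →+* B) (g : B →+* C) (hgf : (g.comp f).FiniteType)
    (hg : g.Finite) (hi : Function.Injective g) : f.FiniteType := by
  algebraize [f, g, g.comp f]
  exact ⟨fg_of_fg_of_fg A B C hgf.1 hg.1 hi⟩

variable {k : Type u} [Field k] {X Y : Scheme.{u}} (φ : X ⟶ Y) (y : Y ⟶ Spec (.of k))

/-- The morphism `φ` followed by the diagonal of `Y` equals the diagonal of `X` followed by `φ × φ`,
a composite of universally closed morphisms. As `φ` is surjective, the diagonal of `Y` has closed
image. -/
lemma isSeparated_of_universallyClosed_surjective {T : Scheme.{u}} (y : Y ⟶ T)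
    [UniversallyClosed φ] [Surjective φ] [IsSeparated (φ ≫ y)] : IsSeparated y := by
  have hmap : UniversallyClosed (pullback.map (φ ≫ y) (φ ≫ y) y y φ φ (𝟙 _)
      (Category.comp_id _) (Category.comp_id _)) :=
    MorphismProperty.pullbackMap (P := @UniversallyClosed) ‹_› ‹_› rfl rfl
  have hcomp : φ ≫ pullback.diagonal y = pullback.diagonal (φ ≫ y) ≫
      pullback.map (φ ≫ y) (φ ≫ y) y y φ φ (𝟙 _) (Category.comp_id _) (Category.comp_id _) := by
    refine pullback.hom_ext ?_ ?_
    · rw [Category.assoc, Category.assoc, pullback.diagonal_fst, pullback.map, pullback.lift_fst,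
        pullback.diagonal_fst_assoc, Category.comp_id]
    · rw [Category.assoc, Category.assoc, pullback.diagonal_snd, pullback.map, pullback.lift_snd,
        pullback.diagonal_snd_assoc, Category.comp_id]
  have : UniversallyClosed (φ ≫ pullback.diagonal y) := by
    rw [hcomp]
    infer_instance
  have := UniversallyClosed.of_comp_surjective φ (pullback.diagonal y)
  exact ⟨.of_isPreimmersion _ (pullback.diagonal y).isClosedMap.isClosed_range⟩

/-- An integral homomorphism of finite type is finite, and scheme-theoretic dominance makes it
injective on sections. The Artin–Tate lemma over the Noetherian base then applies. -/
lemma locallyOfFiniteType_of_isIntegralHom [IsIntegralHom φ] [IsSchemeTheoreticallyDominant φ]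
    {T : Scheme.{u}} [IsLocallyNoetherian T] (y : Y ⟶ T) [LocallyOfFiniteType (φ ≫ y)] :
    LocallyOfFiniteType y := by
  refine ⟨fun {U} hU {V} hV e => ?_⟩
  have : IsNoetherianRing Γ(T, U) := IsLocallyNoetherian.component_noetherian ⟨U, hU⟩
  have h1 : ((φ.app V).hom.comp (y.appLE U V e).hom).FiniteType := by
    have h := (φ ≫ y).finiteType_appLE hU (hV.preimage φ) (φ.preimage_mono e)
    have h2 : (φ ≫ y).appLE U (φ ⁻¹ᵁ V) (φ.preimage_mono e) = y.appLE U V e ≫ φ.app V := by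
      rw [Scheme.Hom.app_eq_appLE, Scheme.Hom.appLE_comp_appLE]
    rwa [h2, CommRingCat.hom_comp] at h
  have h2 : (φ.app V).hom.FiniteType := h1.of_comp_finiteType
  exact finiteType_of_finite_of_comp _ _ h1 ((φ.isIntegral_app V hV).to_finite h2)
    (φ.app_injective V)

lemma quasiCompact_of_surjective {T : Scheme.{u}} (y : Y ⟶ T) [Surjective φ]
    [QuasiCompact (φ ≫ y)] : QuasiCompact y := by
  refine ⟨fun U hU hc => ?_⟩
  have h := QuasiCompact.isCompact_preimage (f := φ ≫ y) U hU hc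
  have h' : φ '' ((φ ≫ y) ⁻¹' U) = y ⁻¹' U := by
    have : ((φ ≫ y) ⁻¹' U : Set X) = φ ⁻¹' (y ⁻¹' U) := by
      ext x
      simp
    rw [this, Set.image_preimage_eq _ φ.surjective]
  rw [← h']
  exact h.image φ.continuous

/-- The image of a variety under an integral, surjective, scheme-theoretically dominant morphism is
a variety. -/
lemma IsVariety.of_isIntegralHom [IsIntegralHom φ] [Surjective φ]
    [IsSchemeTheoreticallyDominant φ] (h : IsVariety (φ ≫ y)) : IsVariety y := by
  have := h.isIntegral
  have := h.isSeparated
  have := h.locallyOfFiniteType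
  have := h.quasiCompact
  have := IsSchemeTheoreticallyDominant.isReduced φ
  have : IrreducibleSpace Y := φ.surjective.irreducibleSpace φ.continuous
  exact ⟨isIntegral_of_irreducibleSpace_of_isReduced _,
    isSeparated_of_universallyClosed_surjective φ y,
    locallyOfFiniteType_of_isIntegralHom φ y, quasiCompact_of_surjective φ y⟩

lemma IsVariety.comp_isIso {y : Y ⟶ Spec (.of k)} (h : IsVariety y)
    (e : Spec (.of k) ⟶ Spec (.of k)) [IsIso e] : IsVariety (y ≫ e) := by
  have := h.isIntegral
  have := h.isSeparated
  have := h.locallyOfFiniteType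
  have := h.quasiCompact
  exact ⟨h.isIntegral, inferInstance, inferInstance, inferInstance⟩

lemma IsVariety.of_comp_isIso {y : Y ⟶ Spec (.of k)} (e : Spec (.of k) ⟶ Spec (.of k)) [IsIso e]
    (h : IsVariety (y ≫ e)) : IsVariety y := by
  have := h.comp_isIso (inv e)
  rwa [Category.assoc, IsIso.hom_inv_id, Category.comp_id] at this

lemma IsVariety.isIso_comp {y : Y ⟶ Spec (.of k)} (h : IsVariety y) [IsIso φ] :
    IsVariety (φ ≫ y) := by
  have := h.isIntegral
  have := h.isSeparated
  have := h.locallyOfFiniteType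
  have := h.quasiCompact
  have : Nonempty X := ⟨(inv φ : Y ⟶ X) (Classical.arbitrary Y)⟩
  exact ⟨isIntegral_of_isOpenImmersion φ, inferInstance, inferInstance, inferInstance⟩

end Image

/-! ### Geometric properties of the absolute Frobenius. -/

section Frobenius

variable (p : ℕ) [Fact p.Prime] {k : Type u} [Field k] [CharP k p] {S : Scheme.{u}}
  (s : S ⟶ Spec (.of k))

lemma isIntegralHom_frob : IsIntegralHom (frob p s) where
  isAffine_preimage U hU := hU
  isIntegral_app U _ b := by
    refine ⟨Polynomial.X ^ p - Polynomial.C (show Γ(S, U) from b),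
      Polynomial.monic_X_pow_sub_C _ (Fact.out : p.Prime).ne_zero, ?_⟩
    rw [Polynomial.eval₂_sub, Polynomial.eval₂_X_pow, Polynomial.eval₂_C, sub_eq_zero]
    rfl

lemma surjective_frob : Surjective (frob p s) := ⟨fun x => ⟨x, rfl⟩⟩

/-- A base change of the Frobenius morphism of a reduced scheme along a flat morphism is
scheme-theoretically dominant. -/
lemma isSchemeTheoreticallyDominant_of_isPullback_frob [IsReduced S] {X Y : Scheme.{u}}
    {φ : X ⟶ Y} {f : X ⟶ S} {g : Y ⟶ S} [Flat g] (H : IsPullback φ f g (frob p s)) :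
    IsSchemeTheoreticallyDominant φ := by
  have := isIntegralHom_frob p s
  have := surjective_frob p s
  -- On a reduced scheme dominance already implies scheme-theoretic dominance, and the latter
  -- survives flat base change.
  have : IsSchemeTheoreticallyDominant (frob p s) := .of_isDominant _
  exact IsSchemeTheoreticallyDominant.of_isPullback H.flip

end Frobenius

/-! ### `X₀` and its Frobenius twist are varieties. -/

namespace FontaineModule

variable {p : ℕ} [Fact p.Prime] {k : Type u} [Field k] [CharP k p] {S : Scheme.{u}}
  {s : S ⟶ Spec (.of k)} {L : FrobeniusLifting p s} (M : FontaineModule L)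

lemma isPullback_φ : IsPullback M.φ M.f M.f₀ (frob p s) := by
  have := M.isIso_φ
  exact IsPullback.of_iso_pullback ⟨M.φ_comm⟩
    (asIso (pullback.lift (f := M.f₀) (g := frob p s) M.φ M.f M.φ_comm))
    (pullback.lift_fst _ _ _) (pullback.lift_snd _ _ _)

/-- The morphism `φ` from the variety `X` is the base change of `F_S` along the flat morphism `f₀`.
It is therefore integral, surjective and scheme-theoretically dominant, and the properties of a
variety descend. -/
lemma isVariety_f₀ [PerfectField k] (hS : IsVariety s) : IsVariety (M.f₀ ≫ s) := by
  have := hS.isIntegral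
  have := isIntegralHom_frob p s
  have := surjective_frob p s
  have := M.flat_ft
  have := isIso_specFrob k p
  have : Flat M.f₀ := inferInstance
  have H := M.isPullback_φ
  have := isSchemeTheoreticallyDominant_of_isPullback_frob p s H
  have : IsIntegralHom M.φ := MorphismProperty.of_isPullback H.flip inferInstance
  have : Surjective M.φ := MorphismProperty.of_isPullback H.flip inferInstance
  refine IsVariety.of_isIntegralHom M.φ _ ?_
  -- The morphism `φ` is not `k`-linear but linear over `σ`. Since `σ` is an automorphism, `X` with
  -- the twisted structure morphism is still a variety.
  have h : M.φ ≫ M.f₀ ≫ s = (M.f ≫ s) ≫ specFrob k p := by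
    rw [← Category.assoc, M.φ_comm, Category.assoc, frob_comp, Category.assoc]
  rw [h]
  exact M.isVariety.comp_isIso _

lemma isVariety_twistf₀ [PerfectField k] (hS : IsVariety s) :
    IsVariety (M.twistf₀ ≫ twistStr p s) := by
  have := isIso_specFrob k p
  refine IsVariety.of_comp_isIso (specFrob k p) ?_
  have h : (M.twistf₀ ≫ twistStr p s) ≫ specFrob k p =
      pullback.fst M.f₀ (twistProj p s) ≫ M.f₀ ≫ s := by
    rw [Category.assoc, ← pullback.condition, ← Category.assoc, ← pullback.condition,
      Category.assoc]
  rw [h]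
  exact (M.isVariety_f₀ hS).isIso_comp _

end FontaineModule

/-! ### The canonical connection -/

section Canonical

variable {X Y S B T T' : Scheme.{u}} {π : X ⟶ Y} {f : X ⟶ S} {g : Y ⟶ B} {F : S ⟶ B}

/-- A vector field on a fibre product is determined by its values on the functions that come from
the factors. -/
lemma VectorField.eq_of_isPullback (H : IsPullback π f g F) {x : X ⟶ T} {V : X.Opens}
    {U : S.Opens} (hV : V ≤ f ⁻¹ᵁ U) {E E' : VectorField x V}
    (hp : ∀ (W' : Y.Opens) (W : X.Opens) (hW : W ≤ V) (hWW' : W ≤ π ⁻¹ᵁ W') (y : Γ(Y, W')),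
      E.app W hW ((π.appLE W' W hWW').hom y) = E'.app W hW ((π.appLE W' W hWW').hom y))
    (hq : ∀ (W' : S.Opens) (_ : W' ≤ U) (W : X.Opens) (hW : W ≤ V) (hWW' : W ≤ f ⁻¹ᵁ W')
      (a : Γ(S, W')),
      E.app W hW ((f.appLE W' W hWW').hom a) = E'.app W hW ((f.appLE W' W hWW').hom a)) :
    E = E' := by
  ext W hW a
  refine VectorField.app_eq_of_isPullback H ?_ ?_ W hW a
  · ext W' W hW hW' b
    exact hp W' W hW hW' b
  · ext W' W hW hW' b
    have i : W ≤ f ⁻¹ᵁ (W' ⊓ U) := le_inf_preimage hW' (hW.trans hV)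
    have h := hq (W' ⊓ U) inf_le_right W hW i (res S inf_le_left b)
    rw [appLE_res] at h
    exact h

variable {k : Type u} [Field k] (p : ℕ) [Fact p.Prime] [CharP k p] {s : S ⟶ Spec (.of k)}

/-- Vector fields kill functions that are pulled back along Frobenius. -/
lemma VectorField.app_frob_comp {r : S ⟶ B} (hr : frob p s ≫ r = F) {x : S ⟶ T} {V : S.Opens}
    (D : VectorField x V) (W : S.Opens) (hW : W ≤ V) (W' : B.Opens) (hW' : W ≤ F ⁻¹ᵁ W')
    (b : Γ(B, W')) : D.app W hW ((F.appLE W' W hW').hom b) = 0 := by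
  have i : W ≤ r ⁻¹ᵁ W' := le_preimage_of_comp hr hW'
  rw [← appLE_comp_eq hr (V := W) i (frob_preimage s W).ge hW', frob_appLE s _ le_rfl, res_self]
  have h := (D.along (𝟙 S)).app_pow W W hW (le_preimage_id le_rfl) ((r.appLE W' W i).hom b) p
  rwa [D.along_id_app, natCast_eq_zero p s W, zero_mul] at h

/-- Zero on `O_Y` and `D` on `O_S` agree on `O_B`, because functions pulled back along `F` are
`p`-th powers and `D` kills them. The factorization through `r` covers the absolute Frobenius, with
`r` the identity, and the relative one, with `r` the inverse of the projection. -/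
lemma exists_canonical [PerfectField k] (H : IsPullback π f g F) {r : S ⟶ B}
    (hr : frob p s ≫ r = F) (U : S.Opens) (D : VectorField s U) :
    ∃ E : VectorField (f ≫ s) (f ⁻¹ᵁ U),
      (∀ (W' : Y.Opens) (W : X.Opens) (hW : W ≤ f ⁻¹ᵁ U) (hWW' : W ≤ π ⁻¹ᵁ W') (y : Γ(Y, W')),
        E.app W hW ((π.appLE W' W hWW').hom y) = 0) ∧ Related f E D := by
  obtain ⟨δ, hδ₁, hδ₂⟩ := ADer.exists_of_isPullback H (Category.id_comp π) (Category.id_comp f)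
    rfl H.w.symm ((0 : VectorField (f ≫ s) (f ⁻¹ᵁ U)).along π) (D.pull f le_rfl) (by
      rw [VectorField.along_comp]
      ext W' W hW hW' b
      have i : W ≤ f ⁻¹ᵁ (F ⁻¹ᵁ W') := le_preimage_of_comp H.w.symm hW'
      rw [D.pull_comp_app f le_rfl F (π ≫ g) H.w.symm W' W hW hW' b (F ⁻¹ᵁ W' ⊓ U) inf_le_left
        inf_le_right (le_inf_preimage i hW), D.app_frob_comp p hr, map_zero]
      rfl)
  let E : VectorField (f ≫ s) (f ⁻¹ᵁ U) := δ.toVectorField (f ≫ s)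
    fun _ _ _ _ _ => ADer.app_eq_zero_of_perfect p _ _ _ _ _ _
  refine ⟨E, fun W' W hW hWW' y => ?_, ?_⟩
  · rw [← E.along_app, δ.toVectorField_along, hδ₁]
    rfl
  · rw [related_iff le_rfl, δ.toVectorField_along, hδ₂]

/-- The canonical connection on a base change along a Frobenius morphism. -/
noncomputable def canonicalConnection [PerfectField k] (H : IsPullback π f g F) {r : S ⟶ B}
    (hr : frob p s ≫ r = F) : Connection f s where
  toFun U D := (exists_canonical p H hr U D).choose
  map_add U D E := by
    have hD := (exists_canonical p H hr U D).choose_spec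
    have hE := (exists_canonical p H hr U E).choose_spec
    have hDE := (exists_canonical p H hr U (D + E)).choose_spec
    refine VectorField.eq_of_isPullback H le_rfl (fun W' W hW hWW' y => ?_)
      (fun W' hW' W hW hWW' a => ?_)
    · rw [VectorField.add_app, hDE.1, hD.1, hE.1, add_zero]
    · rw [VectorField.add_app, hDE.2 W' hW', hD.2 W' hW', hE.2 W' hW', VectorField.add_app,
        _root_.map_add]
  map_smul U c D := by
    have hD := (exists_canonical p H hr U D).choose_spec
    have hcD := (exists_canonical p H hr U (c • D)).choose_spec
    refine VectorField.eq_of_isPullback H le_rfl (fun W' W hW hWW' y => ?_)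
      (fun W' hW' W hW hWW' a => ?_)
    · rw [VectorField.smul_app, hcD.1, hD.1, mul_zero]
    · rw [VectorField.smul_app, hcD.2 W' hW', hD.2 W' hW', VectorField.smul_app,
        _root_.map_mul, appLE_res, Scheme.Hom.app_eq_appLE, res_appLE]
  map_res U U' h D := by
    have hD := (exists_canonical p H hr U D).choose_spec
    have hD' := (exists_canonical p H hr U' (D.restrict h)).choose_spec
    refine VectorField.eq_of_isPullback H le_rfl (fun W' W hW hWW' y => ?_)
      (fun W' hW' W hW hWW' a => ?_)
    · rw [VectorField.restrict_app, hD'.1, hD.1]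
    · rw [VectorField.restrict_app, hD'.2 W' hW', hD.2 W' (hW'.trans h), VectorField.restrict_app]
  proj U D W hW V hV hVW a := by
    rw [map_one, one_mul]
    exact (exists_canonical p H hr U D).choose_spec.2 W hW V hV hVW a

lemma isCanonical_canonicalConnection [PerfectField k] (H : IsPullback π f g F) {r : S ⟶ B}
    (hr : frob p s ≫ r = F) : IsCanonical π (canonicalConnection p H hr) :=
  fun U D => (exists_canonical p H hr U D).choose_spec.1

lemma IsCanonical.unique (H : IsPullback π f g F) {s : S ⟶ T} {N N' : Connection f s}
    (hN : IsCanonical π N) (hN' : IsCanonical π N') : N = N' := by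
  ext1
  funext U D
  refine VectorField.eq_of_isPullback H le_rfl (fun W' W hW hWW' y => ?_)
    (fun W' hW' W hW hWW' a => ?_)
  · rw [hN, hN']
  · rw [N.proj U D W' hW', N'.proj U D W' hW']

end Canonical

/-! ### The inverse Cartier transform -/

section Value

variable {X Y S B T T' : Scheme.{u}} {π : X ⟶ Y} {f : X ⟶ S} {F : S ⟶ B} {g : Y ⟶ B}
  {b : B ⟶ T} {x : X ⟶ T'} {θ : HiggsField g b} {U : S.Opens} {δ : DerivationAlong F b U}
  {E : VectorField x (f ⁻¹ᵁ U)}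

lemma LConnection.neg_app {X S T : Scheme.{u}} {f : X ⟶ S} {s : S ⟶ T} (N : HiggsField f s) (U)
    (D : VectorField s U) (W hW a) : (N.neg.toFun U D).app W hW a = -(N.toFun U D).app W hW a := rfl

lemma IsPullbackValue.neg (H : IsPullbackValue π f F θ δ E) :
    IsPullbackValue π f F θ.neg δ (-E) := by
  intro V U' hU' n c D hD W' hW' W hW hWW' y
  rw [VectorField.neg_app, H V U' hU' n c D hD W' hW' W hW hWW' y, ← Finset.sum_neg_distrib]
  refine Finset.sum_congr rfl fun i _ => ?_
  rw [LConnection.neg_app, map_neg, mul_neg]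

/-- The condition sees only values on `O_Y`, so it cannot distinguish a connection from its
difference with the canonical one. -/
lemma IsPullbackValue.add_left (H : IsPullbackValue π f F θ δ E)
    {E₀ : VectorField x (f ⁻¹ᵁ U)}
    (h₀ : ∀ (W' : Y.Opens) (W : X.Opens) (hW : W ≤ f ⁻¹ᵁ U) (hWW' : W ≤ π ⁻¹ᵁ W') (y : Γ(Y, W')),
      E₀.app W hW ((π.appLE W' W hWW').hom y) = 0) : IsPullbackValue π f F θ δ (E₀ + E) := by
  intro V U' hU' n c D hD W' hW' W hW hWW' y
  rw [VectorField.add_app, h₀, zero_add, H V U' hU' n c D hD W' hW' W hW hWW' y]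

/-- Pullback values are transported along isomorphisms of the source. -/
lemma IsPullbackValue.of_isIso (H : IsPullbackValue π f F θ δ E) {X₁ T₁ : Scheme.{u}} {h : X ⟶ X₁}
    [IsIso h] {π₁ : X₁ ⟶ Y} {f₁ : X₁ ⟶ S} (hπ : h ≫ π₁ = π) (hf : h ≫ f₁ = f) {x₁ : X₁ ⟶ T₁}
    {E₁ : VectorField x₁ (f₁ ⁻¹ᵁ U)} (hE : Related h E E₁) : IsPullbackValue π₁ f₁ F θ δ E₁ := by
  intro V U' hU' n c D hD W' hW' W hW hWW' y
  have i₁ : h ⁻¹ᵁ W ≤ f ⁻¹ᵁ U' := preimage_comp_le hf le_rfl hW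
  have i₂ : h ⁻¹ᵁ W ≤ π ⁻¹ᵁ W' := preimage_comp_le hπ le_rfl hWW'
  have i₃ : f ⁻¹ᵁ U' ≤ f ⁻¹ᵁ U := f.preimage_mono hU'
  apply appLE_injective_of_isIso h W le_rfl le_rfl
  have h₁ := H V U' hU' n c D hD W' hW' (h ⁻¹ᵁ W) i₁ i₂ y
  rw [← hE W _ (h ⁻¹ᵁ W) (i₁.trans i₃) le_rfl, appLE_comp_eq hπ hWW' le_rfl i₂, h₁, map_sum]
  refine Finset.sum_congr rfl fun i _ => ?_
  rw [_root_.map_mul, appLE_comp_eq hf hW le_rfl i₁, appLE_comp_eq hπ hWW' le_rfl i₂]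

/-- Decompositions are transported along isomorphisms of the target. -/
lemma IsDecomposition.comp {U' : S.Opens} {hU' : U' ≤ U} {n : ℕ} {c : Fin n → Γ(S, U')}
    {V : B.Opens} {D : Fin n → VectorField b V} (H : IsDecomposition δ hU' c D) {B₁ T₁ : Scheme.{u}}
    {q : B ⟶ B₁} {F₁ : S ⟶ B₁} (hF : F ≫ q = F₁) {b₁ : B₁ ⟶ T₁} {e : T ⟶ T₁}
    (he : b ≫ e = q ≫ b₁) {V₁ : B₁.Opens} (hV : V ≤ q ⁻¹ᵁ V₁) {D₁ : Fin n → VectorField b₁ V₁}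
    (hD : ∀ i, Related q (D i) (D₁ i)) : IsDecomposition (δ.comp hF he) hU' c D₁ := by
  refine ⟨preimage_comp_le hF H.1 hV, fun W' hW' W hW hWW' a => ?_⟩
  have i₁ : W ≤ F ⁻¹ᵁ (V ⊓ q ⁻¹ᵁ W') :=
    le_inf_preimage (hW.trans H.1) (le_preimage_of_comp hF hWW')
  rw [δ.comp_app hF he (hW.trans hU') hWW' inf_le_right i₁,
    H.2 (V ⊓ q ⁻¹ᵁ W') inf_le_left W hW i₁]
  refine Finset.sum_congr rfl fun i _ => ?_
  rw [hD i W' hW' _ inf_le_left inf_le_right, appLE_comp_eq hF inf_le_right i₁ hWW']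

/-- Pullback values are transported along isomorphisms of the target. -/
lemma IsPullbackValue.of_isIso_base {B₁ Y₁ T₁ : Scheme.{u}} {q : B ⟶ B₁} [IsIso q] {F₁ : S ⟶ B₁}
    (hF : F ≫ q = F₁) {b₁ : B₁ ⟶ T₁} {e : T ⟶ T₁} [IsIso e] (he : b ≫ e = q ≫ b₁) {q₀ : Y ⟶ Y₁}
    [IsIso q₀] {π₁ : X ⟶ Y₁} (hπ : π ≫ q₀ = π₁) {g₁ : Y₁ ⟶ B₁} (hg : g ≫ q = q₀ ≫ g₁)
    {θ₁ : HiggsField g₁ b₁} (hθ : IsBaseChange q₀ q θ₁ θ)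
    (H : IsPullbackValue π₁ f F₁ θ₁ (δ.comp hF he) E) : IsPullbackValue π f F θ δ E := by
  intro V U' hU' n c D hD W' hW' W hW hWW' y
  let D₁ : Fin n → VectorField b₁ ((inv q) ⁻¹ᵁ V) := fun i =>
    (D i).pullOpen (inv q) le_rfl (inv_str he)
  have hD₁ : ∀ i, Related q (D i) (D₁ i) := fun i => by
    have h := ((D i).related_pullOpen (inv q) le_rfl (inv_str he)).inv
    rwa [IsIso.inv_inv] at h
  have hdec := hD.comp hF he (le_preimage_inv q V) hD₁
  have hq₀ : q₀ ≫ inv q₀ = 𝟙 _ := IsIso.hom_inv_id _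
  let W₁ : Y₁.Opens := (inv q₀) ⁻¹ᵁ W'
  have hW₁ : W' ≤ q₀ ⁻¹ᵁ W₁ := le_preimage_inv q₀ W'
  have i₁ : W₁ ≤ g₁ ⁻¹ᵁ ((inv q) ⁻¹ᵁ V) := by
    have h : inv q₀ ≫ g = g₁ ≫ inv q := by
      rw [IsIso.inv_comp_eq, ← Category.assoc, ← hg, Category.assoc, IsIso.hom_inv_id,
        Category.comp_id]
    exact le_preimage_of_comp h.symm (preimage_comp_le rfl le_rfl hW')
  have i₂ : W ≤ π₁ ⁻¹ᵁ W₁ := preimage_comp_le hπ hWW' hW₁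
  obtain ⟨y₁, rfl⟩ : ∃ y₁ : Γ(Y₁, W₁), (q₀.appLE W₁ W' hW₁).hom y₁ = y := by
    refine ⟨((inv q₀).appLE W' W₁ le_rfl).hom y, ?_⟩
    rw [appLE_comp_eq hq₀ le_rfl hW₁ (le_preimage_id le_rfl), id_appLE _ le_rfl, res_self]
  rw [appLE_comp_eq hπ hW₁ hWW' i₂, H _ U' hU' n c D₁ hdec W₁ i₁ W hW i₂ y₁]
  refine Finset.sum_congr rfl fun i _ => ?_
  rw [hθ _ V (le_preimage_inv q V) _ _ (hD₁ i) W₁ i₁ W' hW' hW₁, appLE_comp_eq hπ hW₁ hWW' i₂]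

end Value

/-! ### Uniqueness of the pulled back Higgs field and collapse of the series. -/

section Unique

variable {k : Type u} [Field k] [PerfectField k] {p : ℕ} [Fact p.Prime] [CharP k p]
  {X Y S B T : Scheme.{u}} {π : X ⟶ Y} {f : X ⟶ S} {F : S ⟶ B} {g : Y ⟶ B}
  {b : B ⟶ Spec (.of k)} [Smooth b] {s : S ⟶ Spec (.of k)} {q : B ⟶ S}
  {zeta : ∀ {U : S.Opens}, VectorField s U → DerivationAlong F b U → Prop}

/-- The relation `zeta` is defined locally on all vector fields. -/
def IsLocallyTotal {S B T T' : Scheme.{u}} {F : S ⟶ B} {b : B ⟶ T} {s : S ⟶ T'}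
    (zeta : ∀ {U : S.Opens}, VectorField s U → DerivationAlong F b U → Prop) : Prop :=
  ∀ (U : S.Opens) (D : VectorField s U) (x : S), x ∈ U → ∃ (V : S.Opens) (h : V ≤ U)
    (δ : DerivationAlong F b V), x ∈ V ∧ zeta (D.restrict h) δ

lemma HiggsField.app_appLE {X S T : Scheme.{u}} {f : X ⟶ S} {s : S ⟶ T} (Φ : HiggsField f s)
    (U : S.Opens) (D : VectorField s U) (W : S.Opens) (hW : W ≤ U) (V : X.Opens)
    (hV : V ≤ f ⁻¹ᵁ U) (hVW : V ≤ f ⁻¹ᵁ W) (a : Γ(S, W)) :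
    (Φ.toFun U D).app V hV ((f.appLE W V hVW).hom a) = 0 := by
  rw [Φ.proj U D W hW, map_zero, zero_mul]

lemma HiggsField.app_appLE' {X S T : Scheme.{u}} {f : X ⟶ S} {s : S ⟶ T} (Φ : HiggsField f s)
    (U : S.Opens) (D : VectorField s U) (W : S.Opens) (V : X.Opens)
    (hV : V ≤ f ⁻¹ᵁ U) (hVW : V ≤ f ⁻¹ᵁ W) (a : Γ(S, W)) :
    (Φ.toFun U D).app V hV ((f.appLE W V hVW).hom a) = 0 := by
  have i : V ≤ f ⁻¹ᵁ (W ⊓ U) := le_inf_preimage hVW hV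
  have h := Φ.app_appLE U D (W ⊓ U) inf_le_right V hV i (res S inf_le_left a)
  rwa [appLE_res] at h

lemma LConnection.restrict_toFun {X S T : Scheme.{u}} {f : X ⟶ S} {s : S ⟶ T} {lam : Γ(T, ⊤)}
    (N : LConnection f s lam) {U U' : S.Opens} (h : U' ≤ U) (D : VectorField s U) (W : X.Opens)
    (hW : W ≤ f ⁻¹ᵁ U') (a : Γ(X, W)) :
    (N.toFun U' (D.restrict h)).app W hW a =
      (N.toFun U D).app W (hW.trans (f.preimage_mono h)) a := by
  rw [N.map_res]
  rfl

/-- The Higgs field `(π^* θ) ∘ (f^* ζ)` is unique. -/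
theorem IsPullbackHiggs.unique (p : ℕ) [Fact p.Prime] [CharP k p]
    (H : IsPullback π f g F) (hz : IsLocallyTotal zeta)
    {θ : HiggsField g b} {Φ Φ' : HiggsField f s} (hΦ : IsPullbackHiggs π zeta θ Φ)
    (hΦ' : IsPullbackHiggs π zeta θ Φ') : Φ = Φ' := by
  ext1
  funext U D
  refine VectorField.ext_local fun y hy => ?_
  obtain ⟨U₁, hU₁, δ, hyU₁, hδ⟩ := hz U D (f y) hy
  obtain ⟨V, U', hU', n, c, E, hyU', -, hE⟩ :=
    exists_isDecomposition p δ hyU₁ (W₀ := ⊤) trivial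
  refine ⟨f ⁻¹ᵁ U', f.preimage_mono (hU'.trans hU₁), hyU', ?_⟩
  refine VectorField.eq_of_isPullback (U := U') H le_rfl (fun W' W hW hWW' y => ?_)
    (fun W' hW' W hW hWW' a => ?_)
  -- On functions from `Y` a decomposition of `ζ(D)` prescribes the value of both Higgs fields; on
  -- functions from `S` both vanish.
  · have i : W ≤ π ⁻¹ᵁ (g ⁻¹ᵁ V) := by
      refine le_preimage_of_comp H.w (preimage_comp_le rfl hW hE.1)
    have i' : W ≤ π ⁻¹ᵁ (W' ⊓ g ⁻¹ᵁ V) := le_inf_preimage hWW' i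
    have h₁ := hΦ U₁ _ δ hδ V U' hU' n c E hE (W' ⊓ g ⁻¹ᵁ V) inf_le_right W hW i'
      (res Y inf_le_left y)
    have h₂ := hΦ' U₁ _ δ hδ V U' hU' n c E hE (W' ⊓ g ⁻¹ᵁ V) inf_le_right W hW i'
      (res Y inf_le_left y)
    rw [← h₂, LConnection.restrict_toFun, LConnection.restrict_toFun, appLE_res] at h₁
    exact h₁
  · rw [VectorField.restrict_app, VectorField.restrict_app, Φ.app_appLE', Φ'.app_appLE']

lemma VectorField.res_iterate {X T : Scheme.{u}} {x : X ⟶ T} {V : X.Opens} (D : VectorField x V)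
    {W W' : X.Opens} (h : W' ≤ W) (hW : W ≤ V) (n : ℕ) (a : Γ(X, W)) :
    res X h ((D.app W hW)^[n] a) = (D.app W' (h.trans hW))^[n] (res X h a) := by
  induction n generalizing a with
  | zero => rfl
  | succ n ih => rw [Function.iterate_succ_apply, Function.iterate_succ_apply, ih, D.app_map h hW]

/-- The `p`-th power of `(π^* θ) ∘ (f^* ζ)` vanishes if that of `θ` does. -/
theorem IsPullbackHiggs.powZero (H : IsPullback π f g F) (hz : IsLocallyTotal zeta)
    {θ : HiggsField g b} (hθ : θ.Integrable) (hθp : θ.PowZero p 1) {Φ : HiggsField f s}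
    (hΦ : IsPullbackHiggs π zeta θ Φ) : Φ.PowZero p 1 := by
  intro U D W hW a
  rw [pow_one]
  refine section_ext fun y hy => ?_
  obtain ⟨U₁, hU₁, δ, hyU₁, hδ⟩ := hz U D (f y) (hW hy)
  refine ⟨W ⊓ f ⁻¹ᵁ U₁, inf_le_left, ⟨hy, hyU₁⟩, ?_⟩
  have h := iterate_prime_eq_zero_of_isPullbackValue H (s := s) hθ hθp (hΦ U₁ _ δ hδ)
    (fun W' V hV hVW a => Φ.app_appLE' U₁ _ W' V hV hVW a) (W ⊓ f ⁻¹ᵁ U₁) inf_le_right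
    (res X inf_le_left a)
  rw [Φ.map_res] at h
  rw [VectorField.res_iterate, map_zero]
  exact h

/-- If the `p`-th power of `Φ` vanishes, then so does its Frobenius iterate. -/
theorem IsFrobeniusIterate.eq_zero [IsIso q] {e : Spec (.of k) ⟶ Spec (.of k)} [IsIso e]
    (he : b ≫ e = q ≫ s) (hq : F ≫ q = frob p s) (hz : IsLocallyTotal zeta) {Φ Φ' : HiggsField f s}
    (hΦ : Φ.PowZero p 1) (h : IsFrobeniusIterate p q zeta Φ Φ') (U : S.Opens)
    (D : VectorField s U) : Φ'.toFun U D = 0 := by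
  refine VectorField.ext_local fun y hy => ?_
  obtain ⟨U₁, hU₁, δ, hyU₁, hδ⟩ := hz U D (f y) hy
  obtain ⟨V, U', hU', n, c, E, hyU', -, hE⟩ :=
    exists_isDecomposition p δ hyU₁ (W₀ := ⊤) trivial
  -- The decomposition of `ζ(D)` uses fields on `B`, whereas the iterate evaluates `Φ` at fields on
  -- `S`. They are transported along the isomorphism `q`.
  let V₁ : S.Opens := (inv q) ⁻¹ᵁ V
  have hV₁ : q ⁻¹ᵁ V₁ ≤ V := by
    refine le_of_eq ?_
    rw [← Scheme.Hom.comp_preimage, IsIso.hom_inv_id]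
    rfl
  have hV₁' : V ≤ q ⁻¹ᵁ V₁ := le_preimage_inv q V
  -- The composite of `F` and `q` is the absolute Frobenius, which is the identity on points.
  have hU'V₁ : U' ≤ V₁ := (preimage_comp_le hq hE.1 hV₁').trans (frob_preimage s V₁).le
  let E₁ : Fin n → VectorField s V₁ := fun i => (E i).pullOpen (inv q) le_rfl (inv_str he)
  have hrel : ∀ i, Related q ((E i).restrict hV₁) (E₁ i) := fun i => by
    have h := ((E i).related_pullOpen (inv q) le_rfl (inv_str he)).inv
    rw [IsIso.inv_inv] at h
    exact h.restrict hV₁ le_rfl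
  have hdec : IsDecomposition δ hU' c fun i => (E i).restrict hV₁ :=
    ⟨hE.1.trans (F.preimage_mono hV₁'), fun W' hW' => hE.2 W' (hW'.trans hV₁)⟩
  refine ⟨f ⁻¹ᵁ U' ⊓ f ⁻¹ᵁ V₁, inf_le_left.trans (f.preimage_mono (hU'.trans hU₁)),
    ⟨hyU', hU'V₁ hyU'⟩, ?_⟩
  · ext W hW a
    have h' := h U₁ _ δ hδ V₁ U' hU' n c E₁ _ hrel hdec W (hW.trans inf_le_left)
      (hW.trans inf_le_right) a
    rw [LConnection.restrict_toFun] at h'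
    refine h'.trans ?_
    rw [VectorField.restrict_app, VectorField.zero_app]
    refine Finset.sum_eq_zero fun i _ => ?_
    have h₀ := hΦ V₁ (E₁ i) W (hW.trans inf_le_right) a
    rw [pow_one] at h₀
    rw [h₀, mul_zero]

/-- The inverse Cartier transform of a Higgs field whose `p`-th power vanishes is
`∇_can - (π^* θ) ∘ (f^* ζ)`. -/
theorem isInverseCartier_iff [IsIso q] {e : Spec (.of k) ⟶ Spec (.of k)} [IsIso e]
    (H : IsPullback π f g F) (he : b ≫ e = q ≫ s) (hq : F ≫ q = frob p s)
    (hz : IsLocallyTotal zeta) {θ : HiggsField g b} (hθ : θ.Integrable) (hθp : θ.PowZero p 1)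
    {can : Connection f s} {Φ : HiggsField f s} (hcan : IsCanonical π can)
    (hΦ : IsPullbackHiggs π zeta θ Φ) {N : Connection f s} :
    IsInverseCartier p π q zeta θ N ↔
      ∀ U D W hW x, (N.toFun U D).app W hW x =
        (can.toFun U D).app W hW x - (Φ.toFun U D).app W hW x := by
  have hp : 0 < p := (Fact.out : p.Prime).pos
  have hΦp := hΦ.powZero H hz hθ hθp
  constructor
  · rintro ⟨can', Ψ, n, hcan', hΨ, hfrob, hn, hN⟩ U D W hW x
    obtain rfl := hcan.unique H hcan'
    obtain rfl := hΨ.unique p H hz hΦ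
    -- The first iterate vanishes because `[p] ∘ Φ = 0`. A zero Higgs field has zero `p`-th power as
    -- `p > 0`, so vanishing propagates to all later terms.
    have hzero : ∀ m, 1 ≤ m → ∀ (U : S.Opens) (D : VectorField s U), (Ψ m).toFun U D = 0 := by
      intro m hm
      induction m, hm using Nat.le_induction with
      | base => exact (hfrob 0).eq_zero he hq hz hΦp
      | succ m hm ih =>
        refine (hfrob m).eq_zero he hq hz fun U D W hW x => ?_
        rw [ih, pow_one, ← Nat.succ_pred_eq_of_pos hp, Function.iterate_succ_apply']
        rfl
    rw [hN, sub_right_inj]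
    -- The bound `n = 0` is admissible. The sum is then empty, but the vanishing condition covers
    -- the term of index zero as well.
    rcases Nat.eq_zero_or_pos n with rfl | hn'
    · rw [Finset.sum_range_zero, hn 0 le_rfl]
      rfl
    · rw [Finset.sum_eq_single_of_mem 0 (Finset.mem_range.mpr hn')]
      intro m _ hm
      rw [hzero m (Nat.one_le_iff_ne_zero.mpr hm)]
      rfl
  · intro hN
    -- The constant sequence zero after `Φ` is a sequence of iterates, because both `Φ` and the zero
    -- field have vanishing `p`-th power.
    refine ⟨can, fun m => if m = 0 then Φ else HiggsField.zero f s, 1, hcan, hΦ, fun m => ?_,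
      fun m hm U D => ?_, fun U D W hW x => ?_⟩
    · beta_reduce
      rw [if_neg (Nat.succ_ne_zero m)]
      intro U D δ _ V U' hU' n c E E' _ _ W hW hWV x
      refine (Finset.sum_eq_zero fun i _ => ?_).symm
      split_ifs
      · have h₀ := hΦp V (E i) W hWV x
        rw [pow_one] at h₀
        rw [h₀, mul_zero]
      · rw [← Nat.succ_pred_eq_of_pos hp, Function.iterate_succ_apply']
        exact mul_zero _
    · beta_reduce
      rw [if_neg (Nat.one_le_iff_ne_zero.mp hm)]
      rfl
    · rw [Finset.sum_range_one]
      beta_reduce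
      rw [if_pos rfl]
      exact hN U D W hW x

end Unique

/-! ### `ζ` for the absolute and for the relative Frobenius. -/

section Zeta

variable {k : Type u} [Field k] {p : ℕ} [Fact p.Prime] [CharP k p]
  {S : Scheme.{u}} {s : S ⟶ Spec (.of k)} (L : FrobeniusLifting p s)

lemma twistStr_comp : twistStr p s ≫ specFrob k p = twistProj p s ≫ s := pullback.condition.symm

namespace FrobeniusLifting

lemma relF_fst : L.relF ≫ pullback.fst L.str (specW2Frob k p) = L.F := pullback.lift_fst _ _ _

lemma inclTwist_fst :
    L.inclTwist ≫ pullback.fst L.str (specW2Frob k p) = twistProj p s ≫ L.incl :=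
  pullback.lift_fst _ _ _

variable [PerfectField k]

lemma isLocallyTotal_isZeta :
    IsLocallyTotal (IsZeta p (b := s) (s := s) (frob p s) L.incl L.incl L.F L.str) := by
  intro U D x hx
  obtain ⟨U₁, hU₁, hU₁U, hxU₁⟩ := L.exists_affine U hx
  obtain ⟨δ, hδ⟩ := L.exists_zeta hU₁ (D.restrict hU₁U)
  exact ⟨_, hU₁U, δ, hxU₁, hδ⟩

/-- As `σ` and `W₂(σ)` are automorphisms, the projections `S' ⟶ S` and `S̃' ⟶ S̃` are isomorphisms.
Composing the absolute `ζ` with their inverses gives the relative one. -/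
lemma isLocallyTotal_isZeta_relFrob : IsLocallyTotal
    (IsZeta p (b := twistStr p s) (s := s) (relFrob p s) L.incl L.inclTwist L.relF L.str) := by
  intro U D x hx
  have := isIso_specFrob k p
  have := isIso_specW2Frob k p
  obtain ⟨V, hV, δ, hxV, hδ⟩ := L.isLocallyTotal_isZeta U D x hx
  have hF : frob p s ≫ inv (twistProj p s) = relFrob p s := by
    rw [IsIso.comp_inv_eq, relFrob_proj]
  have hF₂ : L.F ≫ inv (pullback.fst L.str (specW2Frob k p)) = L.relF := by
    rw [IsIso.comp_inv_eq, relF_fst]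
  have hi : L.incl ≫ inv (pullback.fst L.str (specW2Frob k p)) =
      inv (twistProj p s) ≫ L.inclTwist := by
    rw [IsIso.comp_inv_eq, Category.assoc, inclTwist_fst, IsIso.inv_hom_id_assoc]
  exact ⟨V, hV, δ.comp hF (inv_str twistStr_comp), hxV, hδ.comp hF _ hF₂ hi⟩

end FrobeniusLifting

end Zeta

lemma appTop_id {T : Scheme.{u}} {lam : Γ(T, ⊤)} : (𝟙 T : T ⟶ T).appTop.hom lam = lam := by
  rw [Scheme.Hom.id_appTop]
  rfl

/-- The transport of a `λ`-connection along an isomorphism over `S`. -/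
lemma exists_transport {X X' S T : Scheme.{u}} {f : X ⟶ S} {f' : X' ⟶ S} {s : S ⟶ T}
    {lam : Γ(T, ⊤)} (N : LConnection f s lam) (h : X ⟶ X') [IsIso h] (hf : h ≫ f' = f) :
    ∃ N' : LConnection f' s lam, IsBaseChange (inv h) (𝟙 S) N N' ∧
      ∀ (U : S.Opens) (D : VectorField s U), Related h (N.toFun U D) (N'.toFun U D) := by
  have hf' : f' ≫ 𝟙 S = inv h ≫ f := by
    rw [Category.comp_id, IsIso.eq_inv_comp, hf]
  have hs : s ≫ 𝟙 T = 𝟙 S ≫ s := by rw [Category.comp_id, Category.id_comp]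
  have H := N.transport_isBaseChange hf' hs appTop_id
  refine ⟨_, H, fun U D => ?_⟩
  have hD : Related (𝟙 S) D D := by
    intro W' hW' W hW hWW' b
    have i : W ≤ W' := hWW'
    rw [id_appLE hWW' i, id_appLE hWW' i]
    exact D.app_map i hW' b
  have hr := (H U U (le_preimage_id le_rfl) D D hD).inv
  rwa [IsIso.inv_inv] at hr

lemma LConnection.Integrable.neg {X S T : Scheme.{u}} {f : X ⟶ S} {s : S ⟶ T}
    {N : HiggsField f s} (h : N.Integrable) : LConnection.Integrable N.neg := by
  intro U D E W hW x
  have h' := h U D E W hW x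
  rw [map_zero, zero_mul] at h' ⊢
  rw [VectorField.bracket_app] at h' ⊢
  rw [N.neg_app, N.neg_app, N.neg_app, N.neg_app, VectorField.app_neg, VectorField.app_neg, neg_neg,
    neg_neg, h']

lemma LConnection.PowZero.neg {X S T : Scheme.{u}} {f : X ⟶ S} {s : S ⟶ T}
    {N : HiggsField f s} {p n : ℕ} (h : N.PowZero p n) : N.neg.PowZero p n := by
  intro U D W hW x
  have key : ∀ m : ℕ, ((N.neg.toFun U D).app W hW)^[m] x = ((N.toFun U D).app W hW)^[m] x ∨
      ((N.neg.toFun U D).app W hW)^[m] x = -((N.toFun U D).app W hW)^[m] x := by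
    intro m
    induction m with
    | zero => exact Or.inl rfl
    | succ m ih =>
      rw [Function.iterate_succ_apply', Function.iterate_succ_apply', N.neg_app]
      rcases ih with ih | ih
      · exact Or.inr (by rw [ih])
      · exact Or.inl (by rw [ih, VectorField.app_neg, neg_neg])
  have h' := h U D W hW x
  rcases key (p ^ n) with e | e
  · rw [e, h']
  · rw [e, h', neg_zero]

/-! ### The connection of a Fontaine module in terms of `θ`. -/

namespace FontaineModule

variable {p : ℕ} [Fact p.Prime] {k : Type u} [Field k] [CharP k p] {S : Scheme.{u}}
  {s : S ⟶ Spec (.of k)} {L : FrobeniusLifting p s} (M : FontaineModule L)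

/-- The morphism `X ⟶ q^* X₀` induced by `φ`. -/
noncomputable abbrev toTwist : M.X ⟶ pullback M.f₀ (twistProj p s) :=
  pullback.lift M.φ (M.f ≫ relFrob p s) (by
    rw [Category.assoc, relFrob_proj]; exact M.φ_comm)

lemma toTwist_fst : M.toTwist ≫ pullback.fst M.f₀ (twistProj p s) = M.φ :=
  pullback.lift_fst _ _ _

/-- The Cartesian square of `φ` over the absolute Frobenius is cut by the square that defines `q^*
X₀`; cancelling the latter leaves a Cartesian square over the relative Frobenius. -/
lemma isPullback_toTwist : IsPullback M.toTwist M.f M.twistf₀ (relFrob p s) := by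
  have H := M.isPullback_φ
  refine IsPullback.of_right (h₁₂ := pullback.fst M.f₀ (twistProj p s)) (h₂₂ := twistProj p s)
    (v₁₃ := M.f₀) ?_ (pullback.lift_snd _ _ _) (IsPullback.of_hasPullback _ _)
  rwa [toTwist_fst, relFrob_proj]

lemma toCartier_fst : M.toCartier ≫ pullback.fst M.twistf₀ (relFrob p s) = M.toTwist :=
  pullback.lift_fst _ _ _

lemma toCartier_snd : M.toCartier ≫ M.cartierf₀ = M.f := pullback.lift_snd _ _ _

lemma isIso_toCartier : IsIso M.toCartier := by
  have h : M.toCartier = M.isPullback_toTwist.isoPullback.hom := by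
    apply pullback.hom_ext
    · rw [toCartier_fst, IsPullback.isoPullback_hom_fst]
    · exact M.toCartier_snd.trans (IsPullback.isoPullback_hom_snd _).symm
  rw [h]
  infer_instance

lemma isIso_ψ : IsIso M.ψ := M.isIso_φ

lemma ψ_fst : M.ψ ≫ pullback.fst M.f₀ (frob p s) = M.φ := pullback.lift_fst _ _ _

lemma ψ_snd : M.ψ ≫ pullback.snd M.f₀ (frob p s) = M.f := pullback.lift_snd _ _ _

variable [PerfectField k]

/-- The connection `∇` is `∇_can + (π^* θ) ∘ ζ` on `F_S^* X₀`. -/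
theorem exists_isCanonical_isPullbackHiggs :
    ∃ (can : Connection (pullback.snd M.f₀ (frob p s)) s)
      (Φ : HiggsField (pullback.snd M.f₀ (frob p s)) s),
      IsCanonical (pullback.fst M.f₀ (frob p s)) can ∧
      IsPullbackHiggs (pullback.fst M.f₀ (frob p s))
        (IsZeta p (frob p s) L.incl L.incl L.F L.str) M.θ Φ ∧
      ∀ (U : S.Opens) (D : VectorField s U),
        Related M.ψ (M.conn.toFun U D) (can.toFun U D + Φ.toFun U D) := by
  have := M.isIso_ψ
  obtain ⟨N, -, hN⟩ := exists_transport M.conn M.ψ M.ψ_snd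
  let can := canonicalConnection p (IsPullback.of_hasPullback M.f₀ (frob p s))
    (Category.comp_id (frob p s))
  have hcan : IsCanonical (pullback.fst M.f₀ (frob p s)) can :=
    isCanonical_canonicalConnection p _ _
  refine ⟨can, N.sub can, hcan, fun U D δ hδ => ?_, fun U D => ?_⟩
  -- The Higgs field is the difference of the transported connection and the canonical one.
  -- Parallelism gives the values of the former on `O_{X₀}`, and the latter contributes nothing
  -- there.
  · have h := (M.parallel U D δ hδ).of_isIso M.ψ_fst M.ψ_snd (hN U D)
    have h' := h.add_left (E₀ := -can.toFun U D) fun W' W hW hWW' y => by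
      rw [VectorField.neg_app, hcan, neg_zero]
    have e : (N.sub can).toFun U D = -can.toFun U D + N.toFun U D := by
      ext W hW x
      exact add_comm _ _
    rwa [e]
  · have e : can.toFun U D + (N.sub can).toFun U D = N.toFun U D := by
      ext W hW x
      rw [VectorField.add_app, LConnection.sub_app, add_sub_cancel]
    rw [e]
    exact hN U D

/-- The Higgs field on `q^* X₀ ×_{S'} S` attached to `q^* (f₀, -θ)` is the difference of the
canonical connection and the connection transported from `X`. -/
theorem isPullbackHiggs_sub {θ' : HiggsField M.twistf₀ (twistStr p s)}
    (hθ' : IsBaseChange (pullback.fst _ _) (twistProj p s) M.θ.neg θ')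
    {can N : Connection M.cartierf₀ s} (hcan : IsCanonical (pullback.fst _ _) can)
    (hN : ∀ (U : S.Opens) (D : VectorField s U),
      Related M.toCartier (M.conn.toFun U D) (N.toFun U D)) :
    IsPullbackHiggs (pullback.fst _ _)
      (IsZeta p (relFrob p s) L.incl L.inclTwist L.relF L.str) θ' (can.sub N) := by
  have := isIso_specFrob k p
  have := M.isIso_toCartier
  intro U D δ hδ
  -- Composing with `q` turns `ζ` for the relative Frobenius into `ζ` for `F_S`, to which the
  -- parallelism condition refers. The result then returns to `q^* X₀` by base change along the
  -- isomorphism `q`.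
  have hδ' := hδ.comp (relFrob_proj p s) twistStr_comp L.relF_fst L.inclTwist_fst
  -- The sign of `-θ` is matched by that of `N` in `can - N`.
  have h₁ := (M.parallel U D _ hδ').neg
  have h₂ := IsPullbackValue.of_isIso_base (relFrob_proj p s) twistStr_comp M.toTwist_fst
    pullback.condition.symm hθ' h₁
  have h₃ := h₂.of_isIso M.toCartier_fst M.toCartier_snd (hN U D).neg
  exact h₃.add_left fun W' W hW hWW' y => hcan U D W' W hW hWW' y

theorem isNilpotentHiggsVariety_f₀ (hS : IsVariety s) [Flat s] (hM : M.StrictPTorsion) :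
    IsNilpotentHiggsVariety p M.θ.neg :=
  ⟨M.isVariety_f₀ hS, M.integrable_θ.neg, 1, LConnection.PowZero.neg hM⟩

end FontaineModule

end NFM

/-! ### The main theorem. -/

theorem proposition6p5 {k : Type u} [Field k] [PerfectField k] (p : ℕ) [Fact p.Prime] [CharP k p]
    {S : Scheme.{u}} (s : S ⟶ Spec (.of k)) (hS : NFM.IsVariety s) (hs : Smooth s)
    (L : NFM.FrobeniusLifting p s) (M : NFM.FontaineModule L) (hM : M.StrictPTorsion) :
    -- the pair `(f₀, -θ)` is a nilpotent Higgs variety over `S`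
    NFM.IsNilpotentHiggsVariety p M.θ.neg ∧
    -- it has a unique pullback along `q`
    (∃! θ' : NFM.HiggsField M.twistf₀ (NFM.twistStr p s),
      NFM.IsBaseChange (pullback.fst _ _) (NFM.twistProj p s) M.θ.neg θ') ∧
    (∀ θ' : NFM.HiggsField M.twistf₀ (NFM.twistStr p s),
      NFM.IsBaseChange (pullback.fst _ _) (NFM.twistProj p s) M.θ.neg θ' →
      -- this pullback `q^* (f₀, -θ)` is a nilpotent Higgs variety over `S'`
      NFM.IsNilpotentHiggsVariety p θ' ∧
      -- it has a unique inverse Cartier transform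
      (∃! C : NFM.Connection M.cartierf₀ s,
        NFM.IsInverseCartier p (pullback.fst _ _) (NFM.twistProj p s)
          (NFM.IsZeta p (NFM.relFrob p s) L.incl L.inclTwist L.relF L.str) θ' C) ∧
      -- which is isomorphic to `(f, ∇)` by means of the Frobenius structure
      ∀ C : NFM.Connection M.cartierf₀ s,
        NFM.IsInverseCartier p (pullback.fst _ _) (NFM.twistProj p s)
          (NFM.IsZeta p (NFM.relFrob p s) L.incl L.inclTwist L.relF L.str) θ' C →
        NFM.IsFoliatedVariety C ∧ NFM.IsConnectionIso M.toCartier M.conn C) ∧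
    -- explicitly, `ψ` identifies `X` with `F_S^* X₀` and `∇` with `∇_can + π^* θ ∘ ζ`
    IsIso M.ψ ∧ M.ψ ≫ pullback.snd M.f₀ (NFM.frob p s) = M.f ∧
    ∃ (can : NFM.Connection (pullback.snd M.f₀ (NFM.frob p s)) s)
      (Φ : NFM.HiggsField (pullback.snd M.f₀ (NFM.frob p s)) s),
      NFM.IsCanonical (pullback.fst M.f₀ (NFM.frob p s)) can ∧
      NFM.IsPullbackHiggs (pullback.fst M.f₀ (NFM.frob p s))
        (NFM.IsZeta p (NFM.frob p s) L.incl L.incl L.F L.str) M.θ Φ ∧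
      ∀ (U : S.Opens) (D : NFM.VectorField s U),
        NFM.Related M.ψ (M.conn.toFun U D) (can.toFun U D + Φ.toFun U D) := by
  have := NFM.isIso_specFrob k p
  have hX₀ := M.isNilpotentHiggsVariety_f₀ hS hM
  have hf : M.twistf₀ ≫ NFM.twistProj p s =
      pullback.fst M.f₀ (NFM.twistProj p s) ≫ M.f₀ := pullback.condition.symm
  have htw : NFM.twistStr p s ≫ NFM.specFrob k p = NFM.twistProj p s ≫ s := NFM.twistStr_comp
  refine ⟨hX₀, ⟨M.θ.neg.transport hf htw (map_zero _),
    M.θ.neg.transport_isBaseChange hf htw (map_zero _),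
    fun θ' hθ' => hθ'.unique hf htw (M.θ.neg.transport_isBaseChange hf htw (map_zero _))⟩,
    fun θ' hθ' => ?_, M.isIso_ψ, M.ψ_snd, M.exists_isCanonical_isPullbackHiggs⟩
  have hint : θ'.Integrable := hθ'.integrable hf htw (map_zero _) hX₀.integrable
  have hpow : θ'.PowZero p 1 := hθ'.powZero hf htw (NFM.LConnection.PowZero.neg hM)
  have := M.isIso_toCartier
  obtain ⟨N, hN, hrel⟩ := NFM.exists_transport M.conn M.toCartier M.toCartier_snd
  have H := IsPullback.of_hasPullback M.twistf₀ (NFM.relFrob p s)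
  have hr : NFM.frob p s ≫ inv (NFM.twistProj p s) = NFM.relFrob p s := by
    rw [IsIso.comp_inv_eq, NFM.relFrob_proj]
  have hcan := NFM.isCanonical_canonicalConnection p H hr
  -- The role of the pulled back Higgs field is played by `can - N`, where `N` is the connection
  -- transported from `X`. The transform is therefore `can - (can - N) = N`, which settles
  -- existence, uniqueness and the comparison at once.
  have hiff := fun C => NFM.isInverseCartier_iff (N := C) H htw (NFM.relFrob_proj p s)
    L.isLocallyTotal_isZeta_relFrob hint hpow hcan (M.isPullbackHiggs_sub hθ' hcan hrel)
  have hCN : ∀ C : NFM.Connection M.cartierf₀ s,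
      NFM.IsInverseCartier p (pullback.fst _ _) (NFM.twistProj p s)
        (NFM.IsZeta p (NFM.relFrob p s) L.incl L.inclTwist L.relF L.str) θ' C ↔ C = N := by
    intro C
    rw [hiff]
    constructor
    · intro h
      ext U D W hW x
      rw [h, NFM.LConnection.sub_app, sub_sub_cancel]
    · rintro rfl U D W hW x
      rw [NFM.LConnection.sub_app, sub_sub_cancel]
  refine ⟨⟨M.isVariety_twistf₀ hS, hint, 1, hpow⟩, ⟨N, (hCN N).mpr rfl, fun C => (hCN C).mp⟩,
    fun C hC => ?_⟩
  obtain rfl := (hCN C).mp hC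
  refine ⟨⟨?_, ?_⟩, inferInstance, M.toCartier_snd, hrel⟩
  -- The transform lives on an isomorphic copy of `X`, so being a variety and integrability are
  -- inherited from `(f, ∇)`.
  · have h := M.isVariety.isIso_comp (inv M.toCartier)
    rwa [← Category.assoc, ← M.toCartier_snd, IsIso.inv_hom_id_assoc] at h
  · exact hN.integrable (f' := M.cartierf₀) (e := 𝟙 _)
      (by rw [Category.comp_id, IsIso.eq_inv_comp, M.toCartier_snd])
      (by rw [Category.comp_id, Category.id_comp]) NFM.appTop_id M.integrable
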